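/- Let $\mathbb K=\mathbb R$ or $\mathbb C$ and $n\ge 2$. Fix one of the following categories: $C^\infty$-smooth ($\mathbb K=\mathbb R$), or $\mathbb K$-analytic. All germs are at $0$ and, like the diffeomorphism-germs, belong to this category. Definitions. A *singular symplectic form-germ* on $\mathbb K^{2n}$ is a closed $2$-form-germ $\omega$ such that the set $\Sigma_2=\{\omega^n=0\}$ (its Martinet hypersurface) is nowhere dense near $0$. Write $\omega^n=f\,\Omega$ with $\Omega$ the germ of a volume form and $f$ a function-germ; $\Sigma_2=\{f=0\}$ is *structurally smooth at $0$* if $f(0)=0$ and $df|_0\neq 0$. In that case the rank of the pullback of $\omega$ to $\Sigma_2$ at $0$ is the rank of the bilinear form $\omega|_0$ restricted to $T_0\Sigma_2=\ker df|_0$. Let $(p_1,\dots,p_n,q_1,\dots,q_n)$ be the coordinates on $\mathbb K^{2n}$, identify $\{p_1=0\}$ with $\mathbb K^{2n-1}$, and let $\iota:\{p_1=0\}\hookrightarrow\mathbb K^{2n}$ be the inclusion and $\pi:\mathbb K^{2n}\to\{p_1=0\}$, $\pi(p_1,p_2,\dots,p_n,q_1,\dots,q_n)=(p_2,\dots,p_n,q_1,\dots,q_n)$,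 the projection. Call a pair $(\alpha,\sigma)$ *admissible* if $\sigma$ is a closed $2$-form-germ on $\{p_1=0\}$ with $\operatorname{rank}(\sigma|_0)\le 2n-4$ and $\alpha$ is a $1$-form-germ on $\{p_1=0\}$ with $$\alpha\wedge\sigma^{n-1}=0\qquad\text{and}\qquad \alpha\wedge d\alpha\wedge\sigma^{n-2}|_0\neq 0 .$$ (a) Let $\omega$ be a singular symplectic form-germ on $\mathbb K^{2n}$ whose Martinet hypersurface $\Sigma_2$ is structurally smooth at $0$, and suppose that the pullback of $\omega$ to $\Sigma_2$ has rank at most $2n-4$ at $0$. Then there exist a diffeomorphism-germ $\Phi:(\mathbb K^{2n},0)\to(\mathbb K^{2n},0)$ and a $1$-form-germ $\alpha$ on $\{p_1=0\}$ such that, with $\sigma=\iota^*\Phi^*\omega$, the pair $(\alpha,\sigma)$ is admissible and $$\Phi^*\omega=d(p_1\,\pi^*\alpha)+\pi^*\sigma .$$ (b) Let $(\alpha_0,\sigma)$ and $(\alpha_1,\sigma)$ be admissible pairs with the same $\sigma$, and put $\omega_i=d(p_1\,\pi^*\alpha_i)+\pi^*\sigma$ for $i=0,1$. Suppose that 1.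 if $\mathbb K=\mathbb R$, then $\alpha_1\wedge d\alpha_1\wedge\sigma^{n-2}|_0=c\;\alpha_0\wedge d\alpha_0\wedge\sigma^{n-2}|_0$ for some real number $c>0$; 2. $\alpha_1|_0\wedge\alpha_0|_0\wedge\sigma^{n-2}|_0=0$. Then there exists a diffeomorphism-germ $\Psi:(\mathbb K^{2n},0)\to(\mathbb K^{2n},0)$ such that $\Psi^*\omega_1=\omega_0$. -/

import Mathlib

open Filter Topology

noncomputable section

namespace SingularSymplectic

/-! ### Exterior algebra at a point -/

section Pointwise

variable {𝕜 : Type*} [Field 𝕜] {V : Type*} [AddCommGroup V] [Module 𝕜 V]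

/-- The exterior product of two alternating forms (sum over shuffles, so that
`(a ∧ b)(v, w) = a v * b w - a w * b v` for two 1-forms). -/
def wedge {k l : ℕ} (a : V [⋀^Fin k]→ₗ[𝕜] 𝕜) (b : V [⋀^Fin l]→ₗ[𝕜] 𝕜) :
    V [⋀^Fin (k + l)]→ₗ[𝕜] 𝕜 :=
  ((LinearMap.mul' 𝕜 𝕜).compAlternatingMap (a.domCoprod b)).domDomCongr finSumFinEquiv

/-- The exterior power `b ∧ ⋯ ∧ b` (`k` factors) of a 2-form; for `k = 0` it is the constant `1`. -/
def wedgePow (b : V [⋀^Fin 2]→ₗ[𝕜] 𝕜) : (k : ℕ) → V [⋀^Fin (2 * k)]→ₗ[𝕜] 𝕜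
  | 0 => (AlternatingMap.constOfIsEmpty 𝕜 V (Fin 0) 1 : V [⋀^Fin 0]→ₗ[𝕜] 𝕜)
  | k + 1 => wedge (wedgePow b k) b

/-- The rank of a 2-form `b`: the rank of the linear map `v ↦ b(v, ·)`. -/
def formRank (b : V [⋀^Fin 2]→ₗ[𝕜] 𝕜) : ℕ :=
  Module.finrank 𝕜 (LinearMap.range (AlternatingMap.curryLeft (n := 1) b))

end Pointwise

/-! ### Germs at `0` of maps and of differential forms

A germ at `0` is represented by a globally defined function, of which only the values near `0`
matter. The regularity `r` is `∞` (smooth category) or `ω = ⊤` (analytic category). -/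

section Germs

variable {𝕜 : Type*} [RCLike 𝕜]
variable {E : Type*} [NormedAddCommGroup E] [NormedSpace 𝕜 E]
variable {F : Type*} [NormedAddCommGroup F] [NormedSpace 𝕜 F]

/-- `f` is of class `C^r` on some neighbourhood of `0`. -/
def IsGerm (𝕜 : Type*) [RCLike 𝕜] {E F : Type*} [NormedAddCommGroup E] [NormedSpace 𝕜 E]
    [NormedAddCommGroup F] [NormedSpace 𝕜 F] (r : WithTop ℕ∞) (f : E → F) : Prop :=
  ∀ᶠ x in 𝓝 (0 : E), ContDiffAt 𝕜 r f x

/-- `Φ : (E, 0) → (E, 0)` is a diffeomorphism-germ of class `C^r`: it has a two-sided inverse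
map-germ of class `C^r`. -/
def IsDiffeoGerm (𝕜 : Type*) [RCLike 𝕜] {E : Type*} [NormedAddCommGroup E] [NormedSpace 𝕜 E]
    (r : WithTop ℕ∞) (Φ : E → E) : Prop :=
  IsGerm 𝕜 r Φ ∧ Φ 0 = 0 ∧
    ∃ Ψ : E → E, IsGerm 𝕜 r Ψ ∧ Ψ 0 = 0 ∧
      (∀ᶠ x in 𝓝 (0 : E), Ψ (Φ x) = x) ∧ (∀ᶠ x in 𝓝 (0 : E), Φ (Ψ x) = x)

/-- The pullback `Φ^* w` of a differential `k`-form. -/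
def pullback {k : ℕ} (Φ : E → F) (w : F → F [⋀^Fin k]→L[𝕜] 𝕜) : E → E [⋀^Fin k]→L[𝕜] 𝕜 :=
  fun x => (w (Φ x)).compContinuousLinearMap (fderiv 𝕜 Φ x)

/-- `w` is a closed 2-form-germ at `0` of class `C^r`. -/
def IsClosedTwoFormGerm (r : WithTop ℕ∞) (w : E → E [⋀^Fin 2]→L[𝕜] 𝕜) : Prop :=
  IsGerm 𝕜 r w ∧ ∀ᶠ x in 𝓝 (0 : E), extDeriv w x = 0

/-- The value at `x` of the `2k`-form `w^k = w ∧ ⋯ ∧ w`. -/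
def powAt (w : E → E [⋀^Fin 2]→L[𝕜] 𝕜) (k : ℕ) (x : E) : E [⋀^Fin (2 * k)]→ₗ[𝕜] 𝕜 :=
  wedgePow (w x).toAlternatingMap k

/-- The value at `x` of the form `α ∧ dα ∧ σ^k`. -/
def contactAt (α : E → E [⋀^Fin 1]→L[𝕜] 𝕜) (σ : E → E [⋀^Fin 2]→L[𝕜] 𝕜) (k : ℕ) (x : E) :
    E [⋀^Fin (1 + 2 + 2 * k)]→ₗ[𝕜] 𝕜 :=
  wedge (wedge (α x).toAlternatingMap (extDeriv α x).toAlternatingMap) (powAt σ k x)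

end Germs

/-! ### Singular symplectic form-germs on `𝕂^{2n}` -/

/-- The space `𝕂^{2n-1}` with coordinates `(p₂, …, pₙ, q₁, …, qₙ)`. -/
abbrev Hyp (𝕜 : Type*) (n : ℕ) : Type _ := Fin (2 * n - 1) → 𝕜

/-- The space `𝕂^{2n} = 𝕂 × 𝕂^{2n-1}` (for `n ≥ 1`); the first component is the
coordinate `p₁`. -/
abbrev Amb (𝕜 : Type*) (n : ℕ) : Type _ := 𝕜 × Hyp 𝕜 n

section Forms

variable {𝕜 : Type*} [RCLike 𝕜] {n : ℕ}

/-- The inclusion `ι` of `{p₁ = 0} = 𝕂^{2n-1}` into `𝕂^{2n}`. -/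
def incl (y : Hyp 𝕜 n) : Amb 𝕜 n := (0, y)

/-- The projection `π` of `𝕂^{2n}` onto `{p₁ = 0} = 𝕂^{2n-1}`. -/
def proj (x : Amb 𝕜 n) : Hyp 𝕜 n := x.2

/-- `w` is a singular symplectic form-germ at `0` on `𝕂^{2n}`: a closed 2-form-germ whose
degeneracy set `{w^n = 0}` (the Martinet hypersurface) is nowhere dense near `0`. -/
def IsSingularSymplecticGerm (r : WithTop ℕ∞) (w : Amb 𝕜 n → Amb 𝕜 n [⋀^Fin 2]→L[𝕜] 𝕜) : Prop :=
  IsClosedTwoFormGerm r w ∧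
    ∃ U ∈ 𝓝 (0 : Amb 𝕜 n), IsNowhereDense (U ∩ {x | powAt w n x = 0})

/-- `w^n = f Ω` near `0`, where `f` is a function-germ and `Ω` is the germ at `0` of a volume form
on `𝕂^{2n}`; thus `{f = 0}` is the Martinet hypersurface of `w`. -/
def IsMartinetFunction (r : WithTop ℕ∞) (w : Amb 𝕜 n → Amb 𝕜 n [⋀^Fin 2]→L[𝕜] 𝕜)
    (f : Amb 𝕜 n → 𝕜) : Prop :=
  IsGerm 𝕜 r f ∧
    ∃ Ω : Amb 𝕜 n → Amb 𝕜 n [⋀^Fin (2 * n)]→L[𝕜] 𝕜,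
      IsGerm 𝕜 r Ω ∧ Ω 0 ≠ 0 ∧
        ∀ᶠ x in 𝓝 (0 : Amb 𝕜 n), powAt w n x = f x • (Ω x).toAlternatingMap

/-- The Martinet hypersurface `{f = 0}`, where `w^n = f Ω`, is structurally smooth at `0`. -/
def IsStructurallySmooth (r : WithTop ℕ∞) (w : Amb 𝕜 n → Amb 𝕜 n [⋀^Fin 2]→L[𝕜] 𝕜)
    (f : Amb 𝕜 n → 𝕜) : Prop :=
  IsMartinetFunction r w f ∧ f 0 = 0 ∧ fderiv 𝕜 f 0 ≠ 0

/-- The rank at `0` of the pullback of `w` to the smooth hypersurface-germ `{f = 0}`, that is, of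
the restriction of `w|₀` to the tangent space `ker df₀`. -/
def restrictedRank (w : Amb 𝕜 n → Amb 𝕜 n [⋀^Fin 2]→L[𝕜] 𝕜) (f : Amb 𝕜 n → 𝕜) : ℕ :=
  formRank ((w 0).toAlternatingMap.compLinearMap
    (LinearMap.ker (fderiv 𝕜 f 0 : Amb 𝕜 n →ₗ[𝕜] 𝕜)).subtype)

/-- The 2-form `d(p₁ π^* α) + π^* σ` on `𝕂^{2n}`. -/
def normalForm (α : Hyp 𝕜 n → Hyp 𝕜 n [⋀^Fin 1]→L[𝕜] 𝕜)
    (σ : Hyp 𝕜 n → Hyp 𝕜 n [⋀^Fin 2]→L[𝕜] 𝕜) : Amb 𝕜 n → Amb 𝕜 n [⋀^Fin 2]→L[𝕜] 𝕜 :=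
  fun x => extDeriv (fun z : Amb 𝕜 n => z.1 • pullback (proj : Amb 𝕜 n → Hyp 𝕜 n) α z) x
    + pullback (proj : Amb 𝕜 n → Hyp 𝕜 n) σ x

/-- The conditions on the pair `(α, σ)` in the normal form: `σ` is a closed 2-form-germ on
`𝕂^{2n-1}` of rank at most `2n - 4` at `0`, and `α` is a 1-form-germ on `𝕂^{2n-1}` with
`α ∧ σ^{n-1} = 0` and `α ∧ dα ∧ σ^{n-2}|₀ ≠ 0`. -/
structure IsAdmissible (r : WithTop ℕ∞) (α : Hyp 𝕜 n → Hyp 𝕜 n [⋀^Fin 1]→L[𝕜] 𝕜)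
    (σ : Hyp 𝕜 n → Hyp 𝕜 n [⋀^Fin 2]→L[𝕜] 𝕜) : Prop where
  closed : IsClosedTwoFormGerm r σ
  rank_le : formRank (σ 0).toAlternatingMap ≤ 2 * n - 4
  germ : IsGerm 𝕜 r α
  wedge_eq_zero : ∀ᶠ y in 𝓝 (0 : Hyp 𝕜 n),
    wedge (α y).toAlternatingMap (powAt σ (n - 1) y) = 0
  contact_ne_zero : contactAt α σ (n - 2) 0 ≠ 0

end Forms

end SingularSymplectic

end

open Filter Topology

set_option maxSynthPendingDepth 3

noncomputable section

namespace SingularSymplectic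

-- Part (a). Straighten the Martinet hypersurface to {p₁ = 0}, let σ be the restriction of ω to it
-- and α the restriction of ∂_{p₁} ⌟ ω. The form d(p₁π^*α) + π^*σ agrees with ω at every point of
-- {p₁ = 0}, so the relative Poincaré lemma (`exists_relative_primitive`) writes the difference as
-- d(p₁β) with β zero there, and Moser's method should remove it. The field must satisfy V_t ⌟ ω_t =
-- -p₁β, while ω_t itself degenerates along {p₁ = 0}; solving this regularly is the crux,
-- `exists_field_solving`. Differentiating ω^n = p₁Ω at 0 gives n ω^{n-1} ∧ ∂_{p₁}ω = Ω ≠ 0. Hence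
-- the radical of ω|₀ is a plane on which ∂_{p₁}ω is nonzero (`exists_radical_basis_of_martinet`).
-- Bordering ω_t by two linear forms dual to that plane makes it invertible, and the obstruction to
-- inverting ω_t is then one function s, vanishing on {p₁ = 0} to exactly first order; so p₁/s is
-- regular. The rank hypothesis puts the radical plane inside {p₁ = 0}
-- (`fst_eq_zero_of_mem_radical`). On it ∂_{p₁}ω equals dα because dω = 0, which yields the contact
-- condition; the equation α ∧ σ^{n-1} = 0 expresses degeneracy of ω along {p₁ = 0}
-- (`wedge_wedgePow_eq_zero_iff`, `bordered_degenerate_iff`). Part (b). The two forms differ by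
-- d(p₁π^*(α₁ - α₀)), so β = π^*(α₁ - α₀) need not vanish on {p₁ = 0}. Degeneracy of ω_t there
-- survives because α ∧ σ^{n-1} = 0 is linear in α. Condition 2 makes α₁ proportional to α₀ on the
-- radical of σ|₀; rescaling p₁ makes the factor 1, so β kills the radical of every ω_t|₀ and V_t
-- vanishes at 0. Nondegeneracy of ω_t is the nonvanishing of an affine function of t: the sign
-- condition secures it on [0,1] over ℝ, and over ℂ the parameter goes around its only possible zero
-- (`exists_preconnected_ne_zero`). Analysis. Both fields and both categories are handled at once:
-- trajectories solve γ = x + ε∫W(γ) in the Banach space of paths, and the inverse function theorem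
-- applies there because superposition operators are smooth or analytic. Time is a real s in [0,1]
-- and ε lies in 𝕜, so a complex deformation parameter needs no separate theory.

universe u

/-! ### Superposition operators on spaces of continuous paths. -/

section Superposition

variable {𝕜 : Type*} [RCLike 𝕜]
variable {K : Type*} [TopologicalSpace K]
variable {Z : Type u} [NormedAddCommGroup Z] [NormedSpace 𝕜 Z]
variable {F : Type u} [NormedAddCommGroup F] [NormedSpace 𝕜 F]

/-- The superposition operator `γ ↦ h ∘ γ` on continuous maps (with value `0` where the
composition is not continuous). -/
def superpos (h : Z → F) (γ : C(K, Z)) : C(K, F) :=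
  open Classical in if hc : Continuous (h ∘ γ) then ⟨h ∘ γ, hc⟩ else 0

theorem superpos_apply {h : Z → F} {U : Set Z} (hU : IsOpen U) (hh : ContinuousOn h U)
    {γ : C(K, Z)} (hγ : ∀ k, γ k ∈ U) (k : K) : superpos h γ k = h (γ k) := by
  have hc : Continuous (h ∘ γ) := by
    rw [continuous_iff_continuousAt]
    intro k
    exact (hh.continuousAt (hU.mem_nhds (hγ k))).comp γ.continuous.continuousAt
  simp [superpos, hc]

variable [CompactSpace K]

theorem isOpen_setOf_forall_mem {U : Set Z} (hU : IsOpen U) :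
    IsOpen {γ : C(K, Z) | ∀ k, γ k ∈ U} := by
  have := ContinuousMap.isOpen_setOfPred_mapsTo (X := K) (Y := Z) isCompact_univ hU
  convert this using 3
  simp [Set.MapsTo]

variable (𝕜 K Z F) in
/-- The continuous linear map sending a path of operators to the multiplication operator. -/
def applyPath : C(K, Z →L[𝕜] F) →L[𝕜] C(K, Z) →L[𝕜] C(K, F) :=
  LinearMap.mkContinuous₂
    (LinearMap.mk₂ 𝕜 (fun (A : C(K, Z →L[𝕜] F)) (γ : C(K, Z)) =>
        (⟨fun k => A k (γ k), by fun_prop⟩ : C(K, F)))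
      (fun _ _ _ => by ext; simp) (fun _ _ _ => by ext; simp)
      (fun _ _ _ => by ext; simp) (fun _ _ _ => by ext; simp)) 1
    (fun A γ => by
      rw [ContinuousMap.norm_le _ (by positivity)]
      intro k
      rw [one_mul]
      exact ((A k).le_opNorm _).trans
        (mul_le_mul (A.norm_coe_le_norm k) (γ.norm_coe_le_norm k) (norm_nonneg _) (norm_nonneg A)))

@[simp]
theorem applyPath_apply (A : C(K, Z →L[𝕜] F)) (γ : C(K, Z)) (k : K) :
    applyPath 𝕜 K Z F A γ k = A k (γ k) := rfl

/-- The image of a path is compact, so `fderiv h` is uniformly continuous at its points; the mean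
value inequality then bounds the remainder uniformly in `k`, which is the bound in sup norm. -/
theorem hasFDerivAt_superpos {h : Z → F} {U : Set Z} (hU : IsOpen U)
    (hd : DifferentiableOn 𝕜 h U) (hc : ContinuousOn (fderiv 𝕜 h) U)
    {γ : C(K, Z)} (hγ : ∀ k, γ k ∈ U) :
    HasFDerivAt (superpos h) (applyPath 𝕜 K Z F (superpos (fderiv 𝕜 h) γ)) γ := by
  let _ : NormedSpace ℝ Z := NormedSpace.restrictScalars ℝ 𝕜 Z
  rw [hasFDerivAt_iff_isLittleO_nhds_zero, Asymptotics.isLittleO_iff]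
  intro ε hε
  have hK : IsCompact (Set.range γ) := isCompact_range γ.continuous
  have h1 := hK.uniformContinuousAt_of_continuousAt (fderiv 𝕜 h)
    (r := {p | dist p.1 p.2 < ε})
    (by rintro _ ⟨k, rfl⟩; exact hc.continuousAt (hU.mem_nhds (hγ k))) (Metric.dist_mem_uniformity hε)
  obtain ⟨δ₁, hδ₁, h1⟩ := Metric.mem_uniformity_dist.1 h1
  obtain ⟨δ₂, hδ₂, h2⟩ := hK.exists_thickening_subset_open hU
    (by rintro _ ⟨k, rfl⟩; exact hγ k)
  have hsub : ∀ k, Metric.ball (γ k) δ₂ ⊆ U := fun k z hz =>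
    h2 (Metric.mem_thickening_iff.2 ⟨γ k, ⟨k, rfl⟩, hz⟩)
  filter_upwards [Metric.ball_mem_nhds (0 : C(K, Z)) (lt_min hδ₁ hδ₂)] with η hη
  rw [mem_ball_zero_iff] at hη
  rw [ContinuousMap.norm_le _ (by positivity)]
  intro k
  have hk : ‖η k‖ < min δ₁ δ₂ := (η.norm_coe_le_norm k).trans_lt hη
  have hmem : ∀ k, (γ + η) k ∈ U := fun k => hsub k (by
    simpa [mem_ball_iff_norm] using
      ((η.norm_coe_le_norm k).trans_lt hη).trans_le (min_le_right _ _))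
  simp only [ContinuousMap.sub_apply, applyPath_apply, superpos_apply hU hc hγ,
    superpos_apply hU hd.continuousOn hγ, superpos_apply hU hd.continuousOn hmem]
  have key := Convex.norm_image_sub_le_of_norm_hasFDerivWithin_le' (𝕜 := 𝕜) (f := h)
    (f' := fderiv 𝕜 h) (φ := fderiv 𝕜 h (γ k)) (C := ε) (s := Metric.ball (γ k) (min δ₁ δ₂))
    (x := γ k) (y := γ k + η k) (fun z hz => ?_) (fun z hz => ?_) (convex_ball _ _)
    (Metric.mem_ball_self (lt_min hδ₁ hδ₂)) (by simpa [mem_ball_iff_norm] using hk)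
  · simp only [add_sub_cancel_left] at key
    exact key.trans (mul_le_mul_of_nonneg_left (η.norm_coe_le_norm k) hε.le)
  · have hz' : z ∈ U := hsub k (Metric.ball_subset_ball (min_le_right _ _) hz)
    exact ((hd z hz').differentiableAt (hU.mem_nhds hz')).hasFDerivAt.hasFDerivWithinAt
  · rw [← dist_eq_norm, dist_comm]
    refine (h1 ?_ ⟨k, rfl⟩).le
    rw [dist_comm]
    exact (Metric.mem_ball.1 hz).trans_le (min_le_left _ _)

/-- The derivative of a superposition operator is a fixed continuous linear map applied to the
superposition operator of `fderiv h`, so regularity propagates by induction. The target changes from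
`F` to `Z →L[𝕜] F` at each step, hence `F` is generalized and shares its universe with `Z`. -/
theorem contDiffOn_superpos_nat (n : ℕ) {h : Z → F} {U : Set Z} (hU : IsOpen U)
    (hh : ContDiffOn 𝕜 ((⊤ : ℕ∞) : WithTop ℕ∞) h U) :
    ContDiffOn 𝕜 n (superpos h) {γ : C(K, Z) | ∀ k, γ k ∈ U} := by
  induction n generalizing F with
  | zero =>
    have h2 := ((contDiffOn_infty_iff_fderiv_of_isOpen hU).1 hh)
    simp only [Nat.cast_zero, contDiffOn_zero]
    exact fun γ hγ => (hasFDerivAt_superpos hU h2.1 h2.2.continuousOn hγ).continuousAt.continuousWithinAt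
  | succ n ih =>
    have h2 := ((contDiffOn_infty_iff_fderiv_of_isOpen hU).1 hh)
    have hd : ∀ γ ∈ {γ : C(K, Z) | ∀ k, γ k ∈ U}, HasFDerivAt (superpos h) _ γ :=
      fun γ hγ => hasFDerivAt_superpos hU h2.1 h2.2.continuousOn hγ
    push_cast
    rw [contDiffOn_succ_iff_fderiv_of_isOpen (isOpen_setOf_forall_mem hU)]
    refine ⟨fun γ hγ => (hd γ hγ).differentiableAt.differentiableWithinAt, by simp, ?_⟩
    refine ((applyPath 𝕜 K Z F).contDiff.comp_contDiffOn (ih h2.2)).congr fun γ hγ => ?_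
    rw [(hd γ hγ).fderiv]
    rfl

/-- The power series of a superposition operator at a constant path. -/
def superposSeries (K : Type*) [TopologicalSpace K] [CompactSpace K]
    (p : FormalMultilinearSeries 𝕜 Z F) :
    FormalMultilinearSeries 𝕜 C(K, Z) C(K, F) := fun n =>
  MultilinearMap.mkContinuous
    { toFun := fun m => (⟨fun k => p n fun i => m i k, by fun_prop⟩ : C(K, F))
      map_update_add' := fun m i x y => by
        ext k
        have (z : C(K, Z)) : (fun j => (Function.update m i z) j k) =
            Function.update (fun j => m j k) i (z k) := by
          ext j; by_cases h : j = i
          · subst h; simp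
          · simp [h]
        simp [this]
      map_update_smul' := fun m i c x => by
        ext k
        have (z : C(K, Z)) : (fun j => (Function.update m i z) j k) =
            Function.update (fun j => m j k) i (z k) := by
          ext j; by_cases h : j = i
          · subst h; simp
          · simp [h]
        simp [this] }
    ‖p n‖ (fun m => by
      rw [ContinuousMap.norm_le _ (by positivity)]
      intro k
      refine ((p n).le_opNorm _).trans ?_
      gcongr with i
      exact (m i).norm_coe_le_norm k)

/-- At a constant path a single power series of `h` serves every `k`, and applying it pointwise does
not shrink the radius. Constant base paths suffice: analyticity is an open condition. -/
theorem analyticAt_superpos [CompleteSpace F] {h : Z → F} {z₀ : Z} (hh : AnalyticAt 𝕜 h z₀) :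
    AnalyticAt 𝕜 (superpos h) (ContinuousMap.const K z₀) := by
  obtain ⟨p, r, hp⟩ := hh
  have hle : p.radius ≤ (superposSeries K p).radius :=
    FormalMultilinearSeries.radius_le_of_le fun n =>
      MultilinearMap.mkContinuous_norm_le _ (norm_nonneg _) _
  refine ⟨superposSeries K p, r, hp.r_le.trans hle, hp.r_pos, fun {γ} hγ => ?_⟩
  have hk : ∀ k, γ k ∈ Metric.eball (0 : Z) r := fun k => by
    rw [Metric.mem_eball, edist_zero_right] at hγ ⊢
    refine lt_of_le_of_lt ?_ hγ
    rw [← ofReal_norm, ← ofReal_norm]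
    exact ENNReal.ofReal_le_ofReal (γ.norm_coe_le_norm k)
  have hs := (superposSeries K p).hasSum
    (Metric.eball_subset_eball (hp.r_le.trans hle) hγ)
  convert hs using 1
  ext k
  have h1 := ((ContinuousMap.evalCLM 𝕜 k : C(K, F) →L[𝕜] F).hasSum hs)
  have hcont := hp.continuousOn
  rw [superpos_apply Metric.isOpen_eball hcont (fun k => ?_)]
  · exact (hp.hasSum (hk k)).unique h1
  · have := hk k
    rw [Metric.mem_eball, edist_zero_right] at this
    simpa [Metric.mem_eball, edist_eq_enorm_sub] using this

/-- Differentiability class of a map on a neighbourhood of a point. -/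
def SmoothNear (𝕜 : Type*) [RCLike 𝕜] {E F : Type*} [NormedAddCommGroup E] [NormedSpace 𝕜 E]
    [NormedAddCommGroup F] [NormedSpace 𝕜 F] (r : WithTop ℕ∞) (f : E → F) (x₀ : E) : Prop :=
  ∀ᶠ x in 𝓝 x₀, ContDiffAt 𝕜 r f x

theorem smoothNear_superpos [CompleteSpace F] {r : WithTop ℕ∞}
    (hr : r = ((⊤ : ℕ∞) : WithTop ℕ∞) ∨ r = ⊤) {h : Z → F} {z₀ : Z}
    (hh : SmoothNear 𝕜 r h z₀) :
    SmoothNear 𝕜 r (superpos h) (ContinuousMap.const K z₀) := by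
  rcases hr with rfl | rfl
  · obtain ⟨U, hU, hUo, hz⟩ := eventually_nhds_iff.1 hh
    have hc : ContDiffOn 𝕜 ((⊤ : ℕ∞) : WithTop ℕ∞) (superpos h) {γ : C(K, Z) | ∀ k, γ k ∈ U} :=
      contDiffOn_infty.2 fun n =>
        contDiffOn_superpos_nat n hUo fun z hz => (hU z hz).contDiffWithinAt
    filter_upwards [(isOpen_setOf_forall_mem hUo).mem_nhds
      (show ContinuousMap.const K z₀ ∈ {γ : C(K, Z) | ∀ k, γ k ∈ U} from fun _ => hz)] with γ hγ
    exact hc.contDiffAt ((isOpen_setOf_forall_mem hUo).mem_nhds hγ)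
  · exact (analyticAt_superpos hh.self_of_nhds.analyticAt).eventually_analyticAt.mono
      fun γ hγ => hγ.contDiffAt

end Superposition

/-! ### The inverse function theorem for germs. -/

section InverseFunction

variable {𝕜 : Type*} [RCLike 𝕜] {r : WithTop ℕ∞}
variable {E : Type*} [NormedAddCommGroup E] [NormedSpace 𝕜 E]
variable {F : Type*} [NormedAddCommGroup F] [NormedSpace 𝕜 F]
variable {G : Type*} [NormedAddCommGroup G] [NormedSpace 𝕜 G]

theorem ne_zero_of_infty_or_top (hr : r = ((⊤ : ℕ∞) : WithTop ℕ∞) ∨ r = ⊤) : r ≠ 0 := by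
  rcases hr with rfl | rfl <;> simp

theorem add_one_le_of_infty_or_top (hr : r = ((⊤ : ℕ∞) : WithTop ℕ∞) ∨ r = ⊤) : r + 1 ≤ r := by
  rcases hr with rfl | rfl <;> simp

theorem SmoothNear.self {f : E → F} {x : E} (h : SmoothNear 𝕜 r f x) : ContDiffAt 𝕜 r f x :=
  h.self_of_nhds

theorem SmoothNear.eventually {f : E → F} {x : E} (h : SmoothNear 𝕜 r f x) :
    ∀ᶠ y in 𝓝 x, SmoothNear 𝕜 r f y :=
  eventually_eventually_nhds.2 h

theorem SmoothNear.continuousAt {f : E → F} {x : E} (h : SmoothNear 𝕜 r f x) : ContinuousAt f x :=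
  h.self.continuousAt

theorem SmoothNear.comp {g : F → G} {f : E → F} {x : E} (hg : SmoothNear 𝕜 r g (f x))
    (hf : SmoothNear 𝕜 r f x) : SmoothNear 𝕜 r (fun y => g (f y)) x := by
  filter_upwards [hf, hf.continuousAt.eventually hg] with y h1 h2
  exact h2.comp y h1

theorem SmoothNear.fderiv (hr : r = ((⊤ : ℕ∞) : WithTop ℕ∞) ∨ r = ⊤) {f : E → F} {x : E}
    (h : SmoothNear 𝕜 r f x) : SmoothNear 𝕜 r (fderiv 𝕜 f) x :=
  h.mono fun _ hy => hy.fderiv_right (add_one_le_of_infty_or_top hr)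

theorem SmoothNear.prodMk {g : E → G} {f : E → F} {x : E} (hf : SmoothNear 𝕜 r f x)
    (hg : SmoothNear 𝕜 r g x) : SmoothNear 𝕜 r (fun y => (f y, g y)) x := by
  filter_upwards [hf, hg] with y h1 h2
  exact h1.prodMk h2

theorem SmoothNear.congr {f g : E → F} {x : E} (hf : SmoothNear 𝕜 r f x) (h : g =ᶠ[𝓝 x] f) :
    SmoothNear 𝕜 r g x := by
  filter_upwards [hf, eventually_eventually_nhds.2 h] with y h1 h2
  exact h1.congr_of_eventuallyEq h2

theorem ContDiff.smoothNear {f : E → F} (hf : ContDiff 𝕜 r f) (x : E) : SmoothNear 𝕜 r f x :=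
  Eventually.of_forall fun _ => hf.contDiffAt

/-- Inverse function theorem: the local inverse is as regular as the map on a neighbourhood. -/
theorem SmoothNear.exists_inverse [CompleteSpace E]
    (hr : r = ((⊤ : ℕ∞) : WithTop ℕ∞) ∨ r = ⊤) {f : E → F} {a : E}
    (hf : SmoothNear 𝕜 r f a) (f' : E ≃L[𝕜] F) (hf' : HasFDerivAt f (f' : E →L[𝕜] F) a) :
    ∃ g : F → E, SmoothNear 𝕜 r g (f a) ∧ g (f a) = a ∧
      (∀ᶠ x in 𝓝 a, g (f x) = x) ∧ ∀ᶠ y in 𝓝 (f a), f (g y) = y := by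
  have hn := ne_zero_of_infty_or_top hr
  set e := hf.self.toOpenPartialHomeomorph f hf' hn with he
  have hea : a ∈ e.source := hf.self.mem_toOpenPartialHomeomorph_source hf' hn
  have hfa : f a ∈ e.target := hf.self.image_mem_toOpenPartialHomeomorph_target hf' hn
  have hsymm : e.symm (f a) = a := e.left_inv hea
  have hcont : ContinuousAt e.symm (f a) := e.symm.continuousAt hfa
  refine ⟨e.symm, ?_, hsymm, ?_, ?_⟩
  -- Regularity at the single point `f a` is not enough: at each nearby point the inverse is regular
  -- once the derivative at its preimage is invertible, and invertibility is open.
  · have hinv : ∀ᶠ x in 𝓝 a, _root_.fderiv 𝕜 f x ∈ Set.range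
        (ContinuousLinearEquiv.toContinuousLinearMap : (E ≃L[𝕜] F) → E →L[𝕜] F) := by
      have hc : ContinuousAt (_root_.fderiv 𝕜 f) a := (hf.fderiv hr).continuousAt
      refine hc.eventually ?_
      rw [hf'.fderiv]
      exact ContinuousLinearEquiv.nhds f'
    have hcont' : Tendsto e.symm (𝓝 (f a)) (𝓝 a) := by
      have := hcont.tendsto; rwa [hsymm] at this
    filter_upwards [hcont'.eventually hf, hcont'.eventually hinv, e.open_target.mem_nhds hfa]
      with y h1 h2 h3
    obtain ⟨A, hA⟩ := h2
    refine e.contDiffAt_symm (f₀' := A) h3 ?_ h1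
    rw [hA]
    exact (h1.differentiableAt hn).hasFDerivAt
  · filter_upwards [e.open_source.mem_nhds hea] with x hx using e.left_inv hx
  · filter_upwards [e.open_target.mem_nhds hfa] with y hy using e.right_inv hy

theorem isDiffeoGerm_of_fderiv [CompleteSpace E]
    (hr : r = ((⊤ : ℕ∞) : WithTop ℕ∞) ∨ r = ⊤) {f : E → E}
    (hf : SmoothNear 𝕜 r f 0) (h0 : f 0 = 0) (f' : E ≃L[𝕜] E)
    (hf' : HasFDerivAt f (f' : E →L[𝕜] E) 0) : IsDiffeoGerm 𝕜 r f := by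
  obtain ⟨g, h1, h2, h3, h4⟩ := hf.exists_inverse hr f' hf'
  rw [h0] at h1 h2 h4
  exact ⟨hf, h0, g, h1, h2, h3, h4⟩

end InverseFunction

/-! ### Integration of paths as a bounded operator. -/

section Integral

variable {𝕜 : Type*} [RCLike 𝕜] {r : WithTop ℕ∞}
variable {Z : Type u} [NormedAddCommGroup Z] [NormedSpace 𝕜 Z]

variable (𝕜 Z) in
/-- Constant paths, as a continuous linear map. -/
def constPath : Z →L[𝕜] C(unitInterval, Z) :=
  LinearMap.mkContinuous
    { toFun := fun z => ContinuousMap.const _ z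
      map_add' := fun _ _ => rfl
      map_smul' := fun _ _ => rfl } 1
    (fun z => by
      rw [ContinuousMap.norm_le _ (by positivity)]
      intro s
      exact (one_mul ‖z‖).ge)

@[simp]
theorem constPath_apply (z : Z) (s : unitInterval) : constPath 𝕜 Z z s = z := rfl

/-- Extension of a path on `[0, 1]` to the real line. -/
def extendPath (γ : C(unitInterval, Z)) (s : ℝ) : Z := γ (Set.projIcc 0 1 zero_le_one s)

theorem continuous_extendPath (γ : C(unitInterval, Z)) : Continuous (extendPath γ) :=
  γ.continuous.comp continuous_projIcc

theorem extendPath_of_mem (γ : C(unitInterval, Z)) {s : ℝ} (hs : s ∈ Set.Icc (0 : ℝ) 1) :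
    extendPath γ s = γ ⟨s, hs⟩ := by
  rw [extendPath, Set.projIcc_of_mem]

variable [NormedSpace ℝ Z] [IsScalarTower ℝ 𝕜 Z]

variable (𝕜 Z) in
/-- Integration of paths from the initial time. -/
def intPath : C(unitInterval, Z) →L[𝕜] C(unitInterval, Z) :=
  LinearMap.mkContinuous
    { toFun := fun γ => ⟨fun s => ∫ u in (0 : ℝ)..s, extendPath γ u, by
        exact (intervalIntegral.continuous_primitive
          (fun a b => (continuous_extendPath γ).intervalIntegrable a b) 0).comp
          continuous_subtype_val⟩
      map_add' := fun γ η => by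
        ext s
        simp only [ContinuousMap.coe_mk, ContinuousMap.add_apply]
        rw [← intervalIntegral.integral_add ((continuous_extendPath γ).intervalIntegrable _ _)
          ((continuous_extendPath η).intervalIntegrable _ _)]
        rfl
      map_smul' := fun c γ => by
        ext s
        simp only [ContinuousMap.coe_mk, RingHom.id_apply, ContinuousMap.smul_apply]
        rw [← intervalIntegral.integral_smul]
        rfl } 1
    (fun γ => by
      rw [ContinuousMap.norm_le _ (by positivity)]
      intro s
      refine (intervalIntegral.norm_integral_le_of_norm_le_const (C := ‖γ‖)
        fun u _ => γ.norm_coe_le_norm _).trans ?_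
      rw [one_mul, sub_zero, abs_of_nonneg s.2.1]
      exact mul_le_of_le_one_right (norm_nonneg _) s.2.2)

theorem intPath_apply (γ : C(unitInterval, Z)) (s : unitInterval) :
    intPath 𝕜 Z γ s = ∫ u in (0 : ℝ)..s, extendPath γ u := rfl

theorem hasDerivWithinAt_extendPath [CompleteSpace Z] {γ W : C(unitInterval, Z)} {x : Z} {ε : 𝕜}
    (h : γ = constPath 𝕜 Z x + ε • intPath 𝕜 Z W) {s : ℝ} (hs : s ∈ Set.Icc (0 : ℝ) 1) :
    HasDerivWithinAt (extendPath γ) (ε • extendPath W s) (Set.Icc 0 1) s := by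
  have h1 : HasDerivAt (fun u : ℝ => x + ε • ∫ v in (0 : ℝ)..u, extendPath W v)
      (ε • extendPath W s) s :=
    ((((continuous_extendPath W).integral_hasStrictDerivAt 0 s).hasDerivAt).const_smul ε).const_add x
  refine h1.hasDerivWithinAt.congr (fun u hu => ?_) ?_
  · rw [extendPath_of_mem γ hu, h]; rfl
  · rw [extendPath_of_mem γ hs, h]; rfl

theorem extendPath_zero {γ W : C(unitInterval, Z)} {x : Z} {ε : 𝕜}
    (h : γ = constPath 𝕜 Z x + ε • intPath 𝕜 Z W) : extendPath γ 0 = x := by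
  rw [extendPath_of_mem γ (by simp), h]
  simp [intPath_apply]

end Integral

/-! ### Trajectories and their regular dependence on time and initial point. -/

section Flow

variable {𝕜 : Type*} [RCLike 𝕜] {r : WithTop ℕ∞}
variable {Z : Type u} [NormedAddCommGroup Z] [NormedSpace 𝕜 Z] [NormedSpace ℝ Z]
  [IsScalarTower ℝ 𝕜 Z] [CompleteSpace Z]

/-- Solutions on `[0, 1]` of `γ' = ε W(γ)`, `γ(0) = x`, depend regularly on `(ε, x)`. -/
theorem exists_solution_paths (hr : r = ((⊤ : ℕ∞) : WithTop ℕ∞) ∨ r = ⊤) {W : Z → Z} {z₀ : Z}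
    (hW : SmoothNear 𝕜 r W z₀) :
    ∃ ψ : 𝕜 × Z → C(unitInterval, Z), SmoothNear 𝕜 r ψ (0, z₀) ∧
      ψ (0, z₀) = constPath 𝕜 Z z₀ ∧
      (∀ᶠ q in 𝓝 ((0 : 𝕜), z₀), ψ q = constPath 𝕜 Z q.2 + q.1 • intPath 𝕜 Z (superpos W (ψ q))) ∧
      ∀ᶠ v in 𝓝 (((0 : 𝕜), z₀), constPath 𝕜 Z z₀),
        v.2 = constPath 𝕜 Z v.1.2 + v.1.1 • intPath 𝕜 Z (superpos W v.2) → v.2 = ψ v.1 := by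
  set N : C(unitInterval, Z) → C(unitInterval, Z) := superpos W with hN
  have hNs : SmoothNear 𝕜 r N (constPath 𝕜 Z z₀) := smoothNear_superpos hr hW
  -- Carrying `(ε, x)` along turns the implicit equation `γ = x + ε ∫ W(γ)` into the inversion of
  -- `f` over the points `((ε, x), 0)`.
  set f : (𝕜 × Z) × C(unitInterval, Z) → (𝕜 × Z) × C(unitInterval, Z) :=
    fun v => (v.1, v.2 - constPath 𝕜 Z v.1.2 - v.1.1 • intPath 𝕜 Z (N v.2)) with hf
  set u₀ : (𝕜 × Z) × C(unitInterval, Z) := ((0, z₀), constPath 𝕜 Z z₀) with hu₀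
  have hNs' : SmoothNear 𝕜 r (fun v : (𝕜 × Z) × C(unitInterval, Z) => N v.2) u₀ :=
    SmoothNear.comp (g := N) (f := Prod.snd) hNs (ContDiff.smoothNear contDiff_snd u₀)
  have hfs : SmoothNear 𝕜 r f u₀ := by
    filter_upwards [hNs'] with v hv
    refine contDiffAt_fst.prodMk ((contDiffAt_snd.sub ?_).sub ?_)
    · exact (constPath 𝕜 Z).contDiff.contDiffAt.comp v (contDiffAt_snd.comp v contDiffAt_fst)
    · exact (contDiffAt_fst.comp v contDiffAt_fst).smul
        ((intPath 𝕜 Z).contDiff.contDiffAt.comp v hv)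
  set A : (𝕜 × Z) →L[𝕜] C(unitInterval, Z) :=
    (constPath 𝕜 Z).comp (ContinuousLinearMap.snd 𝕜 𝕜 Z) +
      (ContinuousLinearMap.fst 𝕜 𝕜 Z).smulRight (intPath 𝕜 Z (N (constPath 𝕜 Z z₀))) with hA
  -- At `ε = 0` the derivative of `N` is multiplied by zero, so the derivative of `f` is unipotent
  -- triangular and is inverted by changing the sign of `A`.
  set e : ((𝕜 × Z) × C(unitInterval, Z)) ≃L[𝕜] (𝕜 × Z) × C(unitInterval, Z) :=
    ContinuousLinearEquiv.equivOfInverse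
      ((ContinuousLinearMap.fst 𝕜 _ _).prod
        (ContinuousLinearMap.snd 𝕜 _ _ - A.comp (ContinuousLinearMap.fst 𝕜 _ _)))
      ((ContinuousLinearMap.fst 𝕜 _ _).prod
        (ContinuousLinearMap.snd 𝕜 _ _ + A.comp (ContinuousLinearMap.fst 𝕜 _ _)))
      (fun v => by simp) (fun v => by simp) with he
  have hder : HasFDerivAt f (e : _ →L[𝕜] _) u₀ := by
    have hNd : HasFDerivAt (fun v : (𝕜 × Z) × C(unitInterval, Z) => intPath 𝕜 Z (N v.2)) _ u₀ :=
      (intPath 𝕜 Z).hasFDerivAt.comp u₀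
        (hNs'.self.differentiableAt (ne_zero_of_infty_or_top hr)).hasFDerivAt
    have h1 := (hasFDerivAt_fst (𝕜 := 𝕜) (p := u₀)).prodMk
      (((hasFDerivAt_snd (𝕜 := 𝕜) (p := u₀)).sub ((constPath 𝕜 Z).hasFDerivAt.comp u₀
        (hasFDerivAt_snd.comp u₀ hasFDerivAt_fst))).sub
        ((hasFDerivAt_fst.comp u₀ (hasFDerivAt_fst (𝕜 := 𝕜) (p := u₀))).smul hNd))
    refine h1.congr_fderiv ?_
    ext v <;> simp [he, hA, hu₀, ContinuousLinearEquiv.equivOfInverse]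
  obtain ⟨g, hg, hga, hgf, hfg⟩ := hfs.exists_inverse hr e hder
  have hfu : f u₀ = ((0, z₀), 0) := by simp [hf, hu₀]
  rw [hfu] at hg hga hfg
  set j : 𝕜 × Z → (𝕜 × Z) × C(unitInterval, Z) := fun q => (q, 0) with hj
  have hjs : ∀ q, SmoothNear 𝕜 r j q := fun q => ContDiff.smoothNear (by fun_prop) q
  refine ⟨fun q => (g (j q)).2, ?_, ?_, ?_, ?_⟩
  · exact SmoothNear.comp (g := Prod.snd) (ContDiff.smoothNear contDiff_snd _)
      (SmoothNear.comp (g := g) hg (hjs _))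
  · simp [hj, hga, hu₀]
  · filter_upwards [(hjs (0, z₀)).continuousAt.eventually hfg] with q hq
    have h1 : (g (j q)).1 = q := congrArg Prod.fst hq
    have h2 := congrArg Prod.snd hq
    simp only [hf, hj] at h2 h1
    rw [h1, sub_sub, sub_eq_zero] at h2
    exact h2
  · filter_upwards [hgf] with v hv h
    have : f v = j v.1 := by
      simp only [hf, hj, Prod.mk.injEq, true_and]
      rw [sub_sub, sub_eq_zero]
      exact h
    rw [← this, hv]

/-- The local time-one maps of the fields `ε W` near a point, with their variational equation. -/
theorem exists_time_one_map (hr : r = ((⊤ : ℕ∞) : WithTop ℕ∞) ∨ r = ⊤) {W : Z → Z} {z₀ : Z}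
    (hW : SmoothNear 𝕜 r W z₀) :
    ∃ φ : 𝕜 × Z → Z, SmoothNear 𝕜 r φ (0, z₀) ∧
      (∀ᶠ x in 𝓝 z₀, φ (0, x) = x) ∧
      (∀ U ∈ 𝓝 z₀, ∀ᶠ q in 𝓝 ((0 : 𝕜), z₀), ∃ γ : ℝ → Z, γ 0 = q.2 ∧ γ 1 = φ q ∧
        (∀ s ∈ Set.Icc (0 : ℝ) 1, γ s ∈ U ∧
          HasDerivWithinAt γ (q.1 • W (γ s)) (Set.Icc 0 1) s) ∧
        ∀ v, ∃ η : ℝ → Z, η 0 = v ∧ η 1 = fderiv 𝕜 φ q (0, v) ∧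
          ∀ s ∈ Set.Icc (0 : ℝ) 1,
            HasDerivWithinAt η (q.1 • fderiv 𝕜 W (γ s) (η s)) (Set.Icc 0 1) s) ∧
      ∀ v, (∀ᶠ ε in 𝓝 (0 : 𝕜), W (z₀ + ε • v) = v) →
        ∀ᶠ ε in 𝓝 (0 : 𝕜), φ (ε, z₀) = z₀ + ε • v := by
  obtain ⟨ψ, hψ, hψ0, hψe, hψu⟩ := exists_solution_paths (𝕜 := 𝕜) hr hW
  obtain ⟨U₀, hU₀, hU₀o, hz₀⟩ := eventually_nhds_iff.1 hW
  have hWd : DifferentiableOn 𝕜 W U₀ := fun z hz =>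
    ((hU₀ z hz).differentiableAt (ne_zero_of_infty_or_top hr)).differentiableWithinAt
  have hWc : ContinuousOn (fderiv 𝕜 W) U₀ := fun z hz =>
    ((hU₀ z hz).fderiv_right (add_one_le_of_infty_or_top hr)).continuousAt.continuousWithinAt
  have hψc : Tendsto ψ (𝓝 ((0 : 𝕜), z₀)) (𝓝 (constPath 𝕜 Z z₀)) := by
    have := hψ.continuousAt.tendsto; rwa [hψ0] at this
  have hmem : ∀ U ∈ 𝓝 z₀, ∀ᶠ q in 𝓝 ((0 : 𝕜), z₀), ∀ s, ψ q s ∈ U := fun U hU => by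
    obtain ⟨V, hVU, hVo, hV⟩ := mem_nhds_iff.1 hU
    filter_upwards [hψc.eventually ((isOpen_setOf_forall_mem hVo).mem_nhds (fun _ => hV))]
      with q hq s using hVU (hq s)
  let ev : C(unitInterval, Z) →L[𝕜] Z := ContinuousMap.evalCLM 𝕜 1
  refine ⟨fun q => ψ q 1, ?_, ?_, fun U hU => ?_, fun v hv => ?_⟩
  · exact SmoothNear.comp (g := ev) (ContDiff.smoothNear ev.contDiff _) hψ
  · have : Tendsto (fun x : Z => ((0 : 𝕜), x)) (𝓝 z₀) (𝓝 ((0 : 𝕜), z₀)) :=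
      (Continuous.prodMk_right (0 : 𝕜)).tendsto z₀
    filter_upwards [this.eventually hψe] with x hx
    rw [hx]; simp
  · filter_upwards [hmem U hU, hψe, eventually_eventually_nhds.2 hψe,
      hmem U₀ (hU₀o.mem_nhds hz₀), hψ] with q h1 h2 h3 h4 h5
    have hψd : HasFDerivAt ψ (fderiv 𝕜 ψ q) q :=
      (h5.differentiableAt (ne_zero_of_infty_or_top hr)).hasFDerivAt
    refine ⟨extendPath (ψ q), extendPath_zero h2, ?_, fun s hs => ⟨?_, ?_⟩, fun v => ?_⟩
    · rw [extendPath_of_mem _ (by simp)]; rfl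
    · exact h1 _
    · convert hasDerivWithinAt_extendPath h2 hs using 2
      rw [extendPath, extendPath, superpos_apply hU₀o hWd.continuousOn h4]
    · have hNd : HasFDerivAt (superpos W) _ (ψ q) := hasFDerivAt_superpos hU₀o hWd hWc h4
      have hd : HasFDerivAt (fun q : 𝕜 × Z =>
          constPath 𝕜 Z q.2 + q.1 • intPath 𝕜 Z (superpos W (ψ q))) _ q :=
        ((constPath 𝕜 Z).hasFDerivAt.comp q hasFDerivAt_snd).add
          ((hasFDerivAt_fst (𝕜 := 𝕜) (p := q)).smul
            ((intPath 𝕜 Z).hasFDerivAt.comp q (hNd.comp q hψd)))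
      -- Differentiating the integral equation in `q` gives the variational equation, already
      -- integrated.
      have heq := (hψd.congr_of_eventuallyEq
        (show _ =ᶠ[𝓝 q] _ from h3.mono fun _ h => h.symm)).unique hd
      have hη : fderiv 𝕜 ψ q (0, v) = constPath 𝕜 Z v + q.1 • intPath 𝕜 Z
          (applyPath 𝕜 unitInterval Z Z (superpos (fderiv 𝕜 W) (ψ q)) (fderiv 𝕜 ψ q (0, v))) := by
        conv_lhs => rw [heq]
        simp
      refine ⟨extendPath (fderiv 𝕜 ψ q (0, v)), extendPath_zero hη, ?_, fun s hs => ?_⟩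
      · have : HasFDerivAt (fun q => ψ q 1) (ev.comp (fderiv 𝕜 ψ q)) q :=
          ev.hasFDerivAt.comp q hψd
        rw [this.fderiv, extendPath_of_mem _ (by simp)]; rfl
      · convert hasDerivWithinAt_extendPath hη hs using 2
        simp only [extendPath, applyPath_apply]
        rw [superpos_apply hU₀o hWc h4]
  -- If `W` is constant along the line through `z₀`, the straight path solves the equation, so it is
  -- the solution by local uniqueness.
  · let ℓ : 𝕜 → C(unitInterval, Z) := fun ε => constPath 𝕜 Z z₀ + ε • intPath 𝕜 Z (constPath 𝕜 Z v)
    have hℓc : Continuous ℓ := by fun_prop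
    have hℓ0 : ℓ 0 = constPath 𝕜 Z z₀ := by simp [ℓ]
    have hℓs : ∀ ε s, ℓ ε s = z₀ + (ε * ((s : ℝ) : 𝕜)) • v := fun ε s => by
      have : intPath 𝕜 Z (constPath 𝕜 Z v) s = ((s : ℝ) : 𝕜) • v := by
        rw [intPath_apply]
        have h : (extendPath (constPath 𝕜 Z v)) = fun _ => v := rfl
        rw [h, intervalIntegral.integral_const, sub_zero, ← algebraMap_smul 𝕜 (s : ℝ) v]
      simp [ℓ, this, mul_smul]
    obtain ⟨δ, hδ, hv⟩ := Metric.eventually_nhds_iff.1 hv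
    have hℓmem : ∀ᶠ ε in 𝓝 (0 : 𝕜), ∀ s, ℓ ε s ∈ U₀ := by
      have := hℓc.tendsto 0
      rw [hℓ0] at this
      exact this.eventually ((isOpen_setOf_forall_mem hU₀o).mem_nhds (fun _ => hz₀))
    have hj : Tendsto (fun ε : 𝕜 => ((ε, z₀), ℓ ε)) (𝓝 0)
        (𝓝 (((0 : 𝕜), z₀), constPath 𝕜 Z z₀)) := by
      have : Continuous fun ε : 𝕜 => ((ε, z₀), ℓ ε) := by fun_prop
      have := this.tendsto 0
      rwa [hℓ0] at this
    filter_upwards [hj.eventually hψu, hℓmem, Metric.ball_mem_nhds (0 : 𝕜) hδ] with ε h1 h2 h3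
    have h4 : superpos W (ℓ ε) = constPath 𝕜 Z v := by
      ext s
      rw [superpos_apply hU₀o hWd.continuousOn h2, hℓs, constPath_apply]
      apply hv
      rw [dist_zero_right, norm_mul, RCLike.norm_ofReal, abs_of_nonneg s.2.1]
      exact (mul_le_of_le_one_right (norm_nonneg _) s.2.2).trans_lt (by simpa using h3)
    have h5 := h1 (by simp only [h4]; rfl)
    rw [← h5, hℓs]; simp

end Flow

/-! ### Integrals over segments depending on a parameter. -/

section ParametricIntegral

variable {𝕜 : Type*} [RCLike 𝕜] {r : WithTop ℕ∞}
variable {Z : Type u} [NormedAddCommGroup Z] [NormedSpace 𝕜 Z]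
variable {F : Type u} [NormedAddCommGroup F] [NormedSpace 𝕜 F] [NormedSpace ℝ F]
  [IsScalarTower ℝ 𝕜 F] [CompleteSpace F]

/-- Averages of a regular map over segments depend regularly on the segment. -/
theorem smoothNear_integral_segment (hr : r = ((⊤ : ℕ∞) : WithTop ℕ∞) ∨ r = ⊤) {h : Z → F} {z₀ : Z}
    (hh : SmoothNear 𝕜 r h z₀) (A B : Z →L[𝕜] Z) (hA : A z₀ = z₀) (hB : B z₀ = 0) :
    SmoothNear 𝕜 r (fun x => ∫ s in (0 : ℝ)..1, h (A x + (s : 𝕜) • B x)) z₀ ∧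
      (∀ U ∈ 𝓝 z₀, ∀ᶠ x in 𝓝 z₀, ∀ s ∈ Set.Icc (0 : ℝ) 1, A x + (s : 𝕜) • B x ∈ U) ∧
      ∀ᶠ x in 𝓝 z₀, ∀ v, fderiv 𝕜 (fun x => ∫ s in (0 : ℝ)..1, h (A x + (s : 𝕜) • B x)) x v =
        ∫ s in (0 : ℝ)..1, fderiv 𝕜 h (A x + (s : 𝕜) • B x) (A v + (s : 𝕜) • B v) := by
  let S : C(unitInterval, Z →L[𝕜] Z) :=
    ⟨fun s => ((s : ℝ) : 𝕜) • ContinuousLinearMap.id 𝕜 Z, by fun_prop⟩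
  -- The segment depends linearly on `x`, and `hA`, `hB` make it constant at `z₀`; the integral is
  -- then a composition of linear maps with one superposition operator near a constant path.
  let P : Z →L[𝕜] C(unitInterval, Z) := (constPath 𝕜 Z).comp A +
    (applyPath 𝕜 unitInterval Z Z S).comp ((constPath 𝕜 Z).comp B)
  have hP : ∀ x s, P x s = A x + ((s : ℝ) : 𝕜) • B x := fun x s => rfl
  have hP0 : P z₀ = constPath 𝕜 Z z₀ := by ext s; simp [hP, hA, hB]
  let ev : C(unitInterval, F) →L[𝕜] F :=
    (ContinuousMap.evalCLM 𝕜 1 : C(unitInterval, F) →L[𝕜] F).comp (intPath 𝕜 F)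
  have hev : ∀ γ, ev γ = ∫ s in (0 : ℝ)..1, extendPath γ s := fun γ => rfl
  obtain ⟨U₀, hU₀, hU₀o, hz₀⟩ := eventually_nhds_iff.1 hh
  have hWd : DifferentiableOn 𝕜 h U₀ := fun z hz =>
    ((hU₀ z hz).differentiableAt (ne_zero_of_infty_or_top hr)).differentiableWithinAt
  have hWc : ContinuousOn (fderiv 𝕜 h) U₀ := fun z hz =>
    ((hU₀ z hz).fderiv_right (add_one_le_of_infty_or_top hr)).continuousAt.continuousWithinAt
  have hmem : ∀ U ∈ 𝓝 z₀, ∀ᶠ x in 𝓝 z₀, ∀ s, P x s ∈ U := fun U hU => by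
    obtain ⟨V, hVU, hVo, hV⟩ := mem_nhds_iff.1 hU
    have hPc := P.continuous.tendsto z₀
    rw [hP0] at hPc
    filter_upwards [hPc.eventually ((isOpen_setOf_forall_mem hVo).mem_nhds (fun _ => hV))]
      with q hq s using hVU (hq s)
  have heq : (fun x => ∫ s in (0 : ℝ)..1, h (A x + (s : 𝕜) • B x)) =ᶠ[𝓝 z₀]
      fun x => ev (superpos h (P x)) := by
    filter_upwards [hmem U₀ (hU₀o.mem_nhds hz₀)] with x hx
    rw [hev]
    refine intervalIntegral.integral_congr fun s hs => ?_
    rw [Set.uIcc_of_le zero_le_one] at hs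
    rw [extendPath_of_mem _ hs, superpos_apply hU₀o hWd.continuousOn hx, hP]
  refine ⟨?_, fun U hU => ?_, ?_⟩
  · refine SmoothNear.congr ?_ heq
    refine SmoothNear.comp (g := ev) (ContDiff.smoothNear ev.contDiff _)
      (SmoothNear.comp (g := superpos h) ?_ (ContDiff.smoothNear P.contDiff _))
    rw [hP0]
    exact smoothNear_superpos hr hh
  · filter_upwards [hmem U hU] with x hx s hs using hx ⟨s, hs⟩
  · filter_upwards [hmem U₀ (hU₀o.mem_nhds hz₀), eventually_eventually_nhds.2 heq] with x hx h1 v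
    have hd : HasFDerivAt (fun x => ev (superpos h (P x))) _ x :=
      ev.hasFDerivAt.comp x ((hasFDerivAt_superpos hU₀o hWd hWc hx).comp x P.hasFDerivAt)
    rw [(hd.congr_of_eventuallyEq h1).fderiv]
    simp only [ContinuousLinearMap.comp_apply]
    rw [hev]
    refine intervalIntegral.integral_congr fun s hs => ?_
    rw [Set.uIcc_of_le zero_le_one] at hs
    rw [extendPath_of_mem _ hs, applyPath_apply, superpos_apply hU₀o hWc hx, hP, hP]

end ParametricIntegral

/-! ### Moser's method near one value of the parameter. -/

section Moser

variable {𝕜 : Type*} [RCLike 𝕜] {r : WithTop ℕ∞}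
variable {E : Type*} [NormedAddCommGroup E] [NormedSpace 𝕜 E]

/-- The cyclic expression of the exterior derivative of a form with values in bilinear maps
vanishes. -/
def IsClosedBilinAt (A : E → E →L[𝕜] E →L[𝕜] 𝕜) (x : E) : Prop :=
  ∀ a b c, fderiv 𝕜 A x a b c - fderiv 𝕜 A x b a c + fderiv 𝕜 A x c a b = 0

/-- Infinitesimal form of the invariance of a family of closed 2-forms under the flow of a field
`V` with `V ⌟ A = -μ`. -/
theorem moser_derivative_eq_zero {A : 𝕜 × E → E →L[𝕜] E →L[𝕜] 𝕜}
    {A₀ η : E → E →L[𝕜] E →L[𝕜] 𝕜} {μ : E → E →L[𝕜] 𝕜} {V : 𝕜 × E → E} {z : 𝕜 × E}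
    (hA : A = fun z => A₀ z.2 + z.1 • η z.2)
    (hA₀ : DifferentiableAt 𝕜 A₀ z.2) (hη : DifferentiableAt 𝕜 η z.2)
    (hμ : DifferentiableAt 𝕜 μ z.2) (hV : DifferentiableAt 𝕜 V z)
    (hskew : ∀ a b, A z a b = -A z b a)
    (hcA : IsClosedBilinAt A₀ z.2) (hcη : IsClosedBilinAt η z.2)
    (hd : ∀ a b, fderiv 𝕜 μ z.2 a b - fderiv 𝕜 μ z.2 b a = η z.2 a b)
    (hVμ : ∀ᶠ y in 𝓝 z, ∀ b, A y (V y) b = -μ y.2 b) (a b : E) :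
    fderiv 𝕜 A z (1, V z) a b + A z (fderiv 𝕜 V z (0, a)) b + A z a (fderiv 𝕜 V z (0, b)) = 0 := by
  have hAd := (hA₀.hasFDerivAt.comp z (hasFDerivAt_snd (𝕜 := 𝕜) (p := z))).add
      ((hasFDerivAt_fst (𝕜 := 𝕜) (p := z)).smul
        (hη.hasFDerivAt.comp z (hasFDerivAt_snd (𝕜 := 𝕜) (p := z))))
  replace hAd := hAd.congr_of_eventuallyEq (f₁ := A) (by rw [hA]; exact EventuallyEq.rfl)
  have hAv : ∀ t v, fderiv 𝕜 A z (t, v) =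
      fderiv 𝕜 A₀ z.2 v + (z.1 • fderiv 𝕜 η z.2 v + t • η z.2) := fun t v => by
    rw [hAd.fderiv]; simp
  -- The relation `V ⌟ A = -μ` is differentiated in the direction `a` at fixed `t`.
  have key : ∀ a b, fderiv 𝕜 A z (0, a) (V z) b + A z (fderiv 𝕜 V z (0, a)) b =
      -fderiv 𝕜 μ z.2 a b := fun a b => by
    have h1 : HasFDerivAt (fun y => A y (V y) b) _ z :=
      (hAd.differentiableAt.hasFDerivAt.clm_apply hV.hasFDerivAt).clm_apply (hasFDerivAt_const b z)
    have h2 : HasFDerivAt (fun y : 𝕜 × E => -μ y.2 b) _ z :=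
      ((hμ.hasFDerivAt.comp z (hasFDerivAt_snd (𝕜 := 𝕜) (p := z))).clm_apply
        (hasFDerivAt_const b z)).neg
    have h3 := h1.unique (h2.congr_of_eventuallyEq (hVμ.mono fun y hy => hy b))
    have h4 := congrArg (fun L => L (0, a)) h3
    simp at h4
    linear_combination h4
  -- This is Cartan's formula: closedness of `A₀` and `η` converts the derivative along `V` into the
  -- antisymmetrization of `key`, and `dμ = η` cancels the derivative in `t`.
  have k1 := key a b
  have k2 := key b a
  have k3 := hcA (V z) a b
  have k4 := hcη (V z) a b
  have k5 := hd a b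
  have k6 := hskew a (fderiv 𝕜 V z (0, b))
  simp only [hAv, add_apply, smul_apply, smul_eq_mul] at k1 k2 ⊢
  linear_combination k1 - k2 + k3 + z.1 * k4 - k5 + k6

/-- Moser's method, locally in the parameter. -/
theorem moser_local [CompleteSpace E] [NormedSpace ℝ E] [IsScalarTower ℝ 𝕜 E]
    (hr : r = ((⊤ : ℕ∞) : WithTop ℕ∞) ∨ r = ⊤)
    {A : 𝕜 × E → E →L[𝕜] E →L[𝕜] 𝕜}
    {A₀ η : E → E →L[𝕜] E →L[𝕜] 𝕜} {μ : E → E →L[𝕜] 𝕜} {V : 𝕜 × E → E} {t₀ : 𝕜}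
    (hA : A = fun z => A₀ z.2 + z.1 • η z.2)
    (hA₀ : SmoothNear 𝕜 r A₀ 0) (hη : SmoothNear 𝕜 r η 0) (hμ : SmoothNear 𝕜 r μ 0)
    (hV : SmoothNear 𝕜 r V (t₀, 0))
    (hskew : ∀ z a b, A z a b = -A z b a)
    (hcA : ∀ᶠ x in 𝓝 0, IsClosedBilinAt A₀ x) (hcη : ∀ᶠ x in 𝓝 0, IsClosedBilinAt η x)
    (hd : ∀ᶠ x in 𝓝 0, ∀ a b, fderiv 𝕜 μ x a b - fderiv 𝕜 μ x b a = η x a b)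
    (hVμ : ∀ᶠ z in 𝓝 (t₀, (0 : E)), ∀ b, A z (V z) b = -μ z.2 b)
    (hV0 : ∀ᶠ t in 𝓝 t₀, V (t, 0) = 0) :
    ∀ᶠ t in 𝓝 t₀, ∃ Φ : E → E, IsDiffeoGerm 𝕜 r Φ ∧
      ∀ᶠ x in 𝓝 0, ∀ a b, A (t, Φ x) (fderiv 𝕜 Φ x a) (fderiv 𝕜 Φ x b) = A (t₀, x) a b := by
  have hn := ne_zero_of_infty_or_top hr
  set z₀ : 𝕜 × E := (t₀, 0) with hz₀
  -- The suspension makes the field autonomous; the time-one map of `ε W` moves `t₀` to `t₀ + ε`,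
  -- for complex `ε` as well.
  set W : 𝕜 × E → 𝕜 × E := fun z => (1, V z) with hW
  have hWs : SmoothNear 𝕜 r W z₀ := SmoothNear.prodMk (ContDiff.smoothNear contDiff_const _) hV
  obtain ⟨φ, hφ, hφ0, hφc, hφf⟩ := exists_time_one_map (𝕜 := 𝕜) hr hWs
  have hsnd : Tendsto (Prod.snd : 𝕜 × E → E) (𝓝 z₀) (𝓝 0) := continuous_snd.tendsto z₀
  have hU : ∀ᶠ z in 𝓝 z₀, DifferentiableAt 𝕜 A z ∧ DifferentiableAt 𝕜 V z ∧ ∀ a b,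
      fderiv 𝕜 A z (1, V z) a b + A z (fderiv 𝕜 V z (0, a)) b +
        A z a (fderiv 𝕜 V z (0, b)) = 0 := by
    filter_upwards [hsnd.eventually hA₀, hsnd.eventually hη, hsnd.eventually hμ, hV,
      hsnd.eventually hcA, hsnd.eventually hcη, hsnd.eventually hd,
      eventually_eventually_nhds.2 hVμ] with z h1 h2 h3 h4 h5 h6 h7 h8
    refine ⟨?_, h4.differentiableAt hn, fun a b => ?_⟩
    · rw [hA]
      exact ((h1.differentiableAt hn).comp z differentiableAt_snd).add
        (differentiableAt_fst.smul ((h2.differentiableAt hn).comp z differentiableAt_snd))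
    · exact moser_derivative_eq_zero hA (h1.differentiableAt hn) (h2.differentiableAt hn)
        (h3.differentiableAt hn) (h4.differentiableAt hn) (hskew z) h5 h6 h7 h8 a b
  have hmain : ∀ᶠ q in 𝓝 ((0 : 𝕜), z₀), (φ q).1 = q.2.1 + q.1 ∧ ∀ a b,
      A (φ q) (fderiv 𝕜 φ q (0, (0, a))).2 (fderiv 𝕜 φ q (0, (0, b))).2 = A q.2 a b := by
    filter_upwards [hφc _ hU] with q hq
    obtain ⟨γ, hγ0, hγ1, hγ, hη'⟩ := hq
    have hWd : ∀ s ∈ Set.Icc (0 : ℝ) 1, ∀ v, fderiv 𝕜 W (γ s) v = (0, fderiv 𝕜 V (γ s) v) := by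
      intro s hs v
      have : HasFDerivAt W _ (γ s) :=
        (hasFDerivAt_const (1 : 𝕜) (γ s)).prodMk ((hγ s hs).1.2.1.hasFDerivAt)
      rw [this.fderiv]; simp
    constructor
    · have h1 : ∀ s ∈ Set.Icc (0 : ℝ) 1,
          HasDerivWithinAt (fun s => (γ s).1 - (s : 𝕜) * q.1) 0 (Set.Icc 0 1) s := by
        intro s hs
        have h2 := ((hasFDerivAt_fst (𝕜 := ℝ) (p := γ s)).comp_hasDerivWithinAt s (hγ s hs).2)
        have h3 : HasDerivWithinAt (fun s : ℝ => (s : 𝕜) * q.1) ((1 : 𝕜) * q.1) (Set.Icc 0 1) s :=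
          ((RCLike.ofRealCLM (K := 𝕜)).hasDerivAt (x := s)).hasDerivWithinAt.mul_const q.1 |>.congr_deriv (by simp)
        refine (h2.sub h3).congr_deriv ?_
        simp [hW]
      have h2 := constant_of_has_deriv_right_zero
        (fun s hs => (h1 s hs).continuousWithinAt)
        (fun s hs => (h1 s (Set.Ico_subset_Icc_self hs)).mono_of_mem_nhdsWithin
          (Icc_mem_nhdsGE_of_mem hs)) 1 (by simp)
      simp [hγ0, hγ1] at h2
      linear_combination h2
    · intro a b
      obtain ⟨ηa, ha0, ha1, ha⟩ := hη' (0, a)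
      obtain ⟨ηb, hb0, hb1, hb⟩ := hη' (0, b)
      -- The first component of `W` is constant, so variations that start tangent to the slices of
      -- constant `t` remain so.
      have hfst : ∀ (c : ℝ → 𝕜 × E), (c 0).1 = 0 → (∀ s ∈ Set.Icc (0 : ℝ) 1,
          HasDerivWithinAt c (q.1 • fderiv 𝕜 W (γ s) (c s)) (Set.Icc 0 1) s) →
          ∀ s ∈ Set.Icc (0 : ℝ) 1, (c s).1 = 0 := by
        intro c hc0 hc
        have h1 : ∀ s ∈ Set.Icc (0 : ℝ) 1,
            HasDerivWithinAt (fun s => (c s).1) 0 (Set.Icc 0 1) s := by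
          intro s hs
          refine ((hasFDerivAt_fst (𝕜 := ℝ) (p := c s)).comp_hasDerivWithinAt s
            (hc s hs)).congr_deriv ?_
          simp [hWd s hs]
        intro s hs
        have h2 := constant_of_has_deriv_right_zero
          (fun s hs => (h1 s hs).continuousWithinAt)
          (fun s hs => (h1 s (Set.Ico_subset_Icc_self hs)).mono_of_mem_nhdsWithin
            (Icc_mem_nhdsGE_of_mem hs)) s hs
        rw [h2, hc0]
      -- Along a trajectory the derivative of the transported form is `ε` times the infinitesimal
      -- expression that vanishes by `moser_derivative_eq_zero`.
      have h1 : ∀ s ∈ Set.Icc (0 : ℝ) 1,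
          HasDerivWithinAt (fun s => A (γ s) (ηa s).2 (ηb s).2) 0 (Set.Icc 0 1) s := by
        intro s hs
        have hR : HasFDerivAt (fun y : (𝕜 × E) × (𝕜 × E) × (𝕜 × E) => A y.1 y.2.1.2 y.2.2.2) _
            (γ s, ηa s, ηb s) :=
          (((hγ s hs).1.1.hasFDerivAt.comp (γ s, ηa s, ηb s) hasFDerivAt_fst).clm_apply
            ((hasFDerivAt_snd.comp _ (hasFDerivAt_fst.comp _ hasFDerivAt_snd)))).clm_apply
            (hasFDerivAt_snd.comp _ (hasFDerivAt_snd.comp _ hasFDerivAt_snd))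
        have h2 := (hR.restrictScalars ℝ).comp_hasDerivWithinAt s
          ((hγ s hs).2.prodMk ((ha s hs).prodMk (hb s hs)))
        refine h2.congr_deriv ?_
        have h3 := (hγ s hs).1.2.2 (ηa s).2 (ηb s).2
        have e1 : ηa s = (0, (ηa s).2) := Prod.ext (hfst ηa (by simp [ha0]) ha s hs) rfl
        have e2 : ηb s = (0, (ηb s).2) := Prod.ext (hfst ηb (by simp [hb0]) hb s hs) rfl
        rw [← e1, ← e2] at h3
        have hWz : W (γ s) = (1, V (γ s)) := rfl
        simp [hWd s hs, hWz, -Prod.smul_mk]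
        linear_combination q.1 * h3
      have h2 := constant_of_has_deriv_right_zero
        (fun s hs => (h1 s hs).continuousWithinAt)
        (fun s hs => (h1 s (Set.Ico_subset_Icc_self hs)).mono_of_mem_nhdsWithin
          (Icc_mem_nhdsGE_of_mem hs)) 1 (by simp)
      simp only [hγ0, hγ1, ha0, ha1, hb0, hb1] at h2
      exact h2
  have hj : Tendsto (fun ε : 𝕜 => (ε, z₀)) (𝓝 0) (𝓝 ((0 : 𝕜), z₀)) :=
    (Continuous.prodMk_left z₀).tendsto 0
  let ι : E → 𝕜 → 𝕜 × (𝕜 × E) := fun x ε => (ε, (t₀, x))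
  let I₂ : E →L[𝕜] 𝕜 × (𝕜 × E) :=
    (ContinuousLinearMap.inr 𝕜 𝕜 (𝕜 × E)).comp (ContinuousLinearMap.inr 𝕜 𝕜 E)
  have hιd : ∀ ε x, HasFDerivAt (fun x => ι x ε) I₂ x := fun ε x => by
    have : (fun x => ι x ε) = fun x => I₂ x + (ε, (t₀, 0)) := by ext x <;> simp [ι, I₂]
    rw [this]
    exact I₂.hasFDerivAt.add_const _
  have hΦd : ∀ᶠ q in 𝓝 ((0 : 𝕜), z₀), DifferentiableAt 𝕜 φ q :=
    hφ.mono fun q hq => hq.differentiableAt hn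
  let L : 𝕜 → E →L[𝕜] E := fun ε =>
    (ContinuousLinearMap.snd 𝕜 𝕜 E).comp ((fderiv 𝕜 φ (ε, z₀)).comp I₂)
  -- The time-one map for `ε = 0` is the identity, so the derivative at the origin remains
  -- invertible for small `ε`.
  have hL0 : L 0 = ContinuousLinearMap.id 𝕜 E := by
    have h1 : HasFDerivAt (fun x : 𝕜 × E => φ (0, x)) ((fderiv 𝕜 φ (0, z₀)).comp
        (ContinuousLinearMap.inr 𝕜 𝕜 (𝕜 × E))) z₀ := by
      have := hΦd.self_of_nhds.hasFDerivAt.comp z₀ (hasFDerivAt_prodMk_right (0 : 𝕜) z₀)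
      exact this
    have h2 := h1.unique ((hasFDerivAt_id z₀).congr_of_eventuallyEq hφ0)
    ext v
    have h3 := congrArg (fun L => (L (0, v)).2) h2
    simpa [L, I₂] using h3
  have hLc : ContinuousAt L 0 := by
    have h1 : ContinuousAt (fun ε : 𝕜 => fderiv 𝕜 φ (ε, z₀)) 0 :=
      ContinuousAt.comp (g := fderiv 𝕜 φ) (f := fun ε : 𝕜 => (ε, z₀))
        (hφ.fderiv hr).continuousAt hj
    exact continuousAt_const.clm_comp (h1.clm_comp continuousAt_const)
  have hLinv : ∀ᶠ ε in 𝓝 (0 : 𝕜), L ε ∈ Set.range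
      (ContinuousLinearEquiv.toContinuousLinearMap : (E ≃L[𝕜] E) → E →L[𝕜] E) := by
    refine hLc.eventually ?_
    rw [hL0]
    exact ContinuousLinearEquiv.nhds (ContinuousLinearEquiv.refl 𝕜 E)
  -- Since `V` vanishes on `(t, 0)`, the suspended field is constant along that line; hence the maps
  -- fix the origin of `E`.
  have hfix := hφf (1, 0) (by
    have : Tendsto (fun ε : 𝕜 => t₀ + ε) (𝓝 0) (𝓝 t₀) := by
      have : Continuous fun ε : 𝕜 => t₀ + ε := by fun_prop
      simpa using this.tendsto 0
    filter_upwards [this.eventually hV0] with ε hε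
    simp [hW, hz₀, hε])
  have hconc : ∀ᶠ ε in 𝓝 (0 : 𝕜), ∃ Φ : E → E, IsDiffeoGerm 𝕜 r Φ ∧
      ∀ᶠ x in 𝓝 0, ∀ a b,
        A (t₀ + ε, Φ x) (fderiv 𝕜 Φ x a) (fderiv 𝕜 Φ x b) = A (t₀, x) a b := by
    filter_upwards [hfix, hLinv, hj.eventually hφ.eventually,
      hj.eventually (eventually_eventually_nhds.2 hmain),
      hj.eventually (eventually_eventually_nhds.2 hΦd)] with ε h1 h2 h3 h4 h5
    have hιc : Tendsto (fun x => ι x ε) (𝓝 0) (𝓝 (ε, z₀)) :=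
      (hιd ε 0).continuousAt.tendsto
    have hΦx : ∀ x, DifferentiableAt 𝕜 φ (ι x ε) →
        HasFDerivAt (fun x => (φ (ι x ε)).2) ((ContinuousLinearMap.snd 𝕜 𝕜 E).comp
          ((fderiv 𝕜 φ (ι x ε)).comp I₂)) x := fun x hx =>
      hasFDerivAt_snd.comp x (hx.hasFDerivAt.comp x (hιd ε x))
    obtain ⟨e, he⟩ := h2
    refine ⟨fun x => (φ (ι x ε)).2, isDiffeoGerm_of_fderiv hr ?_ ?_ e ?_, ?_⟩
    · refine SmoothNear.comp (g := Prod.snd) (ContDiff.smoothNear contDiff_snd _)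
        (SmoothNear.comp (g := φ) h3 (ContDiff.smoothNear (f := fun x => ι x ε) ?_ _))
      fun_prop
    · have : φ (ι 0 ε) = _ := h1
      simp [this, hz₀]
    · rw [he]
      exact hΦx 0 (h5.self_of_nhds)
    · filter_upwards [hιc.eventually h4, hιc.eventually h5] with x h6 h7 a b
      rw [(hΦx x h7).fderiv]
      have h8 := h6.2 a b
      have h9 : φ (ι x ε) = (t₀ + ε, (φ (ι x ε)).2) := Prod.ext h6.1 rfl
      rw [h9] at h8
      exact h8
  have ht : Tendsto (fun t : 𝕜 => t - t₀) (𝓝 t₀) (𝓝 0) := by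
    have : Continuous fun t : 𝕜 => t - t₀ := by fun_prop
    simpa using this.tendsto t₀
  filter_upwards [ht.eventually hconc] with t h
  simpa using h

end Moser

/-! ### Hadamard's division lemma. -/

section Hadamard

variable {𝕜 : Type u} [RCLike 𝕜] {r : WithTop ℕ∞}
variable {Z : Type u} [NormedAddCommGroup Z] [NormedSpace 𝕜 Z]

/-- The projection along `e` onto the kernel of `ℓ`, when `ℓ e = 1`. -/
def projAlong (ℓ : Z →L[𝕜] 𝕜) (e : Z) : Z →L[𝕜] Z :=
  ContinuousLinearMap.id 𝕜 Z - ℓ.smulRight e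

theorem projAlong_apply (ℓ : Z →L[𝕜] 𝕜) (e x : Z) : projAlong ℓ e x = x - ℓ x • e := rfl

theorem integral_segment_eq_sub {F : Type u} [NormedAddCommGroup F] [NormedSpace 𝕜 F]
    [NormedSpace ℝ F] [IsScalarTower ℝ 𝕜 F] [CompleteSpace F] {f : 𝕜 → F} {f' : 𝕜 → F}
    (hf : ∀ s ∈ Set.Icc (0 : ℝ) 1, HasDerivAt f (f' (s : 𝕜)) (s : 𝕜))
    (hc : ContinuousOn (fun s : ℝ => f' (s : 𝕜)) (Set.Icc 0 1)) :
    ∫ s in (0 : ℝ)..1, f' (s : 𝕜) = f 1 - f 0 := by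
  have h := intervalIntegral.integral_eq_sub_of_hasDerivAt (a := (0 : ℝ)) (b := 1)
    (f := fun s : ℝ => f (s : 𝕜)) (f' := fun s : ℝ => f' (s : 𝕜)) (fun s hs => ?_) ?_
  · simpa using h
  · rw [Set.uIcc_of_le zero_le_one] at hs
    have h1 : HasDerivAt (fun s : ℝ => (s : 𝕜)) 1 s := by
      simpa using (RCLike.ofRealCLM (K := 𝕜)).hasDerivAt (x := s)
    have h2 := ((hf s hs).hasFDerivAt.restrictScalars ℝ).comp_hasDerivAt s h1
    exact (show HasDerivAt (fun s : ℝ => f (s : 𝕜)) _ s from h2).congr_deriv (by simp)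
  · refine ContinuousOn.intervalIntegrable ?_
    rwa [Set.uIcc_of_le zero_le_one]

theorem continuousOn_segment {A B : Z →L[𝕜] Z} {x : Z} {F : Type*} [TopologicalSpace F] {h : Z → F}
    (hh : ∀ s ∈ Set.Icc (0 : ℝ) 1, ContinuousAt h (A x + (s : 𝕜) • B x)) :
    ContinuousOn (fun s : ℝ => h (A x + (s : 𝕜) • B x)) (Set.Icc 0 1) := fun s hs =>
  (ContinuousAt.comp (f := fun s : ℝ => A x + (s : 𝕜) • B x) (hh s hs)
    (by fun_prop)).continuousWithinAt

/-- Hadamard's lemma: a function vanishing on a hyperplane is divisible by its equation. -/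
theorem exists_division (hr : r = ((⊤ : ℕ∞) : WithTop ℕ∞) ∨ r = ⊤) {f : Z → 𝕜} {z₀ : Z}
    (hf : SmoothNear 𝕜 r f z₀) {ℓ : Z →L[𝕜] 𝕜} {e : Z} (he : ℓ e = 1) (hz₀ : ℓ z₀ = 0)
    (hf0 : ∀ᶠ z in 𝓝 z₀, ℓ z = 0 → f z = 0) :
    ∃ g : Z → 𝕜, SmoothNear 𝕜 r g z₀ ∧ (∀ᶠ z in 𝓝 z₀, f z = ℓ z * g z) ∧
      g z₀ = fderiv 𝕜 f z₀ e := by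
  have hA : projAlong ℓ e z₀ = z₀ := by simp [projAlong_apply, hz₀]
  have hB : (ℓ.smulRight e) z₀ = 0 := by simp [hz₀]
  have hh : SmoothNear 𝕜 r (fun z => fderiv 𝕜 f z e) z₀ := by
    filter_upwards [hf.fderiv hr] with z hz
    exact hz.clm_apply contDiffAt_const
  -- The quotient is the mean of the derivative of `f` along `e` over the segment from the
  -- projection of `x` on `{ℓ = 0}` to `x`.
  obtain ⟨h1, h2, h3⟩ := smoothNear_integral_segment hr hh (projAlong ℓ e) (ℓ.smulRight e) hA hB
  refine ⟨_, h1, ?_, ?_⟩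
  · have hcont : Tendsto (projAlong ℓ e) (𝓝 z₀) (𝓝 z₀) := by
      have := (projAlong ℓ e).continuous.tendsto z₀; rwa [hA] at this
    filter_upwards [h2 _ (inter_mem hf hh), hcont.eventually hf0] with x hx hx0
    have hd := integral_segment_eq_sub (𝕜 := 𝕜)
      (f := fun s => f (projAlong ℓ e x + s • ℓ.smulRight e x))
      (f' := fun s => ℓ x * fderiv 𝕜 f (projAlong ℓ e x + s • ℓ.smulRight e x) e)
      (fun s hs => ?_) ?_
    · rw [intervalIntegral.integral_const_mul] at hd
      rw [hd]
      have : f (projAlong ℓ e x) = 0 := hx0 (by simp [projAlong_apply, he])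
      rw [projAlong_apply] at this
      simp [this, projAlong_apply]
    · have h4 := ((hx s hs).1.differentiableAt (ne_zero_of_infty_or_top hr)).hasFDerivAt
      have h5 : HasDerivAt (fun s : 𝕜 => projAlong ℓ e x + s • ℓ.smulRight e x)
          ((1 : 𝕜) • ℓ.smulRight e x) (s : 𝕜) :=
        ((hasDerivAt_id _).smul_const _).const_add _
      refine (h4.comp_hasDerivAt _ h5).congr_deriv ?_
      simp
    · exact continuousOn_const.mul (continuousOn_segment (h := fun z => fderiv 𝕜 f z e)
        fun s hs => (hx s hs).2.continuousAt)
  · simp [hA, hz₀]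

end Hadamard

/-! ### The relative Poincaré lemma. -/

section RelativePoincare

variable {𝕜 : Type u} [RCLike 𝕜] {r : WithTop ℕ∞}
variable {E : Type u} [NormedAddCommGroup E] [NormedSpace 𝕜 E]

/-- This is the integrand of the homotopy formula for the contraction `S s` along `e`. Because `η(e,
e) = 0`, a vector paired with `e` may be replaced by its image under `S s`; thus the factor `ℓ x`
separates from the rest. -/
theorem hasDerivAt_segment_form {η : E → E →L[𝕜] E →L[𝕜] 𝕜} {ℓ : E →L[𝕜] 𝕜} {e x a b : E} {s : 𝕜}
    {S : 𝕜 → E → E} (hη : HasFDerivAt η (fderiv 𝕜 η (S s x)) (S s x))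
    (hskew : ∀ a b, η (S s x) a b = -η (S s x) b a) (hc : IsClosedBilinAt η (S s x))
    (hSd : ∀ v, HasDerivAt (fun s => S s v) (ℓ v • e) s)
    (hSv : ∀ v, S s v = v - ((1 - s) * ℓ v) • e)
    (hskd : ∀ v, fderiv 𝕜 η (S s x) v e e = 0) :
    HasDerivAt (fun s => η (S s x) (S s a) (S s b))
      ((ℓ x * fderiv 𝕜 η (S s x) (S s a) e b + ℓ a * η (S s x) e b) -
        (ℓ x * fderiv 𝕜 η (S s x) (S s b) e a + ℓ b * η (S s x) e a)) s := by
  have k0 : HasDerivAt (fun s => η (S s x)) (fderiv 𝕜 η (S s x) (ℓ x • e)) s :=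
    hη.comp_hasDerivAt s (hSd x)
  have k1 := (k0.clm_apply (hSd a)).clm_apply (hSd b)
  refine k1.congr_deriv ?_
  have k2 := hc e (S s a) (S s b)
  have k3 := hskd (S s a)
  have k4 := hskd (S s b)
  have k5 : η (S s x) e e = 0 := self_eq_neg.1 (hskew e e)
  have k6 := hskew (S s a) e
  have e1 : fderiv 𝕜 η (S s x) (S s a) e (S s b) = fderiv 𝕜 η (S s x) (S s a) e b := by
    conv_lhs => rw [hSv b]
    rw [map_sub, map_smul, k3]; simp
  have e2 : fderiv 𝕜 η (S s x) (S s b) e (S s a) = fderiv 𝕜 η (S s x) (S s b) e a := by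
    conv_lhs => rw [hSv a]
    rw [map_sub, map_smul, k4]; simp
  have e3 : ∀ v, η (S s x) e (S s v) = η (S s x) e v := fun v => by
    conv_lhs => rw [hSv v]
    rw [map_sub, map_smul, k5]; simp
  rw [e1, e2] at k2
  simp only [map_smul, add_apply, smul_apply, smul_eq_mul]
  rw [k6, e3, e3]
  linear_combination ℓ x * k2

/-- Relative Poincaré lemma: a closed 2-form vanishing at the points of `{ℓ = 0}` is `d(ℓ β)` with
`β` vanishing at the points of `{ℓ = 0}`. -/
theorem exists_relative_primitive (hr : r = ((⊤ : ℕ∞) : WithTop ℕ∞) ∨ r = ⊤)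
    {η : E → E →L[𝕜] E →L[𝕜] 𝕜} (hη : SmoothNear 𝕜 r η 0) (hskew : ∀ x a b, η x a b = -η x b a)
    (hc : ∀ᶠ x in 𝓝 0, IsClosedBilinAt η x) {ℓ : E →L[𝕜] 𝕜} {e : E} (he : ℓ e = 1)
    (hη0 : ∀ᶠ x in 𝓝 0, ℓ x = 0 → η x = 0) :
    ∃ β : E → E →L[𝕜] 𝕜, SmoothNear 𝕜 r β 0 ∧ (∀ᶠ x in 𝓝 0, ℓ x = 0 → β x = 0) ∧
      ∀ᶠ x in 𝓝 0, ∀ a b, fderiv 𝕜 (fun x => ℓ x • β x) x a b -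
        fderiv 𝕜 (fun x => ℓ x • β x) x b a = η x a b := by
  have hn := ne_zero_of_infty_or_top hr
  have hA : projAlong ℓ e 0 = 0 := by simp
  have hB : (ℓ.smulRight e) 0 = 0 := by simp
  have hh : SmoothNear 𝕜 r (fun z => η z e) 0 := by
    filter_upwards [hη] with z hz
    exact hz.clm_apply contDiffAt_const
  -- The usual homotopy operator contracts `η` with `ℓ(x) e`; here only `e` is contracted, and the
  -- scalar `ℓ(x)` is kept outside as the required factor.
  obtain ⟨h1, h2, h3⟩ := smoothNear_integral_segment hr hh (projAlong ℓ e) (ℓ.smulRight e) hA hB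
  refine ⟨_, h1, ?_, ?_⟩
  · filter_upwards [hη0] with x hx h0
    simp [h0, projAlong_apply, hx h0]
  · have hcont : Tendsto (projAlong ℓ e) (𝓝 0) (𝓝 0) := by
      have := (projAlong ℓ e).continuous.tendsto 0; rwa [hA] at this
    filter_upwards [h1, h3, hcont.eventually hη0, h2 _ (inter_mem (inter_mem hη (hη.fderiv hr)) hc)]
      with x hx1 hx3 hx0 hx a b
    set S : 𝕜 → E → E := fun s v => projAlong ℓ e v + s • ℓ.smulRight e v with hS
    have hηd : ∀ s ∈ Set.Icc (0 : ℝ) 1, HasFDerivAt η (fderiv 𝕜 η (S s x)) (S s x) := fun s hs =>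
      ((hx s hs).1.1.differentiableAt hn).hasFDerivAt
    have hskd : ∀ s ∈ Set.Icc (0 : ℝ) 1, ∀ v, fderiv 𝕜 η (S s x) v e e = 0 := by
      intro s hs v
      have k1 := ((hηd s hs).clm_apply (hasFDerivAt_const e _)).clm_apply (hasFDerivAt_const e _)
      have k2 : (fun y => η y e e) = fun _ => 0 := funext fun y => self_eq_neg.1 (hskew y e e)
      rw [k2] at k1
      have := congrArg (fun L => L v) (k1.unique (hasFDerivAt_const _ _))
      simpa using this
    have hee : ∀ y, η y e e = 0 := fun y => self_eq_neg.1 (hskew y e e)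
    set β : E → E →L[𝕜] 𝕜 :=
      fun x => ∫ s in (0 : ℝ)..1, η (projAlong ℓ e x + (s : 𝕜) • (ℓ.smulRight e) x) e with hβ
    have hfd : ∀ v, fderiv 𝕜 (fun z => η z e) (S v x) = fderiv 𝕜 (fun z => η z e) (S v x) :=
      fun _ => rfl
    have hηe : ∀ s ∈ Set.Icc (0 : ℝ) 1, ∀ v, fderiv 𝕜 (fun z => η z e) (S s x) v =
        fderiv 𝕜 η (S s x) v e := fun s hs v => by
      rw [((hηd s hs).clm_apply (hasFDerivAt_const e _)).fderiv]
      simp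
    have hcη : ContinuousOn (fun s : ℝ => η (S s x)) (Set.Icc 0 1) :=
      continuousOn_segment fun s hs => (hx s hs).1.1.continuousAt
    have hcDη : ContinuousOn (fun s : ℝ => fderiv 𝕜 η (S s x)) (Set.Icc 0 1) :=
      continuousOn_segment fun s hs => (hx s hs).1.2.continuousAt
    have hSc : ∀ v, ContinuousOn (fun s : ℝ => S s v) (Set.Icc 0 1) := fun v => by
      simp only [hS]; fun_prop
    have hβa : ∀ b, β x b = ∫ s in (0 : ℝ)..1, η (S s x) e b := fun b => by
      have := ContinuousLinearMap.intervalIntegral_comp_comm (𝕜 := 𝕜) (μ := MeasureTheory.volume)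
        (a := (0 : ℝ)) (b := 1) (f := fun s : ℝ => η (S s x) e)
        (ContinuousLinearMap.apply 𝕜 𝕜 b) (by
          refine ContinuousOn.intervalIntegrable ?_
          rw [Set.uIcc_of_le zero_le_one]
          exact hcη.clm_apply continuousOn_const)
      exact this.symm
    have hDβa : ∀ a b, fderiv 𝕜 β x a b =
        ∫ s in (0 : ℝ)..1, fderiv 𝕜 η (S s x) (S s a) e b := fun a b => by
      have k1 : fderiv 𝕜 β x a = ∫ s in (0 : ℝ)..1, fderiv 𝕜 η (S s x) (S s a) e := by
        rw [hx3 a]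
        refine intervalIntegral.integral_congr fun s hs => ?_
        rw [Set.uIcc_of_le zero_le_one] at hs
        exact hηe s hs (S s a)
      have := ContinuousLinearMap.intervalIntegral_comp_comm (𝕜 := 𝕜) (μ := MeasureTheory.volume)
        (a := (0 : ℝ)) (b := 1) (f := fun s : ℝ => fderiv 𝕜 η (S s x) (S s a) e)
        (ContinuousLinearMap.apply 𝕜 𝕜 b) (by
          refine ContinuousOn.intervalIntegrable ?_
          rw [Set.uIcc_of_le zero_le_one]
          exact (hcDη.clm_apply (hSc a)).clm_apply continuousOn_const)
      rw [k1]
      exact this.symm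
    have hμd : HasFDerivAt (fun x => ℓ x • β x) _ x :=
      ℓ.hasFDerivAt.smul (hx1.differentiableAt hn).hasFDerivAt
    have hμa : ∀ a b, fderiv 𝕜 (fun x => ℓ x • β x) x a b =
        ℓ x * fderiv 𝕜 β x a b + ℓ a * β x b := fun a b => by
      rw [hμd.fderiv]; simp
    have hint : ∀ a b, IntervalIntegrable (fun s : ℝ => fderiv 𝕜 η (S s x) (S s a) e b)
        MeasureTheory.volume 0 1 := fun a b => by
      refine ContinuousOn.intervalIntegrable ?_
      rw [Set.uIcc_of_le zero_le_one]
      exact ((hcDη.clm_apply (hSc a)).clm_apply continuousOn_const).clm_apply continuousOn_const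
    have hint' : ∀ b, IntervalIntegrable (fun s : ℝ => η (S s x) e b)
        MeasureTheory.volume 0 1 := fun b => by
      refine ContinuousOn.intervalIntegrable ?_
      rw [Set.uIcc_of_le zero_le_one]
      exact (hcη.clm_apply continuousOn_const).clm_apply continuousOn_const
    rw [hμa, hμa, hβa, hβa, hDβa, hDβa]
    simp only [← intervalIntegral.integral_const_mul]
    rw [← intervalIntegral.integral_add ((hint a b).const_mul _) ((hint' b).const_mul _),
      ← intervalIntegral.integral_add ((hint b a).const_mul _) ((hint' a).const_mul _),
      ← intervalIntegral.integral_sub (((hint a b).const_mul _).add ((hint' b).const_mul _))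
        (((hint b a).const_mul _).add ((hint' a).const_mul _))]
    have hS1 : ∀ v, S 1 v = v := fun v => by simp [hS, projAlong_apply]
    have hS0 : ∀ v, S 0 v = projAlong ℓ e v := fun v => by simp [hS]
    have hSv : ∀ s v, S s v = v - ((1 - s) * ℓ v) • e := fun s v => by
      simp only [hS, projAlong_apply, ContinuousLinearMap.smulRight_apply]
      module
    -- Between the endpoints the pull-back of `η` passes from its value at the projection of `x`,
    -- which is zero, to `η` itself.
    have hfin := integral_segment_eq_sub (𝕜 := 𝕜) (f := fun s => η (S s x) (S s a) (S s b))
      (f' := fun s => (ℓ x * fderiv 𝕜 η (S s x) (S s a) e b + ℓ a * η (S s x) e b) -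
        (ℓ x * fderiv 𝕜 η (S s x) (S s b) e a + ℓ b * η (S s x) e a)) (fun s hs => ?_) ?_
    · rw [hfin]
      simp only [hS1, hS0]
      rw [hx0 (by simp [projAlong_apply, he])]
      simp
    · refine hasDerivAt_segment_form (hηd s hs) (hskew _) ((hx s hs).2) (fun v => ?_) (hSv s)
        (hskd s hs)
      have := ((hasDerivAt_id (s : 𝕜)).smul_const (ℓ.smulRight e v)).const_add (projAlong ℓ e v)
      exact this.congr_deriv (by simp)
    · refine ContinuousOn.sub (ContinuousOn.add ?_ ?_) (ContinuousOn.add ?_ ?_) <;>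
        refine continuousOn_const.mul ?_
      · exact ((hcDη.clm_apply (hSc a)).clm_apply continuousOn_const).clm_apply continuousOn_const
      · exact (hcη.clm_apply continuousOn_const).clm_apply continuousOn_const
      · exact ((hcDη.clm_apply (hSc b)).clm_apply continuousOn_const).clm_apply continuousOn_const
      · exact (hcη.clm_apply continuousOn_const).clm_apply continuousOn_const

end RelativePoincare

/-! ### Dividing by a family of skew forms with a simple degeneracy. -/

section Solver

variable {𝕜 : Type u} [RCLike 𝕜] {r : WithTop ℕ∞}
variable {Z : Type u} [NormedAddCommGroup Z] [NormedSpace 𝕜 Z]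
variable {E : Type u} [NormedAddCommGroup E] [NormedSpace 𝕜 E]

/-- The bordered operator `(v, a) ↦ (B v + a₁ φ₁ + a₂ φ₂, (φ₁ v, φ₂ v))`. -/
def bordered (φ₁ φ₂ : E →L[𝕜] 𝕜) (B : E →L[𝕜] E →L[𝕜] 𝕜) :
    (E × 𝕜 × 𝕜) →L[𝕜] (E →L[𝕜] 𝕜) × 𝕜 × 𝕜 :=
  (ContinuousLinearMap.inl 𝕜 (E →L[𝕜] 𝕜) (𝕜 × 𝕜)).comp
      (B.comp (ContinuousLinearMap.fst 𝕜 E (𝕜 × 𝕜))) +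
    ((((ContinuousLinearMap.fst 𝕜 𝕜 𝕜).comp (ContinuousLinearMap.snd 𝕜 E (𝕜 × 𝕜))).smulRight φ₁ +
      ((ContinuousLinearMap.snd 𝕜 𝕜 𝕜).comp (ContinuousLinearMap.snd 𝕜 E (𝕜 × 𝕜))).smulRight φ₂).prod
      ((φ₁.prod φ₂).comp (ContinuousLinearMap.fst 𝕜 E (𝕜 × 𝕜))))

theorem bordered_apply (φ₁ φ₂ : E →L[𝕜] 𝕜) (B : E →L[𝕜] E →L[𝕜] 𝕜) (v : E) (a b : 𝕜) :
    bordered φ₁ φ₂ B (v, a, b) = (B v + (a • φ₁ + b • φ₂), φ₁ v, φ₂ v) := by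
  simp [bordered]

theorem contDiffAt_bordered {φ₁ φ₂ : E →L[𝕜] 𝕜} {A : Z → E →L[𝕜] E →L[𝕜] 𝕜} {z : Z}
    (hA : ContDiffAt 𝕜 r A z) : ContDiffAt 𝕜 r (fun z => bordered φ₁ φ₂ (A z)) z := by
  unfold bordered
  exact ((contDiffAt_const.clm_comp (hA.clm_comp contDiffAt_const))).add contDiffAt_const

/-- A skew form whose kernel is spanned by a basis dual to the border has invertible border. -/
theorem bordered_injective {φ₁ φ₂ : E →L[𝕜] 𝕜} {B : E →L[𝕜] E →L[𝕜] 𝕜} {k₁ k₂ : E}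
    (hB : ∀ a b, B a b = -B b a) (hk₁ : B k₁ = 0) (hk₂ : B k₂ = 0)
    (hker : ∀ v, B v = 0 → ∃ a b : 𝕜, v = a • k₁ + b • k₂)
    (h11 : φ₁ k₁ = 1) (h12 : φ₁ k₂ = 0) (h21 : φ₂ k₁ = 0) (h22 : φ₂ k₂ = 1) :
    Function.Injective (bordered φ₁ φ₂ B) := by
  rw [injective_iff_map_eq_zero]
  rintro ⟨v, a, b⟩ h
  rw [bordered_apply] at h
  simp only [Prod.mk_eq_zero] at h
  obtain ⟨h0, hv1, hv2⟩ := h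
  have e1 := congrArg (fun L => L k₁) h0
  have e2 := congrArg (fun L => L k₂) h0
  simp only [add_apply, smul_apply, h11, h12, h21, h22, hB v, hk₁, hk₂] at e1 e2
  simp at e1 e2
  subst e1 e2
  simp at h0
  obtain ⟨a, b, rfl⟩ := hker v h0
  simp [h11, h12, h21, h22] at hv1 hv2
  simp [hv1, hv2]

variable [FiniteDimensional 𝕜 E]

theorem exists_equiv_bordered {φ₁ φ₂ : E →L[𝕜] 𝕜} {B : E →L[𝕜] E →L[𝕜] 𝕜}
    (h : Function.Injective (bordered φ₁ φ₂ B)) :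
    ∃ e : (E × 𝕜 × 𝕜) ≃L[𝕜] (E →L[𝕜] 𝕜) × 𝕜 × 𝕜, (e : _ →L[𝕜] _) = bordered φ₁ φ₂ B := by
  have hd : Module.finrank 𝕜 (E →L[𝕜] 𝕜) = Module.finrank 𝕜 E := by
    rw [← (LinearMap.toContinuousLinearMap (𝕜 := 𝕜) (E := E) (F' := 𝕜)).finrank_eq]
    exact Subspace.dual_finrank_eq
  let e := LinearMap.linearEquivOfInjective
    (bordered φ₁ φ₂ B : (E × 𝕜 × 𝕜) →ₗ[𝕜] (E →L[𝕜] 𝕜) × 𝕜 × 𝕜) h (by simp [hd])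
  exact ⟨e.toContinuousLinearEquiv, ContinuousLinearMap.ext fun x => rfl⟩

omit [FiniteDimensional 𝕜 E] in
/-- Relations between the columns of the inverse of the bordered operator of a skew form. -/
theorem bordered_inverse_relations {φ₁ φ₂ β : E →L[𝕜] 𝕜} {B : E →L[𝕜] E →L[𝕜] 𝕜}
    (hB : ∀ a b, B a b = -B b a) {x₁ x₂ u : E × 𝕜 × 𝕜}
    (h₁ : bordered φ₁ φ₂ B x₁ = (0, 1, 0)) (h₂ : bordered φ₁ φ₂ B x₂ = (0, 0, 1))
    (hu : bordered φ₁ φ₂ B u = (β, 0, 0)) :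
    B x₁.1 = B x₁.1 x₂.1 • φ₂ ∧ B x₂.1 = -(B x₁.1 x₂.1) • φ₁ ∧
      B u.1 = β - β x₁.1 • φ₁ - β x₂.1 • φ₂ := by
  obtain ⟨v₁, a₁₁, a₁₂⟩ := x₁
  obtain ⟨v₂, a₂₁, a₂₂⟩ := x₂
  obtain ⟨w, a, b⟩ := u
  have hBs : ∀ a, B a a = 0 := fun a => self_eq_neg.1 (hB a a)
  simp only [bordered_apply, Prod.mk.injEq] at h₁ h₂ hu ⊢
  obtain ⟨e1, p11, p21⟩ := h₁
  obtain ⟨e2, p12, p22⟩ := h₂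
  obtain ⟨e3, q1, q2⟩ := hu
  have c11 := congrArg (fun L => L v₁) e1
  have c12 := congrArg (fun L => L v₂) e1
  have c21 := congrArg (fun L => L v₁) e2
  have c22 := congrArg (fun L => L v₂) e2
  simp only [add_apply, smul_apply, smul_eq_mul, hBs, p11, p12, p21, p22] at c11 c12 c21 c22
  simp at c11 c12 c21 c22
  subst c11 c22
  have f1 : B v₁ = B v₁ v₂ • φ₂ := by
    -- Evaluating the defining equations on `v₁` and `v₂` and using skewness kills the diagonal
    -- coefficients, so that only the number `B v₁ v₂` is left.
    rw [eq_neg_of_add_eq_zero_left c12]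
    rw [eq_neg_of_add_eq_zero_left e1]; simp
  have f2 : B v₂ = -(B v₁ v₂) • φ₁ := by
    rw [← hB v₂ v₁, eq_neg_of_add_eq_zero_left c21]
    rw [eq_neg_of_add_eq_zero_left e2]; simp
  refine ⟨f1, f2, ?_⟩
  have h1 : B w v₁ = 0 := by rw [hB, f1]; simp [q2]
  have h2 : B w v₂ = 0 := by rw [hB, f2]; simp [q1]
  have g1 := congrArg (fun L => L v₁) e3
  have g2 := congrArg (fun L => L v₂) e3
  simp [h1, h2, p11, p12, p21, p22] at g1 g2
  rw [← g1, ← g2, ← e3]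
  abel

/-- Division with respect to a family of skew forms degenerating simply along `{ℓ = 0}`. -/
theorem exists_field_solving (hr : r = ((⊤ : ℕ∞) : WithTop ℕ∞) ∨ r = ⊤)
    {A : Z → E →L[𝕜] E →L[𝕜] 𝕜} {z₀ e : Z} {ℓ : Z →L[𝕜] 𝕜} (hA : SmoothNear 𝕜 r A z₀)
    (hskew : ∀ z a b, A z a b = -A z b a) (he : ℓ e = 1) (hz₀ : ℓ z₀ = 0)
    (hdeg : ∀ᶠ z in 𝓝 z₀, ℓ z = 0 → ∃ v, v ≠ 0 ∧ A z v = 0) {k₁ k₂ : E}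
    (hk₁ : A z₀ k₁ = 0) (hk₂ : A z₀ k₂ = 0)
    (hker : ∀ v, A z₀ v = 0 → ∃ a b : 𝕜, v = a • k₁ + b • k₂)
    (hd : fderiv 𝕜 A z₀ e k₁ k₂ ≠ 0) {β : Z → E →L[𝕜] 𝕜} (hβ : SmoothNear 𝕜 r β z₀) :
    ∃ V : Z → E, SmoothNear 𝕜 r V z₀ ∧ (∀ᶠ z in 𝓝 z₀, A z (V z) = ℓ z • β z) ∧
      ∀ᶠ z in 𝓝 z₀, ℓ z = 0 → (∀ v, A z v = 0 → β z v = 0) → V z = 0 := by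
  have hn := ne_zero_of_infty_or_top hr
  have _ : CompleteSpace E := FiniteDimensional.complete 𝕜 E
  have hAd : HasFDerivAt A (fderiv 𝕜 A z₀) z₀ := (hA.self.differentiableAt hn).hasFDerivAt
  set D := fderiv 𝕜 A z₀ e with hD
  have hDskew : ∀ a b, D a b = -D b a := fun a b => by
    have k1 := (hAd.clm_apply (hasFDerivAt_const a z₀)).clm_apply (hasFDerivAt_const b z₀)
    have k2 := ((hAd.clm_apply (hasFDerivAt_const b z₀)).clm_apply (hasFDerivAt_const a z₀)).neg
    have k3 := k1.unique (k2.congr_of_eventuallyEq (Eventually.of_forall fun z => hskew z a b))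
    simpa using congrArg (fun L => L e) k3
  have hDs : ∀ a, D a a = 0 := fun a => self_eq_neg.1 (hDskew a a)
  -- The skew form `D` is nonzero on the kernel plane, so it supplies a pair of forms dual to `k₁`,
  -- `k₂`.
  set φ₁ : E →L[𝕜] 𝕜 := -(D k₁ k₂)⁻¹ • D k₂ with hφ₁
  set φ₂ : E →L[𝕜] 𝕜 := (D k₁ k₂)⁻¹ • D k₁ with hφ₂
  have h11 : φ₁ k₁ = 1 := by
    simp only [hφ₁, smul_apply, smul_eq_mul, hDskew k₂ k₁]
    field_simp
  have h12 : φ₁ k₂ = 0 := by simp [hφ₁, hDs]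
  have h21 : φ₂ k₁ = 0 := by simp [hφ₂, hDs]
  have h22 : φ₂ k₂ = 1 := by
    simp only [hφ₂, smul_apply, smul_eq_mul]
    field_simp
  set T : Z → (E × 𝕜 × 𝕜) →L[𝕜] (E →L[𝕜] 𝕜) × 𝕜 × 𝕜 := fun z => bordered φ₁ φ₂ (A z) with hT
  have hTs : SmoothNear 𝕜 r T z₀ := hA.mono fun z hz => contDiffAt_bordered hz
  have hinj₀ := bordered_injective (hskew z₀) hk₁ hk₂ hker h11 h12 h21 h22
  obtain ⟨e₀, he₀⟩ := exists_equiv_bordered hinj₀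
  have hTinv : ∀ᶠ z in 𝓝 z₀, T z ∈ Set.range
      (ContinuousLinearEquiv.toContinuousLinearMap : ((E × 𝕜 × 𝕜) ≃L[𝕜] _) → _ →L[𝕜] _) := by
    refine hTs.continuousAt.eventually ?_
    simp only [hT]
    rw [← he₀]
    exact ContinuousLinearEquiv.nhds e₀
  set G : Z → ((E →L[𝕜] 𝕜) × 𝕜 × 𝕜) →L[𝕜] (E × 𝕜 × 𝕜) := fun z => (T z).inverse with hG
  have hGs : SmoothNear 𝕜 r G z₀ := by
    filter_upwards [hTs, hTinv] with z h1 h2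
    obtain ⟨ez, hez⟩ := h2
    refine ContDiffAt.comp (g := ContinuousLinearMap.inverse) z ?_ h1
    rw [← hez]
    exact contDiffAt_map_inverse ez
  have hTG : ∀ᶠ z in 𝓝 z₀, (∀ y, T z (G z y) = y) ∧ ∀ x, G z (T z x) = x := by
    filter_upwards [hTinv] with z h2
    obtain ⟨ez, hez⟩ := h2
    simp [hG, ← hez]
  set v₁ : Z → E := fun z => (G z (0, 1, 0)).1 with hv₁
  set v₂ : Z → E := fun z => (G z (0, 0, 1)).1 with hv₂
  set w : Z → E := fun z => (G z (β z, 0, 0)).1 with hw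
  have hfst : ∀ {y : Z → (E →L[𝕜] 𝕜) × 𝕜 × 𝕜}, SmoothNear 𝕜 r y z₀ →
      SmoothNear 𝕜 r (fun z => (G z (y z)).1) z₀ := fun hy => by
    filter_upwards [hGs, hy] with z h1 h2
    exact contDiffAt_fst.comp z (h1.clm_apply h2)
  have hv₁s : SmoothNear 𝕜 r v₁ z₀ := hfst (ContDiff.smoothNear contDiff_const _)
  have hv₂s : SmoothNear 𝕜 r v₂ z₀ := hfst (ContDiff.smoothNear contDiff_const _)
  have hws : SmoothNear 𝕜 r w z₀ := hfst (hβ.prodMk (ContDiff.smoothNear contDiff_const _))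
  -- This scalar carries the whole degeneracy of `A`: where `s` is zero, `v₁` and `v₂` lie in the
  -- kernel.
  set s : Z → 𝕜 := fun z => A z (v₁ z) (v₂ z) with hs
  have hss : SmoothNear 𝕜 r s z₀ := by
    filter_upwards [hA, hv₁s, hv₂s] with z h1 h2 h3
    exact (h1.clm_apply h2).clm_apply h3
  have hrel : ∀ᶠ z in 𝓝 z₀, A z (v₁ z) = s z • φ₂ ∧ A z (v₂ z) = -s z • φ₁ ∧
      A z (w z) = β z - β z (v₁ z) • φ₁ - β z (v₂ z) • φ₂ := by
    filter_upwards [hTG] with z hz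
    exact bordered_inverse_relations (hskew z) (hz.1 _) (hz.1 _) (hz.1 _)
  -- If `s` were nonzero, a kernel vector of `A z` would be killed by both border forms too, against
  -- invertibility of the bordered operator.
  have hs0 : ∀ᶠ z in 𝓝 z₀, ℓ z = 0 → s z = 0 := by
    filter_upwards [hdeg, hrel, hTG] with z h1 h2 h3 hz
    obtain ⟨v, hv, hAv⟩ := h1 hz
    by_contra hsz
    have k1 := hskew z v (v₁ z)
    have k2 := hskew z v (v₂ z)
    rw [hAv, h2.1] at k1
    rw [hAv, h2.2.1] at k2
    simp [hsz] at k1 k2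
    have k3 : T z (v, 0, 0) = 0 := by
      simp [hT, bordered_apply, hAv, k1, k2]
    have := h3.2 (v, 0, 0)
    rw [k3, map_zero] at this
    exact hv (congrArg Prod.fst this).symm
  have hG₀ : (∀ y, T z₀ (G z₀ y) = y) ∧ ∀ x, G z₀ (T z₀ x) = x := hTG.self_of_nhds
  have hv₁0 : v₁ z₀ = k₁ := by
    have h1 : T z₀ (k₁, 0, 0) = (0, 1, 0) := by simp [hT, bordered_apply, hk₁, h11, h21]
    simp only [hv₁]
    rw [← h1, hG₀.2]
  have hv₂0 : v₂ z₀ = k₂ := by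
    have h1 : T z₀ (k₂, 0, 0) = (0, 0, 1) := by simp [hT, bordered_apply, hk₂, h12, h22]
    simp only [hv₂]
    rw [← h1, hG₀.2]
  obtain ⟨g, hg, hsg, hg0⟩ := exists_division hr hss he hz₀ hs0
  -- The derivatives of `v₁` and `v₂` do not contribute, since they are paired with kernel vectors;
  -- so `s` vanishes to exactly first order.
  have hsd : fderiv 𝕜 s z₀ e = D k₁ k₂ := by
    have k1 := (hAd.clm_apply (hv₁s.self.differentiableAt hn).hasFDerivAt).clm_apply
      (hv₂s.self.differentiableAt hn).hasFDerivAt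
    have k2 : fderiv 𝕜 s z₀ = _ := k1.fderiv
    rw [k2]
    simp [hv₁0, hv₂0, hk₁]
    rw [hskew z₀ _ k₂, hk₂]
    simp [hD]
  rw [hsd] at hg0
  have hgne : ∀ᶠ z in 𝓝 z₀, g z ≠ 0 := hg.continuousAt.eventually_ne (by rw [hg0]; exact hd)
  -- The vector `ℓ w` solves the equation up to multiples of the border forms; with `s = ℓ g`, the
  -- fields `v₁` and `v₂` correct these without dividing by `ℓ`.
  refine ⟨fun z => ℓ z • w z + (g z)⁻¹ • (β z (v₂ z) • v₁ z - β z (v₁ z) • v₂ z), ?_, ?_, ?_⟩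
  · filter_upwards [hws, hg, hgne, hβ, hv₁s, hv₂s] with z h1 h2 h3 h4 h5 h6
    exact (ℓ.contDiff.contDiffAt.smul h1).add ((h2.inv h3).smul
      (((h4.clm_apply h6).smul h5).sub ((h4.clm_apply h5).smul h6)))
  · filter_upwards [hrel, hsg, hgne] with z h1 h2 h3
    simp only [map_add, map_smul, map_sub]
    rw [h1.1, h1.2.1, h1.2.2, h2]
    have : (g z)⁻¹ * g z = 1 := inv_mul_cancel₀ h3
    ext x
    simp only [add_apply, sub_apply, smul_apply, smul_eq_mul]
    linear_combination (ℓ z * (β z (v₂ z) * φ₂ x + β z (v₁ z) * φ₁ x)) * this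
  · filter_upwards [hrel, hs0] with z h1 h2 hz hker
    have k1 : β z (v₁ z) = 0 := hker _ (by rw [h1.1, h2 hz, zero_smul])
    have k2 : β z (v₂ z) = 0 := hker _ (by rw [h1.2.1, h2 hz, neg_zero, zero_smul])
    simp [hz, k1, k2]

end Solver

/-! ### Evaluating exterior products through shuffles. -/

section WedgeAlgebra

variable {𝕜 : Type*} [Field 𝕜] {V : Type*} [AddCommGroup V] [Module 𝕜 V]

theorem wedge_apply {k l : ℕ} (a : V [⋀^Fin k]→ₗ[𝕜] 𝕜) (b : V [⋀^Fin l]→ₗ[𝕜] 𝕜)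
    (v : Fin (k + l) → V) :
    wedge a b v = ∑ σ : Equiv.Perm.ModSumCongr (Fin k) (Fin l),
      ((Equiv.Perm.sign (Quotient.out σ) : ℤ) : 𝕜) *
        (a (fun i => v (finSumFinEquiv (Quotient.out σ (Sum.inl i)))) *
          b (fun j => v (finSumFinEquiv (Quotient.out σ (Sum.inr j))))) := by
  simp only [wedge, AlternatingMap.domDomCongr_apply, LinearMap.compAlternatingMap_apply,
    AlternatingMap.domCoprod_apply, sum_apply, map_sum]
  refine Finset.sum_congr rfl fun σ _ => ?_
  conv_lhs => rw [← Quotient.out_eq' σ]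
  rw [AlternatingMap.domCoprod.summand_mk'']
  simp only [smul_apply, MultilinearMap.domDomCongr_apply,
    MultilinearMap.domCoprod_apply, AlternatingMap.coe_multilinearMap, Function.comp_apply]
  rw [Units.smul_def, map_zsmul, zsmul_eq_mul, LinearMap.mul'_apply]

theorem wedge_comp {W : Type*} [AddCommGroup W] [Module 𝕜 W] {k l : ℕ} (a : V [⋀^Fin k]→ₗ[𝕜] 𝕜)
    (b : V [⋀^Fin l]→ₗ[𝕜] 𝕜) (L : W →ₗ[𝕜] V) :
    wedge (a.compLinearMap L) (b.compLinearMap L) = (wedge a b).compLinearMap L := by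
  ext v
  rw [AlternatingMap.compLinearMap_apply, wedge_apply, wedge_apply]
  rfl

theorem wedgePow_comp {W : Type*} [AddCommGroup W] [Module 𝕜 W] (b : V [⋀^Fin 2]→ₗ[𝕜] 𝕜)
    (L : W →ₗ[𝕜] V) (k : ℕ) : wedgePow (b.compLinearMap L) k = (wedgePow b k).compLinearMap L := by
  induction k with
  | zero => ext v; simp [wedgePow]
  | succ k ih => rw [wedgePow, ih, wedge_comp]; rfl

theorem zero_wedge {k l : ℕ} (b : V [⋀^Fin l]→ₗ[𝕜] 𝕜) :
    wedge (0 : V [⋀^Fin k]→ₗ[𝕜] 𝕜) b = 0 := by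
  ext v; rw [wedge_apply]; simp

theorem smul_wedge {k l : ℕ} (a : V [⋀^Fin k]→ₗ[𝕜] 𝕜) (b : V [⋀^Fin l]→ₗ[𝕜] 𝕜) (c : 𝕜) :
    wedge (c • a) b = c • wedge a b := by
  ext v
  rw [AlternatingMap.smul_apply, wedge_apply, wedge_apply, smul_eq_mul, Finset.mul_sum]
  refine Finset.sum_congr rfl fun σ _ => ?_
  simp only [AlternatingMap.smul_apply, smul_eq_mul]
  ring

theorem add_wedge {k l : ℕ} (a a' : V [⋀^Fin k]→ₗ[𝕜] 𝕜) (b : V [⋀^Fin l]→ₗ[𝕜] 𝕜) :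
    wedge (a + a') b = wedge a b + wedge a' b := by
  ext v
  rw [AlternatingMap.add_apply, wedge_apply, wedge_apply, wedge_apply, ← Finset.sum_add_distrib]
  refine Finset.sum_congr rfl fun σ _ => ?_
  simp only [AlternatingMap.add_apply]
  ring

/-- If only the trivial shuffle contributes, the exterior product is a product of values. -/
theorem wedge_apply_eq_mul {k l : ℕ} {a : V [⋀^Fin k]→ₗ[𝕜] 𝕜} {b : V [⋀^Fin l]→ₗ[𝕜] 𝕜}
    {v : Fin (k + l) → V}
    (h : ∀ σ : Equiv.Perm (Fin k ⊕ Fin l), (∃ i j, σ (Sum.inl i) = Sum.inr j) →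
      (∃ i j, σ (Sum.inr j) = Sum.inl i) →
      a (fun i => v (finSumFinEquiv (σ (Sum.inl i)))) *
        b (fun j => v (finSumFinEquiv (σ (Sum.inr j)))) = 0) :
    wedge a b v = a (fun i => v (Fin.castAdd l i)) * b (fun j => v (Fin.natAdd k j)) := by
  classical
  have hterm : ∀ σ : Equiv.Perm.ModSumCongr (Fin k) (Fin l), σ ≠ Quotient.mk'' 1 →
      a (fun i => v (finSumFinEquiv (Quotient.out σ (Sum.inl i)))) *
        b (fun j => v (finSumFinEquiv (Quotient.out σ (Sum.inr j)))) = 0 := by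
    intro σ hσ
    set τ : Equiv.Perm (Fin k ⊕ Fin l) := Quotient.out σ with hτ
    have hn : τ ∉ (Equiv.Perm.sumCongrHom (Fin k) (Fin l)).range := by
      intro hmem
      apply hσ
      rw [← Quotient.out_eq' σ, ← hτ]
      refine Quotient.sound' ?_
      rw [QuotientGroup.leftRel_apply]
      simpa using (Subgroup.inv_mem _ hmem)
    have h1 : ∃ i j, τ (Sum.inl i) = Sum.inr j := by
      by_contra! hcon
      refine hn (Equiv.Perm.mem_sumCongrHom_range_of_perm_mapsTo_inl ?_)
      rintro _ ⟨i, rfl⟩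
      rcases hx : τ (Sum.inl i) with i' | j'
      · exact ⟨i', rfl⟩
      · exact absurd hx (hcon i j')
    -- A permutation mapping the finite right block into itself fills it, leaving no room for an
    -- index arriving from the left.
    have h2 : ∃ i j, τ (Sum.inr j) = Sum.inl i := by
      by_contra! hcon
      have hmaps : Set.MapsTo τ (Set.range Sum.inr) (Set.range Sum.inr) := by
        rintro _ ⟨j, rfl⟩
        rcases hx : τ (Sum.inr j) with i' | j'
        · exact absurd hx (hcon i' j)
        · exact ⟨j', rfl⟩
      have hsurj := (((Set.finite_range (Sum.inr : Fin l → Fin k ⊕ Fin l)).injOn_iff_bijOn_of_mapsTo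
        hmaps).1 τ.injective.injOn).surjOn
      obtain ⟨i, j, hij⟩ := h1
      obtain ⟨_, ⟨j', rfl⟩, hj'⟩ := hsurj ⟨j, rfl⟩
      have := τ.injective (hij.trans hj'.symm)
      simp at this
    exact h τ h1 h2
  rw [wedge, AlternatingMap.domDomCongr_apply, LinearMap.compAlternatingMap_apply,
    AlternatingMap.domCoprod_apply, sum_apply, map_sum]
  refine (Finset.sum_eq_single (Quotient.mk'' 1 : Equiv.Perm.ModSumCongr (Fin k) (Fin l))
    ?_ ?_).trans ?_
  · intro σ _ hσ
    have := hterm σ hσ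
    conv_lhs => rw [← Quotient.out_eq' σ]
    rw [AlternatingMap.domCoprod.summand_mk'']
    simp only [smul_apply, MultilinearMap.domDomCongr_apply,
      MultilinearMap.domCoprod_apply, AlternatingMap.coe_multilinearMap, Function.comp_apply]
    rw [Units.smul_def, map_zsmul, zsmul_eq_mul, LinearMap.mul'_apply]
    exact mul_eq_zero_of_right _ this
  · intro h; exact absurd (Finset.mem_univ _) h
  · rw [AlternatingMap.domCoprod.summand_mk'']
    simp

theorem wedge_apply_of_right_killed {k l : ℕ} {a : V [⋀^Fin k]→ₗ[𝕜] 𝕜} {b : V [⋀^Fin l]→ₗ[𝕜] 𝕜}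
    {v : Fin (k + l) → V}
    (h : ∀ i, ∀ u : Fin l → V, (∃ j, u j = v (Fin.castAdd l i)) → b u = 0) :
    wedge a b v = a (fun i => v (Fin.castAdd l i)) * b (fun j => v (Fin.natAdd k j)) :=
  wedge_apply_eq_mul fun σ _ ⟨i, j, hij⟩ =>
    mul_eq_zero_of_right _ (h i _ ⟨j, by simp only [hij]; rfl⟩)

theorem wedge_apply_of_left_killed {k l : ℕ} {a : V [⋀^Fin k]→ₗ[𝕜] 𝕜} {b : V [⋀^Fin l]→ₗ[𝕜] 𝕜}
    {v : Fin (k + l) → V}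
    (h : ∀ j, ∀ u : Fin k → V, (∃ i, u i = v (Fin.natAdd k j)) → a u = 0) :
    wedge a b v = a (fun i => v (Fin.castAdd l i)) * b (fun j => v (Fin.natAdd k j)) :=
  wedge_apply_eq_mul fun σ ⟨i, j, hij⟩ _ =>
    mul_eq_zero_of_left (h j _ ⟨i, by simp only [hij]; rfl⟩) _

theorem wedge_apply_eq_zero {k l : ℕ} {a : V [⋀^Fin k]→ₗ[𝕜] 𝕜} {b : V [⋀^Fin l]→ₗ[𝕜] 𝕜}
    {x : V} (ha : ∀ u : Fin k → V, (∃ i, u i = x) → a u = 0)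
    (hb : ∀ u : Fin l → V, (∃ i, u i = x) → b u = 0) (v : Fin (k + l) → V) (hv : ∃ i, v i = x) :
    wedge a b v = 0 := by
  obtain ⟨i, hi⟩ := hv
  rw [wedge_apply]
  refine Finset.sum_eq_zero fun σ _ => mul_eq_zero_of_right _ ?_
  rcases hx : (Quotient.out σ : Equiv.Perm (Fin k ⊕ Fin l)).symm (finSumFinEquiv.symm i) with i' | j'
  · refine mul_eq_zero_of_left (ha _ ⟨i', ?_⟩) _
    rw [← hx]; simp [hi]
  · refine mul_eq_zero_of_right _ (hb _ ⟨j', ?_⟩)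
    rw [← hx]; simp [hi]

/-- A power of a 2-form vanishes on a family one of whose members is orthogonal to all of it. -/
theorem wedgePow_apply_eq_zero {b : V [⋀^Fin 2]→ₗ[𝕜] 𝕜} {m : ℕ} {v : Fin (2 * m) → V}
    {i : Fin (2 * m)} (h : ∀ j, b ![v i, v j] = 0) : wedgePow b m v = 0 := by
  induction m with
  | zero => exact i.elim0
  | succ m ih =>
    change wedge (wedgePow b m) b v = 0
    rw [wedge_apply]
    refine Finset.sum_eq_zero fun σ _ => mul_eq_zero_of_right _ ?_
    have hb : ∀ u : Fin 2 → V, b ![u 0, u 1] = 0 → b u = 0 := fun u hu => by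
      rwa [← List.ofFn_inj.1 (show List.ofFn ![u 0, u 1] = List.ofFn u by simp)]
    rcases hx : (Quotient.out σ : Equiv.Perm (Fin (2 * m) ⊕ Fin 2)).symm
      (finSumFinEquiv.symm i) with i' | j'
    · refine mul_eq_zero_of_left (ih (i := i') fun j => ?_) _
      rw [← hx]; simp [h]
    · refine mul_eq_zero_of_right _ (hb _ ?_)
      have hj : v (finSumFinEquiv ((Quotient.out σ : Equiv.Perm (Fin (2 * m) ⊕ Fin 2))
          (Sum.inr j'))) = v i := by rw [← hx]; simp
      fin_cases j'
      · simp only [Fin.zero_eta] at hj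
        rw [hj]; exact h _
      · simp only [Fin.mk_one] at hj
        rw [hj]
        have h1 := b.map_swap ![v i, v (finSumFinEquiv ((Quotient.out σ : Equiv.Perm (Fin (2 * m) ⊕ Fin 2))
          (Sum.inr 0)))] (i := 0) (j := 1) (by decide)
        rw [h] at h1
        rw [neg_zero] at h1
        rw [← h1]
        congr 1
        ext t; fin_cases t <;> simp

/-- A nonzero form of top degree is not killed by a nonzero vector. -/
theorem eq_zero_of_top_degree [FiniteDimensional 𝕜 V] {k : ℕ} (hk : Module.finrank 𝕜 V = k)
    {a : V [⋀^Fin k]→ₗ[𝕜] 𝕜} {x : V} (hx : x ≠ 0)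
    (ha : ∀ u : Fin k → V, (∃ i, u i = x) → a u = 0) : a = 0 := by
  ext v
  by_cases hv : LinearIndependent 𝕜 v
  · let B := basisOfLinearIndependentOfCardEqFinrank' v hv (by simp [hk])
    have hB : ⇑B = v := coe_basisOfLinearIndependentOfCardEqFinrank' _ _ _
    obtain ⟨i, hi⟩ : ∃ i, B.repr x i ≠ 0 := by
      by_contra! hcon
      exact hx (by rw [← B.sum_repr x]; simp [hcon])
    have h1 := ha (Function.update v i x) ⟨i, by simp⟩
    rw [← B.sum_repr x, a.map_update_sum, Finset.sum_eq_single i] at h1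
    · rw [hB, a.map_update_smul, Function.update_eq_self] at h1
      exact (smul_eq_zero.1 h1).resolve_left hi
    · intro j _ hji
      rw [hB, a.map_update_smul]
      have : a (Function.update v i (v j)) = 0 :=
        a.map_eq_zero_of_eq _ (i := i) (j := j) (by simp [Function.update_of_ne hji]) hji.symm
      rw [this, smul_zero]
    · simp
  · exact a.map_linearDependent v hv

end WedgeAlgebra

/-! ### Commutation of 2-forms in exterior products. -/

section WedgeCommutation

variable {𝕜 : Type*} [Field 𝕜] {V : Type*} [AddCommGroup V] [Module 𝕜 V]

/-- The tensor product of two multilinear forms. -/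
def tensorForm {k l : ℕ} (a : MultilinearMap 𝕜 (fun _ : Fin k => V) 𝕜)
    (b : MultilinearMap 𝕜 (fun _ : Fin l => V) 𝕜) :
    MultilinearMap 𝕜 (fun _ : Fin (k + l) => V) 𝕜 :=
  ((LinearMap.mul' 𝕜 𝕜).compMultilinearMap (a.domCoprod b)).domDomCongr finSumFinEquiv

theorem tensorForm_apply {k l : ℕ} (a : MultilinearMap 𝕜 (fun _ : Fin k => V) 𝕜)
    (b : MultilinearMap 𝕜 (fun _ : Fin l => V) 𝕜) (v : Fin (k + l) → V) :
    tensorForm a b v = a (fun i => v (Fin.castAdd l i)) * b (fun j => v (Fin.natAdd k j)) := by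
  simp [tensorForm]

theorem alternatization_domDomCongr_equiv {ι κ : Type*} [Fintype ι] [DecidableEq ι] [Fintype κ]
    [DecidableEq κ] (e : ι ≃ κ) (m : MultilinearMap 𝕜 (fun _ : ι => V) 𝕜) :
    MultilinearMap.alternatization (m.domDomCongr e) =
      (MultilinearMap.alternatization m).domDomCongr e := by
  ext v
  rw [AlternatingMap.domDomCongr_apply, MultilinearMap.alternatization_apply,
    MultilinearMap.alternatization_apply]
  refine (Fintype.sum_equiv e.permCongr _ _ fun σ => ?_).symm
  rw [Equiv.Perm.sign_permCongr]
  simp only [MultilinearMap.domDomCongr_apply]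
  congr 2
  ext i
  simp [Equiv.permCongr_apply]

theorem alternatization_comp_perm {ι : Type*} [Fintype ι] [DecidableEq ι] (τ : Equiv.Perm ι)
    (m : MultilinearMap 𝕜 (fun _ : ι => V) 𝕜) :
    MultilinearMap.alternatization (m.domDomCongr τ) =
      Equiv.Perm.sign τ • MultilinearMap.alternatization m := by
  rw [alternatization_domDomCongr_equiv, AlternatingMap.domDomCongr_perm]

theorem wedge_alternatization {k l : ℕ} (a : MultilinearMap 𝕜 (fun _ : Fin k => V) 𝕜)
    (b : MultilinearMap 𝕜 (fun _ : Fin l => V) 𝕜) :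
    wedge (MultilinearMap.alternatization a) (MultilinearMap.alternatization b) =
      MultilinearMap.alternatization (tensorForm a b) := by
  rw [wedge, tensorForm, alternatization_domDomCongr_equiv,
    LinearMap.compMultilinearMap_alternatization, MultilinearMap.domCoprod_alternization]

theorem exists_alternatization_eq [CharZero 𝕜] {k : ℕ} (a : V [⋀^Fin k]→ₗ[𝕜] 𝕜) :
    ∃ m : MultilinearMap 𝕜 (fun _ : Fin k => V) 𝕜, MultilinearMap.alternatization m = a := by
  refine ⟨(((k.factorial : 𝕜)⁻¹ • a : V [⋀^Fin k]→ₗ[𝕜] 𝕜) :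
    MultilinearMap 𝕜 (fun _ : Fin k => V) 𝕜), ?_⟩
  rw [AlternatingMap.coe_alternatization, Fintype.card_fin, ← Nat.cast_smul_eq_nsmul 𝕜, smul_smul,
    mul_inv_cancel₀ (Nat.cast_ne_zero.2 k.factorial_ne_zero), one_smul]

/-- In characteristic zero every alternating form is the alternatization of a multilinear one. The
identity then reduces to tensor products that differ by exchanging two blocks of length 2, a product
of two transpositions and hence even. -/
theorem wedge_wedge_right_comm [CharZero 𝕜] {k : ℕ} (a : V [⋀^Fin k]→ₗ[𝕜] 𝕜)
    (b c : V [⋀^Fin 2]→ₗ[𝕜] 𝕜) : wedge (wedge a b) c = wedge (wedge a c) b := by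
  obtain ⟨a, rfl⟩ := exists_alternatization_eq a
  obtain ⟨b, rfl⟩ := exists_alternatization_eq b
  obtain ⟨c, rfl⟩ := exists_alternatization_eq c
  simp only [wedge_alternatization]
  let τ : Equiv.Perm (Fin (k + 2 + 2)) :=
    Equiv.swap (Fin.castAdd 2 (Fin.natAdd k 0)) (Fin.natAdd (k + 2) 0) *
      Equiv.swap (Fin.castAdd 2 (Fin.natAdd k 1)) (Fin.natAdd (k + 2) 1)
  have hτ : Equiv.Perm.sign τ = 1 := by
    rw [Equiv.Perm.sign_mul, Equiv.Perm.sign_swap, Equiv.Perm.sign_swap]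
    · simp
    · simp [Fin.ext_iff]
    · simp [Fin.ext_iff]
  have h1 : tensorForm (tensorForm a b) c = (tensorForm (tensorForm a c) b).domDomCongr τ := by
    ext v
    simp only [MultilinearMap.domDomCongr_apply, tensorForm_apply]
    have e0 : ∀ i : Fin k, τ (Fin.castAdd 2 (Fin.castAdd 2 i)) = Fin.castAdd 2 (Fin.castAdd 2 i) := by
      intro i
      simp only [τ, Equiv.Perm.mul_apply]
      have hi := i.2
      rw [Equiv.swap_apply_of_ne_of_ne (x := Fin.castAdd 2 (Fin.castAdd 2 i))
          (a := Fin.castAdd 2 (Fin.natAdd k 1)),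
        Equiv.swap_apply_of_ne_of_ne (x := Fin.castAdd 2 (Fin.castAdd 2 i))] <;>
        · simp [Fin.ext_iff]
          try omega
    have e1 : ∀ j : Fin 2, τ (Fin.castAdd 2 (Fin.natAdd k j)) = Fin.natAdd (k + 2) j := by
      intro j
      simp only [τ, Equiv.Perm.mul_apply]
      fin_cases j
      · simp only [Fin.zero_eta]
        rw [Equiv.swap_apply_of_ne_of_ne (x := Fin.castAdd 2 (Fin.natAdd k 0)),
          Equiv.swap_apply_left] <;>
          grind [Fin.val_castAdd, Fin.val_natAdd]
      · simp only [Fin.mk_one]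
        rw [Equiv.swap_apply_left, Equiv.swap_apply_of_ne_of_ne] <;>
          grind [Fin.val_castAdd, Fin.val_natAdd]
    have e2 : ∀ j : Fin 2, τ (Fin.natAdd (k + 2) j) = Fin.castAdd 2 (Fin.natAdd k j) := by
      intro j
      simp only [τ, Equiv.Perm.mul_apply]
      fin_cases j
      · simp only [Fin.zero_eta]
        rw [Equiv.swap_apply_of_ne_of_ne (x := Fin.natAdd (k + 2) 0),
          Equiv.swap_apply_right] <;> simp [Fin.ext_iff]
      · simp only [Fin.mk_one]
        rw [Equiv.swap_apply_right, Equiv.swap_apply_of_ne_of_ne] <;> simp [Fin.ext_iff]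
    rw [funext fun i => congrArg v (e0 i), funext fun i => congrArg v (e1 i),
      funext fun i => congrArg v (e2 i)]
    ring
  rw [h1, alternatization_comp_perm, hτ, one_smul]

end WedgeCommutation

/-! ### Derivatives of exterior powers. -/

section WedgeDerivative

variable {𝕜 : Type*} [RCLike 𝕜] {V : Type*} [AddCommGroup V] [Module 𝕜 V]

theorem hasDerivAt_wedge {k l : ℕ} {a : 𝕜 → V [⋀^Fin k]→ₗ[𝕜] 𝕜} {a' : V [⋀^Fin k]→ₗ[𝕜] 𝕜}
    {b : 𝕜 → V [⋀^Fin l]→ₗ[𝕜] 𝕜} {b' : V [⋀^Fin l]→ₗ[𝕜] 𝕜} {t : 𝕜}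
    (ha : ∀ v, HasDerivAt (fun s => a s v) (a' v) t)
    (hb : ∀ v, HasDerivAt (fun s => b s v) (b' v) t) (v : Fin (k + l) → V) :
    HasDerivAt (fun s => wedge (a s) (b s) v) ((wedge a' (b t) + wedge (a t) b') v) t := by
  simp only [AlternatingMap.add_apply, wedge_apply, ← Finset.sum_add_distrib, ← mul_add]
  exact HasDerivAt.fun_sum fun σ _ => ((ha _).mul (hb _)).const_mul _

theorem hasDerivAt_wedgePow_succ {c : 𝕜 → V [⋀^Fin 2]→ₗ[𝕜] 𝕜} {c' : V [⋀^Fin 2]→ₗ[𝕜] 𝕜} {t : 𝕜}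
    (hc : ∀ v, HasDerivAt (fun s => c s v) (c' v) t) (m : ℕ) (v : Fin (2 * (m + 1)) → V) :
    HasDerivAt (fun s => wedgePow (c s) (m + 1) v)
      (((m + 1 : ℕ) : 𝕜) * wedge (wedgePow (c t) m) c' v) t := by
  induction m with
  | zero =>
    have h := hasDerivAt_wedge (a := fun s => wedgePow (c s) 0) (a' := 0) (b := c) (b' := c')
      (t := t) (fun v => by simpa [wedgePow] using hasDerivAt_const t (1 : 𝕜)) hc v
    rw [zero_wedge, zero_add] at h
    exact h.congr_deriv (by simp)
  | succ m ih =>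
    have h := hasDerivAt_wedge (a := fun s => wedgePow (c s) (m + 1))
      (a' := ((m + 1 : ℕ) : 𝕜) • wedge (wedgePow (c t) m) c') (b := c) (b' := c') (t := t)
      (fun v => by simpa using ih v) hc v
    rw [smul_wedge, wedge_wedge_right_comm] at h
    refine h.congr_deriv ?_
    rw [AlternatingMap.add_apply, AlternatingMap.smul_apply, smul_eq_mul]
    change ((m + 1 : ℕ) : 𝕜) * wedge (wedgePow (c t) (m + 1)) c' v +
      wedge (wedgePow (c t) (m + 1)) c' v = _
    push_cast
    ring

end WedgeDerivative

/-! ### Two-forms as bilinear forms; rank and radical. -/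

section Bilinear

variable {𝕜 : Type*} [Field 𝕜] {V : Type*} [AddCommGroup V] [Module 𝕜 V]

theorem form_two_apply (b : V [⋀^Fin 2]→ₗ[𝕜] 𝕜) (v : Fin 2 → V) : b v = b ![v 0, v 1] := by
  congr 1; ext i; fin_cases i <;> rfl

theorem form_one_apply (a : V [⋀^Fin 1]→ₗ[𝕜] 𝕜) (v : Fin 1 → V) : a v = a ![v 0] := by
  congr 1; ext i; fin_cases i; rfl

theorem form_two_swap (b : V [⋀^Fin 2]→ₗ[𝕜] 𝕜) (x y : V) : b ![x, y] = -b ![y, x] := by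
  have h := b.map_swap ![y, x] (i := 0) (j := 1) (by decide)
  rw [form_two_apply] at h
  simpa using h

/-- The bilinear form of a 2-form. -/
def bilOf (b : V [⋀^Fin 2]→ₗ[𝕜] 𝕜) : V →ₗ[𝕜] V →ₗ[𝕜] 𝕜 :=
  LinearMap.mk₂ 𝕜 (fun x y => b ![x, y])
    (fun x x' y => b.map_vecCons_add _ _ _) (fun c x y => b.map_vecCons_smul _ _ _)
    (fun x y y' => by
      rw [form_two_swap, form_two_swap b x, form_two_swap b x, ← neg_add]
      exact congrArg _ (b.map_vecCons_add _ _ _))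
    (fun c x y => by
      rw [form_two_swap, form_two_swap b x, smul_neg]
      exact congrArg _ (b.map_vecCons_smul _ _ _))

theorem bilOf_apply (b : V [⋀^Fin 2]→ₗ[𝕜] 𝕜) (x y : V) : bilOf b x y = b ![x, y] := rfl

theorem bilOf_swap (b : V [⋀^Fin 2]→ₗ[𝕜] 𝕜) (x y : V) : bilOf b x y = -bilOf b y x :=
  form_two_swap b x y

theorem bilOf_self (b : V [⋀^Fin 2]→ₗ[𝕜] 𝕜) (x : V) : bilOf b x x = 0 :=
  b.map_eq_zero_of_eq _ (i := 0) (j := 1) rfl (by decide)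

theorem mem_ker_bilOf {b : V [⋀^Fin 2]→ₗ[𝕜] 𝕜} {x : V} :
    x ∈ LinearMap.ker (bilOf b) ↔ ∀ y, b ![x, y] = 0 := by
  rw [LinearMap.mem_ker, LinearMap.ext_iff]; rfl

theorem formRank_add_finrank_ker [FiniteDimensional 𝕜 V] (b : V [⋀^Fin 2]→ₗ[𝕜] 𝕜) :
    formRank b + Module.finrank 𝕜 (LinearMap.ker (bilOf b)) = Module.finrank 𝕜 V := by
  have h : LinearMap.ker (bilOf b) = LinearMap.ker (AlternatingMap.curryLeft (n := 1) b) := by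
    ext x
    rw [mem_ker_bilOf, LinearMap.mem_ker]
    constructor
    · intro h
      ext v
      rw [AlternatingMap.curryLeft_apply_apply, form_two_apply]
      exact h _
    · intro h y
      have := congrArg (fun a => a ![y]) h
      simpa using this
  rw [h]
  exact LinearMap.finrank_range_add_finrank_ker _

theorem formRank_compLinearMap_le {W : Type*} [AddCommGroup W] [Module 𝕜 W] [FiniteDimensional 𝕜 V]
    [FiniteDimensional 𝕜 W] (b : V [⋀^Fin 2]→ₗ[𝕜] 𝕜) (L : W →ₗ[𝕜] V) :
    formRank (b.compLinearMap L) ≤ formRank b := by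
  have h1 : bilOf (b.compLinearMap L) = (L.dualMap).comp ((bilOf b).comp L) := by
    ext x y
    simp only [bilOf_apply, AlternatingMap.compLinearMap_apply, LinearMap.comp_apply,
      LinearMap.dualMap_apply]
    rw [form_two_apply]; rfl
  have h2 := formRank_add_finrank_ker (b.compLinearMap L)
  have h3 := LinearMap.finrank_range_add_finrank_ker (bilOf (b.compLinearMap L))
  have h4 := formRank_add_finrank_ker b
  have h5 := LinearMap.finrank_range_add_finrank_ker (bilOf b)
  have h6 : Module.finrank 𝕜 (LinearMap.range (bilOf (b.compLinearMap L))) ≤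
      Module.finrank 𝕜 (LinearMap.range (bilOf b)) := by
    rw [h1, LinearMap.range_comp]
    exact (Submodule.finrank_map_le _ _).trans
      (Submodule.finrank_mono (LinearMap.range_comp_le_range _ _))
  omega

end Bilinear

/-! ### Powers of a 2-form on orthogonal sums. -/

section PowerEvaluation

variable {𝕜 : Type*} [RCLike 𝕜] {V : Type*} [AddCommGroup V] [Module 𝕜 V]

/-- The value of a power of a 2-form on an orthogonal union of a family and a pair. -/
theorem wedgePow_succ_append (b : V [⋀^Fin 2]→ₗ[𝕜] 𝕜) {m : ℕ} {u : Fin (2 * m) → V} {v w : V}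
    (hv : ∀ i, b ![u i, v] = 0) (hw : ∀ i, b ![u i, w] = 0) :
    wedgePow b (m + 1) (Fin.append u ![v, w] : Fin (2 * m + 2) → V) =
      ((m + 1 : ℕ) : 𝕜) * (wedgePow b m u * b ![v, w]) := by
  have hrec : ∀ c : V [⋀^Fin 2]→ₗ[𝕜] 𝕜, (∀ i y, c ![u i, y] = 0) →
      wedge (wedgePow b m) c (Fin.append u ![v, w]) = wedgePow b m u * c ![v, w] := by
    intro c hc
    rw [wedge_apply_of_right_killed]
    · congr 1
      · simp
      · rw [form_two_apply]; simp
    · intro i x ⟨j, hj⟩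
      rw [Fin.append_left] at hj
      rw [form_two_apply]
      fin_cases j
      · simp only [Fin.zero_eta] at hj
        rw [hj, hc]
      · simp only [Fin.mk_one] at hj
        rw [form_two_swap, hj, hc, neg_zero]
  by_cases hd : b ![v, w] = 0
  · rw [hd, mul_zero, mul_zero]
    refine wedgePow_apply_eq_zero (m := m + 1) (i := Fin.natAdd (2 * m) (0 : Fin 2)) fun j => ?_
    have h0 : (Fin.append u ![v, w] : Fin (2 * m + 2) → V) (Fin.natAdd (2 * m) (0 : Fin 2)) = v := by
      simp
    refine Fin.addCases (m := 2 * m) (n := 2) (fun i => ?_) (fun i => ?_) j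
    · rw [h0, Fin.append_left, form_two_swap, hv, neg_zero]
    · rw [h0, Fin.append_right]
      fin_cases i
      · exact bilOf_self b v
      · exact hd
  · set B := bilOf b with hB
    have hBa : ∀ x y, b ![x, y] = B x y := fun _ _ => rfl
    rw [hBa] at hd
    -- Instead of counting shuffles, the argument rescales `v`: `S t` multiplies `v` by `t` and
    -- fixes `w` and all `u i`, and both sides are compared through their derivative at `t = 1`.
    let φ : V →ₗ[𝕜] 𝕜 := (B v w)⁻¹ • B.flip w
    let S : 𝕜 → V →ₗ[𝕜] V := fun t => LinearMap.id + (t - 1) • φ.smulRight v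
    have hS : ∀ t x, S t x = x + ((t - 1) * φ x) • v := fun t x => by simp [S, mul_smul]
    -- The pull-back of `b` by `S t` is affine in `t`, because `b(v, v) = 0` removes the quadratic
    -- term; its derivative is thus the difference of the values at 2 and 1.
    let c' : V [⋀^Fin 2]→ₗ[𝕜] 𝕜 := b.compLinearMap (S 2) - b
    have hcS : ∀ t x y, b ![S t x, S t y] = B x y + (t - 1) * (φ x * B v y + φ y * B x v) := by
      intro t x y
      rw [hBa, hS, hS]
      have := bilOf_self b v
      simp only [map_add, map_smul, LinearMap.add_apply, LinearMap.smul_apply, smul_eq_mul, hB, this]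
      ring
    have hc' : ∀ x y, c' ![x, y] = φ x * B v y + φ y * B x v := by
      intro x y
      simp only [c', AlternatingMap.sub_apply, AlternatingMap.compLinearMap_apply]
      rw [form_two_apply]
      have := hcS 2 x y
      simp only [Matrix.cons_val_zero, Matrix.cons_val_one]
      rw [this, hBa]
      ring
    have hφu : ∀ i, φ (u i) = 0 := fun i => by
      simp only [φ, LinearMap.smul_apply, LinearMap.flip_apply, ← hBa, hw, smul_zero]
    have hφv : φ v = 1 := by simp [φ, hd]
    have hφw : φ w = 0 := by simp [φ, hB, bilOf_self]
    have hder : ∀ z, HasDerivAt (fun s => (b.compLinearMap (S s)) z) (c' z) 1 := by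
      intro z
      have h1 : (fun s => (b.compLinearMap (S s)) z) = fun s => b z + (s - 1) * c' z := by
        ext s
        rw [AlternatingMap.compLinearMap_apply, form_two_apply, form_two_apply b z,
          form_two_apply c' z, hcS, hc']; rfl
      rw [h1]
      simpa using ((((hasDerivAt_id (1 : 𝕜)).sub_const 1).mul_const (c' z)).const_add (b z))
    have hS1 : b.compLinearMap (S 1) = b := by
      have : S 1 = LinearMap.id := by simp [S]
      rw [this]; ext; rfl
    -- The derivative form `c'` kills every `u i`, so in `b^m ∧ c'` only the trivial shuffle is
    -- left.
    have h1 := hasDerivAt_wedgePow_succ hder m (Fin.append u ![v, w] : Fin (2 * m + 2) → V)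
    rw [hS1, hrec c' (fun i y => by
      rw [hc', hφu, ← hBa (u i), hv]; ring), hc', hφv, hφw] at h1
    have h2 : (fun s => wedgePow (b.compLinearMap (S s)) (m + 1)
        (Fin.append u ![v, w] : Fin (2 * m + 2) → V)) =
        fun s => s * wedgePow b (m + 1) (Fin.append u ![v, w] : Fin (2 * m + 2) → V) := by
      ext s
      rw [wedgePow_comp, AlternatingMap.compLinearMap_apply]
      have h3 : (fun i => S s ((Fin.append u ![v, w] : Fin (2 * m + 2) → V) i)) =
          Function.update (Fin.append u ![v, w] : Fin (2 * m + 2) → V)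
            (Fin.natAdd (2 * m) (0 : Fin 2))
            (s • (Fin.append u ![v, w] : Fin (2 * m + 2) → V) (Fin.natAdd (2 * m) (0 : Fin 2))) := by
        ext i
        refine Fin.addCases (m := 2 * m) (n := 2) (fun i => ?_) (fun i => ?_) i
        · rw [Function.update_of_ne, Fin.append_left, hS, hφu, mul_zero, zero_smul, add_zero]
          simp only [ne_eq, Fin.ext_iff, Fin.val_castAdd, Fin.val_natAdd]
          have := i.2
          omega
        · fin_cases i
          · simp only [Fin.zero_eta, Function.update_self, Fin.append_right, hS,
              Matrix.cons_val_zero, hφv, mul_one]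
            module
          · rw [Function.update_of_ne]
            · simp only [Fin.mk_one, Fin.append_right, hS, Matrix.cons_val_one,
                hφw, mul_zero, zero_smul, add_zero, Matrix.cons_val_fin_one]
            · simp [Fin.ext_iff]
      have h4 : (wedgePow b (m + 1)) (fun i => S s ((Fin.append u ![v, w] : Fin (2 * m + 2) → V) i)) =
          wedgePow b (m + 1) (Function.update (Fin.append u ![v, w] : Fin (2 * m + 2) → V)
            (Fin.natAdd (2 * m) (0 : Fin 2))
            (s • (Fin.append u ![v, w] : Fin (2 * m + 2) → V) (Fin.natAdd (2 * m) (0 : Fin 2)))) :=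
        congrArg _ h3
      refine h4.trans ?_
      exact ((wedgePow b (m + 1)).map_update_smul _ _ _ _).trans (by
        rw [Function.update_eq_self, smul_eq_mul])
    rw [h2] at h1
    have h5 := (hasDerivAt_mul_const _).unique h1
    rw [h5, hBa]
    ring

end PowerEvaluation

/-! ### Nondegeneracy and the nonvanishing of powers. -/

section Nondegeneracy

/-- Split off a hyperbolic plane spanned by `v`, `w`: its orthogonal complement is the kernel of
`f`, has dimension two less and is again nondegenerate. `wedgePow_succ_append` multiplies the two
contributions. -/
theorem exists_wedgePow_apply_ne_zero {𝕜 : Type*} [RCLike 𝕜] (m : ℕ) : ∀ {V : Type*} [AddCommGroup V]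
    [Module 𝕜 V] [FiniteDimensional 𝕜 V] (_ : Module.finrank 𝕜 V = 2 * m) (b : V [⋀^Fin 2]→ₗ[𝕜] 𝕜)
    (_ : ∀ x, (∀ y, b ![x, y] = 0) → x = 0), ∃ u : Fin (2 * m) → V, wedgePow b m u ≠ 0 := by
  induction m with
  | zero => intro V _ _ _ _ b _; exact ⟨fun i => i.elim0, by simp [wedgePow]⟩
  | succ m ih =>
    intro V _ _ _ hV b hb
    obtain ⟨v, hv⟩ : ∃ v : V, v ≠ 0 := by
      have : Nontrivial V := Module.nontrivial_of_finrank_pos (R := 𝕜) (by omega)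
      exact exists_ne 0
    obtain ⟨w, hw⟩ : ∃ w, b ![v, w] ≠ 0 := by
      by_contra! h
      exact hv (hb v h)
    let f : V →ₗ[𝕜] 𝕜 × 𝕜 := ((bilOf b).flip v).prod ((bilOf b).flip w)
    have hf : ∀ x, f x = (b ![x, v], b ![x, w]) := fun x => rfl
    set d := b ![v, w] with hd
    have hdecomp : ∀ x, f (x - ((d⁻¹ * b ![x, w]) • v - (d⁻¹ * b ![x, v]) • w)) = 0 := by
      intro x
      have hvv := bilOf_self b v
      have hww := bilOf_self b w
      have hwv : bilOf b w v = -d := bilOf_swap b w v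
      have hvw : bilOf b v w = d := rfl
      have e : f (x - ((d⁻¹ * b ![x, w]) • v - (d⁻¹ * b ![x, v]) • w)) =
          (bilOf b x v - ((d⁻¹ * bilOf b x w) * bilOf b v v - (d⁻¹ * bilOf b x v) * bilOf b w v),
           bilOf b x w - ((d⁻¹ * bilOf b x w) * bilOf b v w - (d⁻¹ * bilOf b x v) * bilOf b w w)) := by
        simp [f, bilOf_apply]
      rw [e, hvv, hww, hwv, hvw]
      ext
      · simp only [Prod.fst_zero]; field_simp; ring
      · simp only [Prod.snd_zero]; field_simp; ring
    have hsurj : LinearMap.range f = ⊤ := by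
      rw [LinearMap.range_eq_top]
      rintro ⟨s, t⟩
      refine ⟨(d⁻¹ * t) • v - (d⁻¹ * s) • w, ?_⟩
      have hvv := bilOf_self b v
      have hww := bilOf_self b w
      have hwv : bilOf b w v = -d := bilOf_swap b w v
      have hvw : bilOf b v w = d := rfl
      have e : f ((d⁻¹ * t) • v - (d⁻¹ * s) • w) =
          ((d⁻¹ * t) * bilOf b v v - (d⁻¹ * s) * bilOf b w v,
           (d⁻¹ * t) * bilOf b v w - (d⁻¹ * s) * bilOf b w w) := by
        simp [f]
      rw [e, hvv, hww, hwv, hvw]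
      ext
      · simp only; field_simp; ring
      · simp only; field_simp; ring
    have hker : Module.finrank 𝕜 (LinearMap.ker f) = 2 * m := by
      have h := LinearMap.finrank_range_add_finrank_ker f
      rw [hsurj, finrank_top, Module.finrank_prod, Module.finrank_self, hV] at h
      omega
    obtain ⟨u, hu⟩ := ih hker (b.compLinearMap (LinearMap.ker f).subtype) (by
      intro x hx
      have hx0 : f x = 0 := x.2
      rw [hf, Prod.mk_eq_zero] at hx0
      refine Subtype.ext (hb x fun y => ?_)
      have h1 := hx ⟨_, LinearMap.mem_ker.2 (hdecomp y)⟩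
      rw [AlternatingMap.compLinearMap_apply, form_two_apply] at h1
      have h2 : bilOf b x (y - ((d⁻¹ * b ![y, w]) • v - (d⁻¹ * b ![y, v]) • w)) = 0 := h1
      have hxv : bilOf b x v = 0 := hx0.1
      have hxw : bilOf b x w = 0 := hx0.2
      rw [← bilOf_apply]
      simpa [hxv, hxw] using h2)
    have hu' : ∀ i, b ![(u i : V), v] = 0 ∧ b ![(u i : V), w] = 0 := fun i => by
      have h := (u i).2
      rwa [LinearMap.mem_ker, hf, Prod.mk_eq_zero] at h
    rw [wedgePow_comp, AlternatingMap.compLinearMap_apply] at hu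
    refine ⟨(Fin.append (fun i => (u i : V)) ![v, w] : Fin (2 * m + 2) → V), ?_⟩
    rw [wedgePow_succ_append b (fun i => (hu' i).1) (fun i => (hu' i).2)]
    exact mul_ne_zero (Nat.cast_ne_zero.2 m.succ_ne_zero) (mul_ne_zero hu hw)

variable {𝕜 : Type*} [RCLike 𝕜] {V : Type*} [AddCommGroup V] [Module 𝕜 V]

theorem exists_degenerate_of_wedgePow_eq_zero [FiniteDimensional 𝕜 V] {m : ℕ}
    (hV : Module.finrank 𝕜 V = 2 * m) {b : V [⋀^Fin 2]→ₗ[𝕜] 𝕜} (hb : wedgePow b m = 0) :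
    ∃ x, x ≠ 0 ∧ ∀ y, b ![x, y] = 0 := by
  by_contra! h
  obtain ⟨u, hu⟩ := exists_wedgePow_apply_ne_zero m hV b fun x hx => by
    by_contra hne
    obtain ⟨y, hy⟩ := h x hne
    exact hy (hx y)
  exact hu (by rw [hb]; rfl)

theorem wedgePow_apply_of_mem_radical {b : V [⋀^Fin 2]→ₗ[𝕜] 𝕜} {x : V} (hx : ∀ y, b ![x, y] = 0)
    {m : ℕ} (v : Fin (2 * m) → V) (hv : ∃ i, v i = x) : wedgePow b m v = 0 := by
  obtain ⟨i, rfl⟩ := hv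
  exact wedgePow_apply_eq_zero fun j => hx _

/-- The evaluation of `b(x, u i)` in a family `u`. -/
def pairing (b : V [⋀^Fin 2]→ₗ[𝕜] 𝕜) {k : ℕ} (u : Fin k → V) : V →ₗ[𝕜] (Fin k → 𝕜) :=
  LinearMap.pi fun i => (bilOf b).flip (u i)

/-- Substituting a combination orthogonal to all of `u` for `u i` makes the power vanish, whereas
multilinearity gives `c i` times the nonzero value. So the Gram matrix of `u` is invertible. -/
theorem eq_zero_of_pairing_sum {b : V [⋀^Fin 2]→ₗ[𝕜] 𝕜} {m : ℕ} {u : Fin (2 * m) → V}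
    (hu : wedgePow b m u ≠ 0) {c : Fin (2 * m) → 𝕜} (hc : pairing b u (∑ i, c i • u i) = 0) :
    c = 0 := by
  ext i
  by_contra hi
  have h1 : wedgePow b m (Function.update u i (∑ j, c j • u j)) = 0 := by
    refine wedgePow_apply_eq_zero (i := i) fun j => ?_
    rw [Function.update_self]
    by_cases hj : j = i
    · subst hj
      rw [Function.update_self]
      exact bilOf_self b _
    · rw [Function.update_of_ne hj]
      exact congrFun hc j
  rw [AlternatingMap.map_update_sum, Finset.sum_eq_single i, AlternatingMap.map_update_smul,
    Function.update_eq_self] at h1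
  · exact hu ((smul_eq_zero.1 h1).resolve_left hi)
  · intro j _ hj
    rw [AlternatingMap.map_update_smul,
      (wedgePow b m).map_eq_zero_of_eq _ (i := i) (j := j)
        (by simp [Function.update_of_ne hj]) hj.symm, smul_zero]
  · simp

theorem pairing_surjective {b : V [⋀^Fin 2]→ₗ[𝕜] 𝕜} {m : ℕ} {u : Fin (2 * m) → V}
    (hu : wedgePow b m u ≠ 0) (t : Fin (2 * m) → 𝕜) :
    ∃ c : Fin (2 * m) → 𝕜, pairing b u (∑ i, c i • u i) = t := by
  let T : (Fin (2 * m) → 𝕜) →ₗ[𝕜] (Fin (2 * m) → 𝕜) := (pairing b u).comp (Fintype.linearCombination 𝕜 u)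
  have hT : ∀ c, T c = pairing b u (∑ i, c i • u i) := fun c => by
    simp [T, Fintype.linearCombination_apply]
  have hinj : Function.Injective T := by
    rw [← LinearMap.ker_eq_bot, LinearMap.ker_eq_bot']
    exact fun c hc => eq_zero_of_pairing_sum hu (by rw [← hT, hc])
  obtain ⟨c, hc⟩ := LinearMap.injective_iff_surjective.1 hinj t
  exact ⟨c, by rw [← hT, hc]⟩

theorem finrank_ker_pairing [FiniteDimensional 𝕜 V] {b : V [⋀^Fin 2]→ₗ[𝕜] 𝕜} {m : ℕ}
    {u : Fin (2 * m) → V} (hu : wedgePow b m u ≠ 0) :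
    2 * m + Module.finrank 𝕜 (LinearMap.ker (pairing b u)) = Module.finrank 𝕜 V := by
  have h := LinearMap.finrank_range_add_finrank_ker (pairing b u)
  rwa [LinearMap.range_eq_top.2 fun t => (pairing_surjective hu t).imp' _ fun c hc => hc,
    finrank_top, Module.finrank_fin_fun] at h

theorem ker_bilOf_le_ker_pairing (b : V [⋀^Fin 2]→ₗ[𝕜] 𝕜) {k : ℕ} (u : Fin k → V) :
    LinearMap.ker (bilOf b) ≤ LinearMap.ker (pairing b u) := fun x hx => by
  rw [mem_ker_bilOf] at hx
  rw [LinearMap.mem_ker]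
  ext i
  exact hx _

/-- Vectors orthogonal to the family and to its orthogonal complement are in the radical. -/
theorem mem_radical_of_orthogonal {b : V [⋀^Fin 2]→ₗ[𝕜] 𝕜} {m : ℕ} {u : Fin (2 * m) → V}
    (hu : wedgePow b m u ≠ 0) {x : V} (hx : pairing b u x = 0)
    (h : ∀ y, pairing b u y = 0 → b ![x, y] = 0) (y : V) : b ![x, y] = 0 := by
  obtain ⟨c, hc⟩ := pairing_surjective hu (pairing b u y)
  have h1 := h (y - ∑ i, c i • u i) (by rw [map_sub, hc, sub_self])
  have h2 : bilOf b x y - ∑ i, c i • bilOf b x (u i) = 0 := by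
    have h3 : bilOf b x (y - ∑ i, c i • u i) = 0 := h1
    simpa using h3
  have h4 : ∀ i, bilOf b x (u i) = 0 := fun i => congrFun hx i
  rw [← bilOf_apply]
  simpa [h4] using h2

theorem linearIndependent_append {b : V [⋀^Fin 2]→ₗ[𝕜] 𝕜} {m k : ℕ} {u : Fin (2 * m) → V}
    (hu : wedgePow b m u ≠ 0) {h : Fin k → V} (hh : LinearIndependent 𝕜 h)
    (hhu : ∀ i, pairing b u (h i) = 0) : LinearIndependent 𝕜 (Fin.append h u) := by
  rw [Fintype.linearIndependent_iff] at hh ⊢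
  intro c hc
  rw [Fin.sum_univ_add] at hc
  simp only [Fin.append_left, Fin.append_right] at hc
  have h1 : (fun i => c (Fin.natAdd k i)) = 0 := by
    refine eq_zero_of_pairing_sum hu ?_
    have := congrArg (pairing b u) hc
    simpa [hhu] using this
  have h2 : ∀ i, c (Fin.natAdd k i) = 0 := fun i => congrFun h1 i
  simp only [h2, zero_smul, Finset.sum_const_zero, add_zero] at hc
  intro i
  exact Fin.addCases (hh _ hc) h2 i

end Nondegeneracy

/-! ### Radicals, adapted frames and the meaning of the wedge conditions. -/

section Radicals

theorem forall_append_mem {X : Type*} {p : X → Prop} {h₁ h₂ h₃ : X} (h1 : p h₁) (h2 : p h₂) (h3 : p h₃)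
    (i : Fin (1 + 2)) : p (Fin.append ![h₃] ![h₁, h₂] i) := by
  fin_cases i <;> assumption

variable {𝕜 : Type*} [RCLike 𝕜] {V : Type*} [AddCommGroup V] [Module 𝕜 V]

/-- The linear form of a 1-form. -/
def linOf (a : V [⋀^Fin 1]→ₗ[𝕜] 𝕜) : V →ₗ[𝕜] 𝕜 where
  toFun x := a ![x]
  map_add' _ _ := a.map_vecCons_add _ _ _
  map_smul' _ _ := a.map_vecCons_smul _ _ _

theorem apply_ne_zero_of_linearIndependent [FiniteDimensional 𝕜 V] {k : ℕ}
    (hk : Module.finrank 𝕜 V = k) {a : V [⋀^Fin k]→ₗ[𝕜] 𝕜} (ha : a ≠ 0) {v : Fin k → V}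
    (hv : LinearIndependent 𝕜 v) : a v ≠ 0 := by
  let B := basisOfLinearIndependentOfCardEqFinrank' v hv (by simp [hk])
  have hB : ⇑B = v := coe_basisOfLinearIndependentOfCardEqFinrank' _ _ _
  rw [← hB]
  exact (AlternatingMap.map_basis_ne_zero_iff B a).2 ha

theorem exists_eq_smul_add_smul_of_finrank_two {N : Submodule 𝕜 V} [FiniteDimensional 𝕜 N]
    (hN : Module.finrank 𝕜 N = 2) : ∃ k₁ k₂, k₁ ∈ N ∧ k₂ ∈ N ∧ LinearIndependent 𝕜 ![k₁, k₂] ∧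
      ∀ x ∈ N, ∃ s t : 𝕜, x = s • k₁ + t • k₂ := by
  let B := Module.finBasisOfFinrankEq 𝕜 N hN
  refine ⟨B 0, B 1, (B 0).2, (B 1).2, ?_, fun x hx => ?_⟩
  · have h := B.linearIndependent.map' N.subtype (Submodule.ker_subtype N)
    have e : ![(B 0 : V), (B 1 : V)] = N.subtype ∘ B := by
      funext i; fin_cases i <;> rfl
    rw [e]
    exact h
  · refine ⟨B.repr ⟨x, hx⟩ 0, B.repr ⟨x, hx⟩ 1, ?_⟩
    have h := congrArg Subtype.val (B.sum_repr ⟨x, hx⟩)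
    rw [Fin.sum_univ_two] at h
    exact h.symm

/-- A degenerate 2-form on a `2m + 2`-dimensional space whose `m`-th power does not vanish has a
two-dimensional radical. -/
theorem exists_radical_basis [FiniteDimensional 𝕜 V] {m : ℕ} (hV : Module.finrank 𝕜 V = 2 * m + 2)
    {b : V [⋀^Fin 2]→ₗ[𝕜] 𝕜} {u : Fin (2 * m) → V} (hu : wedgePow b m u ≠ 0)
    (hb : ∃ x, x ≠ 0 ∧ ∀ y, b ![x, y] = 0) :
    ∃ k₁ k₂, LinearIndependent 𝕜 ![k₁, k₂] ∧ (∀ y, b ![k₁, y] = 0) ∧ (∀ y, b ![k₂, y] = 0) ∧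
      ∀ x, (∀ y, b ![x, y] = 0) → ∃ s t : 𝕜, x = s • k₁ + t • k₂ := by
  obtain ⟨x₀, hx₀, hx₀b⟩ := hb
  have hN : Module.finrank 𝕜 (LinearMap.ker (pairing b u)) = 2 := by
    have := finrank_ker_pairing hu
    omega
  obtain ⟨k₁, k₂, h₁, h₂, hli, hsp⟩ := exists_eq_smul_add_smul_of_finrank_two hN
  obtain ⟨s₀, t₀, hx₀k⟩ := hsp x₀ (ker_bilOf_le_ker_pairing b u (mem_ker_bilOf.2 hx₀b))
  -- The radical vector lies in the plane orthogonal to `u`, and a skew form on a plane with a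
  -- nonzero radical vector is zero.
  have h12 : bilOf b k₁ k₂ = 0 := by
    have e1 : bilOf b x₀ k₁ = 0 := hx₀b k₁
    have e2 : bilOf b x₀ k₂ = 0 := hx₀b k₂
    rw [hx₀k] at e1 e2
    simp only [map_add, map_smul, LinearMap.add_apply, LinearMap.smul_apply, bilOf_self,
      bilOf_swap b k₂ k₁, smul_eq_mul, mul_zero, zero_add, add_zero, mul_neg, neg_eq_zero,
      mul_eq_zero] at e1 e2
    by_contra hne
    refine hx₀ ?_
    rw [hx₀k, e1.resolve_right hne, e2.resolve_right hne, zero_smul, zero_smul, add_zero]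
  refine ⟨k₁, k₂, hli, ?_, ?_, fun x hx => hsp x
    (ker_bilOf_le_ker_pairing b u (mem_ker_bilOf.2 hx))⟩
  · refine mem_radical_of_orthogonal hu h₁ fun y hy => ?_
    obtain ⟨s, t, rfl⟩ := hsp y hy
    rw [← bilOf_apply]
    simp [bilOf_self, h12]
  · refine mem_radical_of_orthogonal hu h₂ fun y hy => ?_
    obtain ⟨s, t, rfl⟩ := hsp y hy
    rw [← bilOf_apply]
    simp [bilOf_self, bilOf_swap b k₂ k₁, h12]

theorem form_one_eq_zero_of_mem {a : V [⋀^Fin 1]→ₗ[𝕜] 𝕜} {x : V} (hx : a ![x] = 0)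
    (v : Fin 1 → V) (hv : ∃ i, v i = x) : a v = 0 := by
  obtain ⟨i, rfl⟩ := hv
  rw [form_one_apply]
  fin_cases i
  exact hx

theorem wedge_wedgePow_apply {k m : ℕ} (a : V [⋀^Fin k]→ₗ[𝕜] 𝕜) {b : V [⋀^Fin 2]→ₗ[𝕜] 𝕜}
    {h : Fin k → V} (hh : ∀ i y, b ![h i, y] = 0) (u : Fin (2 * m) → V) :
    wedge a (wedgePow b m) (Fin.append h u) = a h * wedgePow b m u := by
  rw [wedge_apply_of_right_killed]
  · simp
  · intro i v hv
    rw [Fin.append_left] at hv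
    exact wedgePow_apply_of_mem_radical (hh i) v hv

theorem wedge_one_two_apply {a : V [⋀^Fin 1]→ₗ[𝕜] 𝕜} (θ : V [⋀^Fin 2]→ₗ[𝕜] 𝕜) (h₃ : V) {h₁ h₂ : V}
    (ha₁ : a ![h₁] = 0) (ha₂ : a ![h₂] = 0) :
    wedge a θ (Fin.append ![h₃] ![h₁, h₂]) = a ![h₃] * θ ![h₁, h₂] := by
  rw [wedge_apply_of_left_killed]
  · simp only [Fin.append_left, Fin.append_right]
  · intro j v hv
    rw [Fin.append_right] at hv
    fin_cases j
    · exact form_one_eq_zero_of_mem ha₁ v hv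
    · exact form_one_eq_zero_of_mem ha₂ v hv

theorem wedge_one_one_apply (a : V [⋀^Fin 1]→ₗ[𝕜] 𝕜) {c : V [⋀^Fin 1]→ₗ[𝕜] 𝕜} {h₁ : V} (h₃ : V)
    (hc : c ![h₁] = 0) :
    wedge a c (Fin.append ![h₁] ![h₃]) = a ![h₁] * c ![h₃] := by
  rw [wedge_apply_of_right_killed]
  · simp only [Fin.append_left, Fin.append_right]
  · intro j v hv
    rw [Fin.append_left] at hv
    fin_cases j
    exact form_one_eq_zero_of_mem hc v hv

/-- An adapted frame for a contact-type condition `a ∧ θ ∧ b^m ≠ 0`. -/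
structure IsContactFrame {m : ℕ} (a : V [⋀^Fin 1]→ₗ[𝕜] 𝕜) (θ b : V [⋀^Fin 2]→ₗ[𝕜] 𝕜)
    (h₁ h₂ h₃ : V) (u : Fin (2 * m) → V) : Prop where
  radical : ∀ i y, b ![(Fin.append ![h₃] ![h₁, h₂] : Fin (1 + 2) → V) i, y] = 0
  pow_ne_zero : wedgePow b m u ≠ 0
  apply_one : a ![h₁] = 0
  apply_two : a ![h₂] = 0
  apply_three : a ![h₃] = 1
  two_ne_zero : θ ![h₁, h₂] ≠ 0
  linearIndependent : LinearIndependent 𝕜 (Fin.append (Fin.append ![h₃] ![h₁, h₂]) u)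
  span : ∀ x, (∀ y, b ![x, y] = 0) → ∃ r s t : 𝕜, x = r • h₃ + s • h₁ + t • h₂

/-- The family `u` comes from `b^m ≠ 0`; its orthogonal complement has dimension 3, and the rank
bound forces it to be the radical of `b`. On that 3-space `a ∧ θ` is a nonzero top form, so `a` is
nonzero there and `θ` is nonzero on the kernel plane of `a`. -/
theorem exists_isContactFrame [FiniteDimensional 𝕜 V] {m : ℕ}
    (hV : Module.finrank 𝕜 V = 1 + 2 + 2 * m) {a : V [⋀^Fin 1]→ₗ[𝕜] 𝕜} {θ b : V [⋀^Fin 2]→ₗ[𝕜] 𝕜}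
    (hr : formRank b ≤ 2 * m) (h : wedge (wedge a θ) (wedgePow b m) ≠ 0) :
    ∃ h₁ h₂ h₃ u, IsContactFrame (m := m) a θ b h₁ h₂ h₃ u := by
  obtain ⟨u, hu⟩ : ∃ u, wedgePow b m u ≠ 0 := by
    by_contra! hcon
    refine h ?_
    have : wedgePow b m = 0 := by ext v; exact hcon v
    rw [this]
    ext v
    rw [wedge_apply]
    simp
  set N := LinearMap.ker (bilOf b) with hN
  have hNu : N = LinearMap.ker (pairing b u) := by
    refine Submodule.eq_of_le_of_finrank_le (ker_bilOf_le_ker_pairing b u) ?_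
    have h1 := finrank_ker_pairing hu
    have h2 := formRank_add_finrank_ker b
    rw [← hN] at h2
    omega
  have hN3 : Module.finrank 𝕜 N = 3 := by
    have h1 := finrank_ker_pairing hu
    rw [← hNu] at h1
    omega
  have hind : ∀ g : Fin (1 + 2) → V, (∀ i, g i ∈ N) → LinearIndependent 𝕜 g →
      LinearIndependent 𝕜 (Fin.append g u) := fun g hg hgi =>
    linearIndependent_append hu hgi fun i => by
      have := hg i; rwa [hNu, LinearMap.mem_ker] at this
  have htop : ∀ g : Fin (1 + 2) → V, (∀ i, g i ∈ N) → LinearIndependent 𝕜 g →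
      wedge a θ g ≠ 0 := by
    intro g hg hgi h0
    refine apply_ne_zero_of_linearIndependent hV h (hind g hg hgi) ?_
    rw [wedge_wedgePow_apply _ (fun i => mem_ker_bilOf.1 (hg i)), h0, zero_mul]
  obtain ⟨h₃, h₃N, h₃a⟩ : ∃ x ∈ N, linOf a x = 1 := by
    obtain ⟨y, hyN, hy⟩ : ∃ y ∈ N, linOf a y ≠ 0 := by
      by_contra! hcon
      let B := Module.finBasisOfFinrankEq 𝕜 N hN3
      refine htop (fun i => (B i : V)) (fun i => (B i).2)
        (B.linearIndependent.map' N.subtype (Submodule.ker_subtype N)) ?_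
      rw [wedge_apply]
      refine Finset.sum_eq_zero fun σ _ => mul_eq_zero_of_right _ (mul_eq_zero_of_left ?_ _)
      rw [form_one_apply]
      exact hcon _ (B _).2
    exact ⟨(linOf a y)⁻¹ • y, N.smul_mem _ hyN, by
      rw [map_smul, smul_eq_mul, inv_mul_cancel₀ hy]⟩
  let aN : N →ₗ[𝕜] 𝕜 := (linOf a).comp N.subtype
  have hK : Module.finrank 𝕜 (LinearMap.ker aN) = 2 := by
    have h1 := LinearMap.finrank_range_add_finrank_ker aN
    have h2 : LinearMap.range aN = ⊤ := by
      rw [LinearMap.range_eq_top]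
      exact fun t => ⟨t • ⟨h₃, h₃N⟩, by simp [aN, h₃a]⟩
    rw [h2, finrank_top, Module.finrank_self, hN3] at h1
    omega
  obtain ⟨k₁, k₂, hk₁, hk₂, hli, hsp⟩ := exists_eq_smul_add_smul_of_finrank_two hK
  have e1 : linOf a (k₁ : V) = 0 := hk₁
  have e2 : linOf a (k₂ : V) = 0 := hk₂
  have hspan : ∀ x ∈ N, ∃ r s t : 𝕜, x = r • h₃ + s • (k₁ : V) + t • (k₂ : V) := by
    intro x hx
    obtain ⟨s, t, hst⟩ := hsp (⟨x, hx⟩ - linOf a x • ⟨h₃, h₃N⟩) (by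
      rw [LinearMap.mem_ker]
      simp [aN, h₃a])
    refine ⟨linOf a x, s, t, ?_⟩
    have := congrArg Subtype.val hst
    simp only [Submodule.coe_sub, Submodule.coe_smul, Submodule.coe_add] at this
    rw [add_assoc, ← this]
    module
  have hli3 : LinearIndependent 𝕜 (Fin.append ![h₃] ![(k₁ : V), (k₂ : V)] : Fin (1 + 2) → V) := by
    rw [Fintype.linearIndependent_iff]
    intro c hc
    rw [Fin.sum_univ_add, Fin.sum_univ_one, Fin.sum_univ_two] at hc
    simp only [Fin.append_left, Fin.append_right, Matrix.cons_val_zero, Matrix.cons_val_one,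
      Matrix.cons_val_fin_one] at hc
    have h0 : c (Fin.castAdd 2 0) = 0 := by
      have := congrArg (linOf a) hc
      simpa [e1, e2, h₃a] using this
    rw [h0, zero_smul, zero_add] at hc
    rw [LinearIndependent.pair_iff] at hli
    have h12 := hli _ _ (Subtype.ext hc : c (Fin.natAdd 1 0) • k₁ + c (Fin.natAdd 1 1) • k₂ = 0)
    intro i
    refine Fin.addCases (m := 1) (n := 2) (fun i => ?_) (fun i => ?_) i
    · fin_cases i; exact h0
    · fin_cases i
      · exact h12.1
      · exact h12.2
  have hmem : ∀ i, (Fin.append ![h₃] ![(k₁ : V), (k₂ : V)] : Fin (1 + 2) → V) i ∈ N :=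
    forall_append_mem k₁.2 k₂.2 h₃N
  refine ⟨k₁, k₂, h₃, u, fun i => mem_ker_bilOf.1 (hmem i), hu, e1, e2, h₃a, ?_,
    hind _ hmem hli3, fun x hx => hspan x (mem_ker_bilOf.2 hx)⟩
  intro h0
  refine htop _ hmem hli3 ?_
  rw [wedge_one_two_apply θ h₃ e1 e2, h0, mul_zero]

/-- By the rank bound the radical of `b` has dimension at least 3, while `a` has kernel of dimension
at most 2 in it. So that dimension is exactly 3, `a` takes a nonzero value at some `h₃` in it, and
`b` is nondegenerate on a complement; the form is evaluated on the resulting frame. -/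
theorem contact_ne_zero_of_radical [FiniteDimensional 𝕜 V] {m : ℕ}
    (hV : Module.finrank 𝕜 V = 1 + 2 + 2 * m) {a : V [⋀^Fin 1]→ₗ[𝕜] 𝕜} {θ b : V [⋀^Fin 2]→ₗ[𝕜] 𝕜}
    (hr : formRank b ≤ 2 * m) {h₁ h₂ : V} (hb₁ : ∀ y, b ![h₁, y] = 0) (hb₂ : ∀ y, b ![h₂, y] = 0)
    (ha₁ : a ![h₁] = 0) (ha₂ : a ![h₂] = 0)
    (hsp : ∀ x, (∀ y, b ![x, y] = 0) → a ![x] = 0 → ∃ s t : 𝕜, x = s • h₁ + t • h₂)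
    (hθ : θ ![h₁, h₂] ≠ 0) : wedge (wedge a θ) (wedgePow b m) ≠ 0 := by
  set N := LinearMap.ker (bilOf b) with hN
  have hN3 : 3 ≤ Module.finrank 𝕜 N := by
    have h2 := formRank_add_finrank_ker b
    rw [← hN] at h2
    omega
  let aN : N →ₗ[𝕜] 𝕜 := (linOf a).comp N.subtype
  have hK : Module.finrank 𝕜 (LinearMap.ker aN) ≤ 2 := by
    have h1 : (LinearMap.ker aN).map N.subtype ≤ Submodule.span 𝕜 (Set.range ![h₁, h₂]) := by
      rintro _ ⟨x, hx, rfl⟩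
      obtain ⟨s, t, hst⟩ := hsp x (mem_ker_bilOf.1 x.2) hx
      rw [Submodule.subtype_apply, hst]
      exact add_mem (Submodule.smul_mem _ _ (Submodule.subset_span ⟨0, rfl⟩))
        (Submodule.smul_mem _ _ (Submodule.subset_span ⟨1, rfl⟩))
    have h2 := (Submodule.finrank_mono h1).trans (finrank_range_le_card ![h₁, h₂])
    rwa [Submodule.finrank_map_subtype_eq, Fintype.card_fin] at h2
  have hrn := LinearMap.finrank_range_add_finrank_ker aN
  have hrg : Module.finrank 𝕜 (LinearMap.range aN) ≤ 1 := by
    simpa using Submodule.finrank_le (LinearMap.range aN)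
  obtain ⟨h₃, h₃N, h₃a⟩ : ∃ x ∈ N, linOf a x ≠ 0 := by
    by_contra! hcon
    have : LinearMap.ker aN = ⊤ := by
      rw [eq_top_iff]
      exact fun x _ => hcon x x.2
    rw [this, finrank_top] at hK
    omega
  obtain ⟨W, hW⟩ := N.exists_isCompl
  have hWr : Module.finrank 𝕜 W = 2 * m := by
    have := Submodule.finrank_add_eq_of_isCompl hW
    omega
  obtain ⟨u, hu⟩ := exists_wedgePow_apply_ne_zero m hWr (b.compLinearMap W.subtype) (by
    intro x hx
    have hxN : (x : V) ∈ N := mem_ker_bilOf.2 fun y => by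
      obtain ⟨y₁, hy₁, y₂, hy₂, rfl⟩ := Submodule.mem_sup.1
        (show y ∈ N ⊔ W by rw [hW.sup_eq_top]; trivial)
      have e1 : b ![(x : V), y₁] = 0 := by
        rw [form_two_swap, mem_ker_bilOf.1 hy₁, neg_zero]
      have e2 : b ![(x : V), y₂] = 0 := by
        have := hx ⟨y₂, hy₂⟩
        rw [AlternatingMap.compLinearMap_apply, form_two_apply] at this
        exact this
      rw [← bilOf_apply] at e1 e2 ⊢
      rw [map_add, e1, e2, add_zero]
    exact Subtype.ext ((Submodule.disjoint_def.1 hW.disjoint) x hxN x.2))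
  rw [wedgePow_comp, AlternatingMap.compLinearMap_apply] at hu
  intro h0
  have h1 := congrArg (fun c => c (Fin.append (Fin.append ![h₃] ![h₁, h₂])
    (fun i => (W.subtype (u i))))) h0
  simp only [AlternatingMap.zero_apply] at h1
  rw [wedge_wedgePow_apply _ (forall_append_mem (p := fun x => ∀ y, b ![x, y] = 0) hb₁ hb₂
    (mem_ker_bilOf.1 h₃N)), wedge_one_two_apply θ h₃ ha₁ ha₂] at h1
  exact mul_ne_zero (mul_ne_zero h₃a hθ) hu h1

/-- A skew matrix of odd size equals minus its transpose, so its determinant is its own negative. -/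
theorem exists_radical_of_odd [FiniteDimensional 𝕜 V] {m : ℕ} (hV : Module.finrank 𝕜 V = 2 * m + 1)
    (b : V [⋀^Fin 2]→ₗ[𝕜] 𝕜) : ∃ x, x ≠ 0 ∧ ∀ y, b ![x, y] = 0 := by
  let B := Module.finBasisOfFinrankEq 𝕜 V hV
  let M : Matrix (Fin (2 * m + 1)) (Fin (2 * m + 1)) 𝕜 := Matrix.of fun i j => b ![B j, B i]
  have hM : M.transpose = -M := by
    ext i j
    simpa [M] using form_two_swap b (B i) (B j)
  have hdet : M.det = 0 := by
    have h := Matrix.det_transpose M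
    rw [hM, Matrix.det_neg, Fintype.card_fin, pow_succ, pow_mul] at h
    simp only [even_two, Even.neg_pow, one_pow, one_mul, neg_mul] at h
    exact self_eq_neg.1 h.symm
  obtain ⟨c, hc, hMc⟩ := Matrix.exists_mulVec_eq_zero_iff.2 hdet
  refine ⟨∑ i, c i • B i, fun h0 => hc ?_, fun y => ?_⟩
  · ext i
    exact Fintype.linearIndependent_iff.1 B.linearIndependent c h0 i
  · have h1 : bilOf b (∑ i, c i • B i) = 0 := B.ext fun j => by
      have := congrFun hMc j
      simp only [Matrix.mulVec, dotProduct, M, Matrix.of_apply, Pi.zero_apply] at this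
      simp only [map_sum, map_smul, LinearMap.sum_apply, LinearMap.smul_apply, bilOf_apply,
        smul_eq_mul, LinearMap.zero_apply]
      rw [← this]
      exact Finset.sum_congr rfl fun _ _ => mul_comm _ _
    exact congrArg (fun f => f y) h1

/-- In odd dimension `b` has a radical vector `z`. If `a(z) ≠ 0`, the vanishing product forces `b^m
= 0`, so `b` degenerates on the even-dimensional kernel of `a`, and a kernel vector found there is
orthogonal to `z` as well. This reads `α ∧ σ^{n-1} = 0` as the existence of a common kernel vector.
-/
theorem wedge_wedgePow_eq_zero_iff [FiniteDimensional 𝕜 V] {m : ℕ}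
    (hV : Module.finrank 𝕜 V = 1 + 2 * m) {a : V [⋀^Fin 1]→ₗ[𝕜] 𝕜} {b : V [⋀^Fin 2]→ₗ[𝕜] 𝕜} :
    wedge a (wedgePow b m) = 0 ↔ ∃ x, x ≠ 0 ∧ a ![x] = 0 ∧ ∀ y, b ![x, y] = 0 := by
  constructor
  · intro h
    obtain ⟨z, hz, hzb⟩ := exists_radical_of_odd (m := m) (by omega) b
    by_cases haz : linOf a z = 0
    · exact ⟨z, hz, haz, hzb⟩
    have hpow : wedgePow b m = 0 := by
      ext u
      have h1 := congrArg (fun c => c (Fin.append ![z] u)) h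
      simp only [AlternatingMap.zero_apply] at h1
      rw [wedge_wedgePow_apply _ (fun i => by fin_cases i; exact hzb)] at h1
      exact (mul_eq_zero.1 h1).resolve_left haz
    set K := LinearMap.ker (linOf a) with hK
    have hKr : Module.finrank 𝕜 K = 2 * m := by
      have h1 := LinearMap.finrank_range_add_finrank_ker (linOf a)
      have h2 : LinearMap.range (linOf a) = ⊤ := by
        rw [LinearMap.range_eq_top]
        exact fun t => ⟨(t * (linOf a z)⁻¹) • z, by
          rw [map_smul, smul_eq_mul, mul_assoc, inv_mul_cancel₀ haz, mul_one]⟩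
      rw [h2, finrank_top, Module.finrank_self, hV, ← hK] at h1
      omega
    obtain ⟨x, hx, hxb⟩ := exists_degenerate_of_wedgePow_eq_zero hKr
      (b := b.compLinearMap K.subtype) (by rw [wedgePow_comp, hpow]; rfl)
    refine ⟨x, fun h0 => hx (Subtype.ext h0), x.2, fun y => ?_⟩
    have h1 := hxb ⟨y - ((linOf a z)⁻¹ * linOf a y) • z, by
      rw [hK, LinearMap.mem_ker, map_sub, map_smul, smul_eq_mul, mul_right_comm,
        inv_mul_cancel₀ haz, one_mul, sub_self]⟩
    rw [AlternatingMap.compLinearMap_apply, form_two_apply] at h1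
    have h2 : bilOf b x (y - ((linOf a z)⁻¹ * linOf a y) • z) = 0 := h1
    have h3 : bilOf b x z = 0 := by rw [bilOf_swap, bilOf_apply, hzb, neg_zero]
    rw [map_sub, map_smul, h3, smul_zero, sub_zero] at h2
    exact h2
  · rintro ⟨x, hx, hax, hbx⟩
    refine eq_zero_of_top_degree hV hx fun v hv => ?_
    exact wedge_apply_eq_zero (fun u hu => form_one_eq_zero_of_mem hax u hu)
      (fun u hu => wedgePow_apply_of_mem_radical hbx u hu) v hv

end Radicals

/-! ### Equivalence of germs and Moser's method along a connected parameter set. -/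

section GermEquivalence

variable {𝕜 : Type u} [RCLike 𝕜] {r : WithTop ℕ∞}
variable {E : Type u} [NormedAddCommGroup E] [NormedSpace 𝕜 E]

/-- `W'` pulls back to `W` near `0` under a diffeomorphism-germ. -/
def GermEquivalent (𝕜 : Type u) [RCLike 𝕜] {E : Type u} [NormedAddCommGroup E] [NormedSpace 𝕜 E]
    (r : WithTop ℕ∞) (W W' : E → E →L[𝕜] E →L[𝕜] 𝕜) : Prop :=
  ∃ Φ : E → E, IsDiffeoGerm 𝕜 r Φ ∧
    ∀ᶠ x in 𝓝 0, ∀ a b, W' (Φ x) (fderiv 𝕜 Φ x a) (fderiv 𝕜 Φ x b) = W x a b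

theorem IsDiffeoGerm.comp {Φ Ψ : E → E} (hΦ : IsDiffeoGerm 𝕜 r Φ) (hΨ : IsDiffeoGerm 𝕜 r Ψ) :
    IsDiffeoGerm 𝕜 r (fun x => Φ (Ψ x)) := by
  obtain ⟨h1, h2, Φ', h3, h4, h5, h6⟩ := hΦ
  obtain ⟨k1, k2, Ψ', k3, k4, k5, k6⟩ := hΨ
  have hc : ∀ {f : E → E}, IsGerm 𝕜 r f → f 0 = 0 → Tendsto f (𝓝 0) (𝓝 0) := fun hf h0 => by
    have := (SmoothNear.continuousAt hf).tendsto
    rwa [h0] at this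
  refine ⟨SmoothNear.comp (by rwa [k2]) k1, by simp only [k2, h2], fun x => Ψ' (Φ' x),
    SmoothNear.comp (by rwa [h4]) h3, by simp only [h4, k4], ?_, ?_⟩
  · filter_upwards [k5, (hc k1 k2).eventually h5] with x e1 e2
    rw [e2, e1]
  · filter_upwards [h6, (hc h3 h4).eventually k6] with x e1 e2
    rw [e2, e1]

theorem IsDiffeoGerm.tendsto {Φ : E → E} (hΦ : IsDiffeoGerm 𝕜 r Φ) : Tendsto Φ (𝓝 0) (𝓝 0) := by
  have := (SmoothNear.continuousAt hΦ.1).tendsto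
  rwa [hΦ.2.1] at this

theorem IsDiffeoGerm.differentiableAt (hr : r = ((⊤ : ℕ∞) : WithTop ℕ∞) ∨ r = ⊤) {Φ : E → E}
    (hΦ : IsDiffeoGerm 𝕜 r Φ) : ∀ᶠ x in 𝓝 0, DifferentiableAt 𝕜 Φ x :=
  hΦ.1.mono fun _ hx => hx.differentiableAt (ne_zero_of_infty_or_top hr)

theorem GermEquivalent.trans (hr : r = ((⊤ : ℕ∞) : WithTop ℕ∞) ∨ r = ⊤)
    {W W' W'' : E → E →L[𝕜] E →L[𝕜] 𝕜} (h : GermEquivalent 𝕜 r W W')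
    (h' : GermEquivalent 𝕜 r W' W'') : GermEquivalent 𝕜 r W W'' := by
  obtain ⟨Ψ, hΨ, e⟩ := h
  obtain ⟨Φ, hΦ, e'⟩ := h'
  refine ⟨_, hΦ.comp hΨ, ?_⟩
  filter_upwards [e, hΨ.tendsto.eventually e', hΨ.differentiableAt hr,
    hΨ.tendsto.eventually (hΦ.differentiableAt hr)] with x h1 h2 h3 h4 a b
  have h5 : fderiv 𝕜 (fun x => Φ (Ψ x)) x = (fderiv 𝕜 Φ (Ψ x)).comp (fderiv 𝕜 Ψ x) :=
    (h4.hasFDerivAt.comp x h3.hasFDerivAt).fderiv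
  rw [h5]
  exact (h2 _ _).trans (h1 a b)

theorem GermEquivalent.symm (hr : r = ((⊤ : ℕ∞) : WithTop ℕ∞) ∨ r = ⊤)
    {W W' : E → E →L[𝕜] E →L[𝕜] 𝕜} (h : GermEquivalent 𝕜 r W W') : GermEquivalent 𝕜 r W' W := by
  obtain ⟨Φ, hΦ, e⟩ := h
  have hΦ' := hΦ
  obtain ⟨h1, h2, Ψ, h3, h4, h5, h6⟩ := hΦ'
  have hΨ : IsDiffeoGerm 𝕜 r Ψ := ⟨h3, h4, Φ, h1, h2, h6, h5⟩
  refine ⟨Ψ, hΨ, ?_⟩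
  filter_upwards [hΨ.tendsto.eventually e, hΨ.differentiableAt hr,
    hΨ.tendsto.eventually (hΦ.differentiableAt hr), eventually_eventually_nhds.2 h6]
    with y k1 k2 k3 k4 a b
  have h7 : HasFDerivAt (fun y => Φ (Ψ y)) ((fderiv 𝕜 Φ (Ψ y)).comp (fderiv 𝕜 Ψ y)) y :=
    k3.hasFDerivAt.comp y k2.hasFDerivAt
  have h8 := h7.unique ((hasFDerivAt_id y).congr_of_eventuallyEq k4)
  have h9 : ∀ a, fderiv 𝕜 Φ (Ψ y) (fderiv 𝕜 Ψ y a) = a := fun a => congrArg (fun L => L a) h8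
  rw [← k1, h9, h9, k4.self_of_nhds]

/-- A global form of Moser's argument along a connected set of parameters. -/
theorem germEquivalent_of_path [FiniteDimensional 𝕜 E]
    (hr : r = ((⊤ : ℕ∞) : WithTop ℕ∞) ∨ r = ⊤) {W₀ W₁ : E → E →L[𝕜] E →L[𝕜] 𝕜}
    (hW₀ : SmoothNear 𝕜 r W₀ 0) (hW₁ : SmoothNear 𝕜 r W₁ 0)
    (hs₀ : ∀ x a b, W₀ x a b = -W₀ x b a) (hs₁ : ∀ x a b, W₁ x a b = -W₁ x b a)
    (hc₀ : ∀ᶠ x in 𝓝 0, IsClosedBilinAt W₀ x) (hc₁ : ∀ᶠ x in 𝓝 0, IsClosedBilinAt W₁ x)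
    {ℓ : E →L[𝕜] 𝕜} {e : E} (he : ℓ e = 1) {β : E → E →L[𝕜] 𝕜} (hβ : SmoothNear 𝕜 r β 0)
    (hd : ∀ᶠ x in 𝓝 0, ∀ a b, fderiv 𝕜 (fun x => ℓ x • β x) x a b -
      fderiv 𝕜 (fun x => ℓ x • β x) x b a = W₁ x a b - W₀ x a b)
    (hdeg : ∀ᶠ x in 𝓝 0, ℓ x = 0 → ∀ t : 𝕜, ∃ v, v ≠ 0 ∧ (W₀ x + t • (W₁ x - W₀ x)) v = 0)
    {T : Set 𝕜} (hT : IsPreconnected T) (hT0 : (0 : 𝕜) ∈ T) (hT1 : (1 : 𝕜) ∈ T)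
    (hker : ∀ t ∈ T, ∃ k₁ k₂, (W₀ 0 + t • (W₁ 0 - W₀ 0)) k₁ = 0 ∧
      (W₀ 0 + t • (W₁ 0 - W₀ 0)) k₂ = 0 ∧
      (∀ v, (W₀ 0 + t • (W₁ 0 - W₀ 0)) v = 0 → ∃ a b : 𝕜, v = a • k₁ + b • k₂) ∧
      fderiv 𝕜 W₀ 0 e k₁ k₂ + t * (fderiv 𝕜 W₁ 0 e k₁ k₂ - fderiv 𝕜 W₀ 0 e k₁ k₂) ≠ 0)
    (hβ0 : ∀ (t : 𝕜) v, (W₀ 0 + t • (W₁ 0 - W₀ 0)) v = 0 → β 0 v = 0) :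
    GermEquivalent 𝕜 r W₀ W₁ := by
  have hn := ne_zero_of_infty_or_top hr
  have _ : CompleteSpace E := FiniteDimensional.complete 𝕜 E
  let _ : NormedSpace ℝ E := NormedSpace.restrictScalars ℝ 𝕜 E
  have _ : IsScalarTower ℝ 𝕜 E := IsScalarTower.restrictScalars ..
  set η : E → E →L[𝕜] E →L[𝕜] 𝕜 := fun x => W₁ x - W₀ x with hηdef
  have hη : SmoothNear 𝕜 r η 0 := by
    filter_upwards [hW₀, hW₁] with x h0 h1
    exact h1.sub h0
  have hcη : ∀ᶠ x in 𝓝 0, IsClosedBilinAt η x := by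
    filter_upwards [hW₀, hW₁, hc₀, hc₁] with x h0 h1 h2 h3 a b c
    have h4 : fderiv 𝕜 η x = fderiv 𝕜 W₁ x - fderiv 𝕜 W₀ x :=
      fderiv_fun_sub (h1.differentiableAt hn) (h0.differentiableAt hn)
    have h5 := h2 a b c
    have h6 := h3 a b c
    simp only [h4, sub_apply]
    linear_combination h6 - h5
  set A : 𝕜 × E → E →L[𝕜] E →L[𝕜] 𝕜 := fun z => W₀ z.2 + z.1 • η z.2 with hA
  have hAskew : ∀ z a b, A z a b = -A z b a := fun z a b => by
    simp only [hA, hηdef, add_apply, smul_apply, sub_apply, smul_eq_mul]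
    rw [hs₀ _ a b, hs₁ _ a b]
    ring
  have hsnd : ∀ t₀ : 𝕜, Tendsto (Prod.snd : 𝕜 × E → E) (𝓝 (t₀, 0)) (𝓝 0) :=
    fun t₀ => continuous_snd.tendsto (t₀, 0)
  have hμ : SmoothNear 𝕜 r (fun x => ℓ x • β x) 0 := by
    filter_upwards [hβ] with x hx
    exact ℓ.contDiff.contDiffAt.smul hx
  have hloc : ∀ t₀ ∈ T, ∀ᶠ t in 𝓝 t₀,
      GermEquivalent 𝕜 r (fun x => A (t₀, x)) (fun x => A (t, x)) := by
    intro t₀ ht₀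
    obtain ⟨k₁, k₂, hk₁, hk₂, hsp, hne⟩ := hker t₀ ht₀
    have hAs : SmoothNear 𝕜 r A (t₀, 0) := by
      filter_upwards [(hsnd t₀).eventually hW₀, (hsnd t₀).eventually hη] with z h0 h1
      exact (h0.comp z contDiffAt_snd).add (contDiffAt_fst.smul (h1.comp z contDiffAt_snd))
    have hβs : SmoothNear 𝕜 r (fun z : 𝕜 × E => -β z.2) (t₀, 0) := by
      filter_upwards [(hsnd t₀).eventually hβ] with z h0
      exact (h0.comp z contDiffAt_snd).neg
    have hdA : fderiv 𝕜 A (t₀, 0) (0, e) k₁ k₂ =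
        fderiv 𝕜 W₀ 0 e k₁ k₂ + t₀ * (fderiv 𝕜 W₁ 0 e k₁ k₂ - fderiv 𝕜 W₀ 0 e k₁ k₂) := by
      have h0 : HasFDerivAt W₀ (fderiv 𝕜 W₀ 0) (t₀, (0 : E)).2 :=
        (hW₀.self.differentiableAt hn).hasFDerivAt
      have h1 : HasFDerivAt W₁ (fderiv 𝕜 W₁ 0) (t₀, (0 : E)).2 :=
        (hW₁.self.differentiableAt hn).hasFDerivAt
      have h2 : HasFDerivAt A _ (t₀, (0 : E)) :=
        (h0.comp (t₀, (0 : E)) hasFDerivAt_snd).add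
          ((hasFDerivAt_fst (𝕜 := 𝕜) (p := (t₀, (0 : E)))).smul
            ((h1.sub h0).comp (t₀, (0 : E)) hasFDerivAt_snd))
      rw [h2.fderiv]
      simp
    -- The parameter `t` is treated as one more coordinate, so the field comes out regular jointly
    -- in `t` and `x`.
    obtain ⟨V, hV, hVe, hV0⟩ := exists_field_solving hr (ℓ := ℓ.comp (ContinuousLinearMap.snd 𝕜 𝕜 E))
      (e := ((0 : 𝕜), e)) hAs hAskew (by simpa using he) (by simp)
      (by
        filter_upwards [(hsnd t₀).eventually hdeg] with z hz h0
        exact hz h0 z.1)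
      hk₁ hk₂ hsp (by rw [hdA]; exact hne) hβs
    refine moser_local hr hA hW₀ hη hμ hV hAskew hc₀ hcη hd ?_ ?_
    · filter_upwards [hVe] with z hz b
      rw [hz]
      simp
    · have hcont : Tendsto (fun t : 𝕜 => (t, (0 : E))) (𝓝 t₀) (𝓝 (t₀, 0)) :=
        (Continuous.prodMk_left (0 : E)).tendsto t₀
      filter_upwards [hcont.eventually hV0] with t ht
      refine ht (by simp) fun v hv => ?_
      rw [neg_apply, hβ0 t v hv, neg_zero]
  -- No single flow reaches from 0 to 1: equivalence is a locally constant relation in `t`, hence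
  -- constant on the connected set `T`.
  have hglob := hT.induction₂
    (fun t t' => GermEquivalent 𝕜 r (fun x => A (t, x)) (fun x => A (t', x)))
    (fun t ht => (hloc t ht).filter_mono nhdsWithin_le_nhds)
    (fun _ _ _ _ _ _ h h' => h.trans hr h') (fun _ _ _ _ h => h.symm hr) hT0 hT1
  have e0 : (fun x => A (0, x)) = W₀ := by funext x; simp [hA]
  have e1 : (fun x => A (1, x)) = W₁ := by funext x; simp [hA, hηdef]
  rwa [e0, e1] at hglob

end GermEquivalence

/-! ### Exterior derivatives and pull-backs of bilinear fields. -/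

section ClosedForms

variable {𝕜 : Type*} [RCLike 𝕜] {r : WithTop ℕ∞}
variable {E : Type*} [NormedAddCommGroup E] [NormedSpace 𝕜 E]
variable {F : Type*} [NormedAddCommGroup F] [NormedSpace 𝕜 F]

variable (𝕜 E) in
/-- Transposition of bilinear forms. -/
def flipCLM : (E →L[𝕜] E →L[𝕜] 𝕜) →L[𝕜] (E →L[𝕜] E →L[𝕜] 𝕜) :=
  ((ContinuousLinearMap.flipₗᵢ 𝕜 E E 𝕜).toContinuousLinearEquiv :
    (E →L[𝕜] E →L[𝕜] 𝕜) →L[𝕜] (E →L[𝕜] E →L[𝕜] 𝕜))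

theorem flipCLM_apply (B : E →L[𝕜] E →L[𝕜] 𝕜) (a b : E) : flipCLM 𝕜 E B a b = B b a := rfl

/-- Pull-back of bilinear forms under a linear map. -/
def comapCLM (L : E →L[𝕜] F) : (F →L[𝕜] F →L[𝕜] 𝕜) →L[𝕜] (E →L[𝕜] E →L[𝕜] 𝕜) :=
  ((ContinuousLinearMap.compL 𝕜 E (F →L[𝕜] 𝕜) (E →L[𝕜] 𝕜))
    ((ContinuousLinearMap.compL 𝕜 E F 𝕜).flip L)).comp
      ((ContinuousLinearMap.compL 𝕜 E F (F →L[𝕜] 𝕜)).flip L)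

theorem comapCLM_apply (L : E →L[𝕜] F) (B : F →L[𝕜] F →L[𝕜] 𝕜) (a b : E) :
    comapCLM L B a b = B (L a) (L b) := rfl

/-- The exterior derivative of a field of linear forms, as a bilinear form. -/
def bilinDeriv (μ : E → E →L[𝕜] 𝕜) (x : E) : E →L[𝕜] E →L[𝕜] 𝕜 :=
  fderiv 𝕜 μ x - flipCLM 𝕜 E (fderiv 𝕜 μ x)

theorem bilinDeriv_apply (μ : E → E →L[𝕜] 𝕜) (x a b : E) :
    bilinDeriv μ x a b = fderiv 𝕜 μ x a b - fderiv 𝕜 μ x b a := rfl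

theorem SmoothNear.bilinDeriv (hr : r = ((⊤ : ℕ∞) : WithTop ℕ∞) ∨ r = ⊤) {μ : E → E →L[𝕜] 𝕜}
    {x : E} (hμ : SmoothNear 𝕜 r μ x) : SmoothNear 𝕜 r (bilinDeriv μ) x := by
  filter_upwards [hμ.fderiv hr] with y hy
  exact hy.sub ((flipCLM 𝕜 E).contDiff.contDiffAt.comp y hy)

theorem isClosedBilinAt_bilinDeriv (hr : r = ((⊤ : ℕ∞) : WithTop ℕ∞) ∨ r = ⊤)
    {μ : E → E →L[𝕜] 𝕜} {x : E} (hμ : SmoothNear 𝕜 r μ x) :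
    IsClosedBilinAt (bilinDeriv μ) x := by
  have hn := ne_zero_of_infty_or_top hr
  have h1 : DifferentiableAt 𝕜 (fderiv 𝕜 μ) x := (hμ.fderiv hr).self.differentiableAt hn
  have h2 : HasFDerivAt (SingularSymplectic.bilinDeriv μ) (fderiv 𝕜 (fderiv 𝕜 μ) x -
      (flipCLM 𝕜 E).comp (fderiv 𝕜 (fderiv 𝕜 μ) x)) x :=
    h1.hasFDerivAt.sub ((flipCLM 𝕜 E).hasFDerivAt.comp x h1.hasFDerivAt)
  have h3 : IsSymmSndFDerivAt 𝕜 μ x := hμ.self.isSymmSndFDerivAt (by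
    rcases hr with rfl | rfl
    · rw [minSmoothness_of_isRCLikeNormedField]; exact WithTop.coe_le_coe.2 le_top
    · exact le_top)
  intro a b c
  rw [h2.fderiv]
  simp only [sub_apply, ContinuousLinearMap.comp_apply, flipCLM_apply]
  rw [h3.eq a b, h3.eq a c, h3.eq b c]
  ring

theorem IsClosedBilinAt.add {A B : E → E →L[𝕜] E →L[𝕜] 𝕜} {x : E} (hA : IsClosedBilinAt A x)
    (hB : IsClosedBilinAt B x) (hAd : DifferentiableAt 𝕜 A x) (hBd : DifferentiableAt 𝕜 B x) :
    IsClosedBilinAt (fun y => A y + B y) x := by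
  intro a b c
  rw [fderiv_fun_add hAd hBd]
  simp only [add_apply]
  linear_combination hA a b c + hB a b c

theorem IsClosedBilinAt.sub {A B : E → E →L[𝕜] E →L[𝕜] 𝕜} {x : E} (hA : IsClosedBilinAt A x)
    (hB : IsClosedBilinAt B x) (hAd : DifferentiableAt 𝕜 A x) (hBd : DifferentiableAt 𝕜 B x) :
    IsClosedBilinAt (fun y => A y - B y) x := by
  intro a b c
  rw [fderiv_fun_sub hAd hBd]
  simp only [sub_apply]
  linear_combination hA a b c - hB a b c

theorem IsClosedBilinAt.comap {S : F → F →L[𝕜] F →L[𝕜] 𝕜} (L : E →L[𝕜] F) {x : E}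
    (hS : IsClosedBilinAt S (L x)) (hSd : DifferentiableAt 𝕜 S (L x)) :
    IsClosedBilinAt (fun y => comapCLM L (S (L y))) x := by
  have h : HasFDerivAt (fun y => comapCLM L (S (L y)))
      ((comapCLM L).comp ((fderiv 𝕜 S (L x)).comp L)) x :=
    (comapCLM L).hasFDerivAt.comp x (hSd.hasFDerivAt.comp x L.hasFDerivAt)
  intro a b c
  rw [h.fderiv]
  exact hS _ _ _

end ClosedForms

/-! ### The normal form d(p₁π^*α) + π^*σ and reduction to it. -/

section NormalForm

theorem tendsto_snd_zero {X Y : Type*} [TopologicalSpace X] [TopologicalSpace Y] [Zero X] [Zero Y] :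
    Tendsto (Prod.snd : X × Y → Y) (𝓝 0) (𝓝 0) :=
  continuous_snd.tendsto (0 : X × Y)

theorem tendsto_inr_zero {X Y : Type*} [TopologicalSpace X] [TopologicalSpace Y] [Zero X] [Zero Y] :
    Tendsto (fun y : Y => ((0 : X), y)) (𝓝 0) (𝓝 0) :=
  (Continuous.prodMk_right (0 : X)).tendsto (0 : Y)

variable {𝕜 : Type u} [RCLike 𝕜] {r : WithTop ℕ∞}
variable {H : Type u} [NormedAddCommGroup H] [NormedSpace 𝕜 H]

/-- The pull-back to `𝕜 × H` of a field of linear forms on `H`. -/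
def liftForm (A : H → H →L[𝕜] 𝕜) (z : 𝕜 × H) : 𝕜 × H →L[𝕜] 𝕜 :=
  (A z.2).comp (ContinuousLinearMap.snd 𝕜 𝕜 H)

/-- The field of bilinear forms `d(p π^* A) + π^* S` on `𝕜 × H`. -/
def normalBilin (A : H → H →L[𝕜] 𝕜) (S : H → H →L[𝕜] H →L[𝕜] 𝕜) (z : 𝕜 × H) :
    𝕜 × H →L[𝕜] 𝕜 × H →L[𝕜] 𝕜 :=
  bilinDeriv (fun z => ContinuousLinearMap.fst 𝕜 𝕜 H z • liftForm A z) z +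
    comapCLM (ContinuousLinearMap.snd 𝕜 𝕜 H) (S (ContinuousLinearMap.snd 𝕜 𝕜 H z))

theorem liftForm_apply (A : H → H →L[𝕜] 𝕜) (z v : 𝕜 × H) : liftForm A z v = A z.2 v.2 := rfl

theorem SmoothNear.liftForm {A : H → H →L[𝕜] 𝕜} (hA : SmoothNear 𝕜 r A 0) :
    SmoothNear 𝕜 r (liftForm A) 0 := by
  filter_upwards [tendsto_snd_zero.eventually hA] with z hz
  exact (hz.comp z contDiffAt_snd).clm_comp contDiffAt_const

theorem SmoothNear.fst_smul_liftForm {A : H → H →L[𝕜] 𝕜} (hA : SmoothNear 𝕜 r A 0) :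
    SmoothNear 𝕜 r (fun z => ContinuousLinearMap.fst 𝕜 𝕜 H z •
      SingularSymplectic.liftForm A z) 0 := by
  filter_upwards [hA.liftForm] with z hz
  exact contDiffAt_fst.smul hz

theorem fderiv_fst_smul_liftForm {A : H → H →L[𝕜] 𝕜} {z : 𝕜 × H} (hA : DifferentiableAt 𝕜 A z.2)
    (a b : 𝕜 × H) :
    fderiv 𝕜 (fun z => ContinuousLinearMap.fst 𝕜 𝕜 H z • liftForm A z) z a b =
      a.1 * A z.2 b.2 + z.1 * fderiv 𝕜 A z.2 a.2 b.2 := by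
  have h1 : HasFDerivAt (fun z : 𝕜 × H => A z.2) _ z := hA.hasFDerivAt.comp z hasFDerivAt_snd
  have h2 : HasFDerivAt (liftForm A) _ z :=
    h1.clm_comp (hasFDerivAt_const (ContinuousLinearMap.snd 𝕜 𝕜 H) z)
  have h3 := (ContinuousLinearMap.fst 𝕜 𝕜 H).hasFDerivAt (x := z) |>.smul h2
  have h4 : fderiv 𝕜 (fun z => ContinuousLinearMap.fst 𝕜 𝕜 H z • liftForm A z) z = _ := h3.fderiv
  rw [h4]
  simp [liftForm_apply]
  ring

theorem normalBilin_apply {A : H → H →L[𝕜] 𝕜} (S : H → H →L[𝕜] H →L[𝕜] 𝕜) {z : 𝕜 × H}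
    (hA : DifferentiableAt 𝕜 A z.2) (a b : 𝕜 × H) :
    normalBilin A S z a b = a.1 * A z.2 b.2 - b.1 * A z.2 a.2 +
      z.1 * (fderiv 𝕜 A z.2 a.2 b.2 - fderiv 𝕜 A z.2 b.2 a.2) + S z.2 a.2 b.2 := by
  rw [normalBilin, add_apply, add_apply, bilinDeriv_apply, fderiv_fst_smul_liftForm hA,
    fderiv_fst_smul_liftForm hA, comapCLM_apply]
  simp only [ContinuousLinearMap.coe_snd']
  ring

theorem normalBilin_skew (A : H → H →L[𝕜] 𝕜) {S : H → H →L[𝕜] H →L[𝕜] 𝕜}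
    (hS : ∀ y a b, S y a b = -S y b a) (z a b : 𝕜 × H) :
    normalBilin A S z a b = -normalBilin A S z b a := by
  simp only [normalBilin, add_apply, bilinDeriv_apply, comapCLM_apply]
  rw [hS _ (ContinuousLinearMap.snd 𝕜 𝕜 H a)]
  ring

theorem SmoothNear.normalBilin (hr : r = ((⊤ : ℕ∞) : WithTop ℕ∞) ∨ r = ⊤) {A : H → H →L[𝕜] 𝕜}
    {S : H → H →L[𝕜] H →L[𝕜] 𝕜} (hA : SmoothNear 𝕜 r A 0) (hS : SmoothNear 𝕜 r S 0) :
    SmoothNear 𝕜 r (normalBilin A S) 0 := by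
  filter_upwards [hA.fst_smul_liftForm.bilinDeriv hr, tendsto_snd_zero.eventually hS] with z h1 h2
  have h3 : ContDiffAt 𝕜 r (fun z : 𝕜 × H => S (ContinuousLinearMap.snd 𝕜 𝕜 H z)) z :=
    h2.comp z contDiffAt_snd
  exact h1.add ((comapCLM (ContinuousLinearMap.snd 𝕜 𝕜 H)).contDiff.contDiffAt.comp z h3)

theorem isClosedBilinAt_normalBilin (hr : r = ((⊤ : ℕ∞) : WithTop ℕ∞) ∨ r = ⊤)
    {A : H → H →L[𝕜] 𝕜} {S : H → H →L[𝕜] H →L[𝕜] 𝕜} (hA : SmoothNear 𝕜 r A 0)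
    (hS : SmoothNear 𝕜 r S 0) (hSc : ∀ᶠ y in 𝓝 0, IsClosedBilinAt S y) :
    ∀ᶠ z in 𝓝 0, IsClosedBilinAt (normalBilin A S) z := by
  have hn := ne_zero_of_infty_or_top hr
  filter_upwards [hA.fst_smul_liftForm.eventually, tendsto_snd_zero.eventually hS,
    tendsto_snd_zero.eventually hSc] with z h1 h2 h3
  have h2d : DifferentiableAt 𝕜 S (ContinuousLinearMap.snd 𝕜 𝕜 H z) := h2.differentiableAt hn
  exact (isClosedBilinAt_bilinDeriv hr h1).add (IsClosedBilinAt.comap _ h3 h2d)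
    ((h1.bilinDeriv hr).self.differentiableAt hn)
    ((comapCLM (ContinuousLinearMap.snd 𝕜 𝕜 H)).differentiableAt.comp z
      (h2d.comp z (ContinuousLinearMap.snd 𝕜 𝕜 H).differentiableAt))

/-- On vectors tangent to the hyperplane the normal form reads `p dA + S`, with `A` and `S`
independent of `p`. This identifies the nondegeneracy needed by the solver with a condition on `dα`.
-/
theorem fderiv_normalBilin (hr : r = ((⊤ : ℕ∞) : WithTop ℕ∞) ∨ r = ⊤) {A : H → H →L[𝕜] 𝕜}
    {S : H → H →L[𝕜] H →L[𝕜] 𝕜} (hA : SmoothNear 𝕜 r A 0) (hS : SmoothNear 𝕜 r S 0) (h h' : H) :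
    fderiv 𝕜 (normalBilin A S) 0 (1, 0) (0, h) (0, h') =
      fderiv 𝕜 A 0 h h' - fderiv 𝕜 A 0 h' h := by
  have hn := ne_zero_of_infty_or_top hr
  have h1 : HasFDerivAt (normalBilin A S) (fderiv 𝕜 (normalBilin A S) 0) 0 :=
    ((SmoothNear.normalBilin hr hA hS).self.differentiableAt hn).hasFDerivAt
  have h2 := (h1.clm_apply (hasFDerivAt_const ((0 : 𝕜), h) 0)).clm_apply
    (hasFDerivAt_const ((0 : 𝕜), h') 0)
  have h2A : HasFDerivAt (fderiv 𝕜 A) (fderiv 𝕜 (fderiv 𝕜 A) 0) (0 : 𝕜 × H).2 :=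
    ((hA.fderiv hr).self.differentiableAt hn).hasFDerivAt
  have h4 : HasFDerivAt (fun z : 𝕜 × H => fderiv 𝕜 A z.2)
      ((fderiv 𝕜 (fderiv 𝕜 A) 0).comp (ContinuousLinearMap.snd 𝕜 𝕜 H)) 0 :=
    h2A.comp (0 : 𝕜 × H) hasFDerivAt_snd
  have h3 := ((h4.clm_apply (hasFDerivAt_const h (0 : 𝕜 × H))).clm_apply
    (hasFDerivAt_const h' (0 : 𝕜 × H))).sub
      ((h4.clm_apply (hasFDerivAt_const h' (0 : 𝕜 × H))).clm_apply
        (hasFDerivAt_const h (0 : 𝕜 × H)))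
  have hS0 : HasFDerivAt S (fderiv 𝕜 S 0) (0 : 𝕜 × H).2 :=
    (hS.self.differentiableAt hn).hasFDerivAt
  have h5' : HasFDerivAt (fun z : 𝕜 × H => S z.2)
      ((fderiv 𝕜 S 0).comp (ContinuousLinearMap.snd 𝕜 𝕜 H)) 0 :=
    hS0.comp (0 : 𝕜 × H) hasFDerivAt_snd
  have h5 :=
    ((h5'.clm_apply (hasFDerivAt_const h (0 : 𝕜 × H))).clm_apply
      (hasFDerivAt_const h' (0 : 𝕜 × H)))
  have h6 := ((hasFDerivAt_fst (𝕜 := 𝕜) (p := (0 : 𝕜 × H))).mul h3).add h5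
  have h7 := h2.unique (h6.congr_of_eventuallyEq (by
    filter_upwards [tendsto_snd_zero.eventually hA] with z hz
    rw [normalBilin_apply S (hz.differentiableAt hn)]
    simp))
  simpa using congrArg (fun L => L ((1 : 𝕜), (0 : H))) h7

/-- Reduction of a field of bilinear forms, degenerate along a hyperplane, to a normal form. -/
theorem germEquivalent_normalBilin [FiniteDimensional 𝕜 H]
    (hr : r = ((⊤ : ℕ∞) : WithTop ℕ∞) ∨ r = ⊤) {W : 𝕜 × H → 𝕜 × H →L[𝕜] 𝕜 × H →L[𝕜] 𝕜}
    (hW : SmoothNear 𝕜 r W 0) (hskew : ∀ z a b, W z a b = -W z b a)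
    (hc : ∀ᶠ z in 𝓝 0, IsClosedBilinAt W z)
    (hdeg : ∀ᶠ z in 𝓝 0, z.1 = 0 → ∃ v, v ≠ 0 ∧ W z v = 0) {h₁ h₂ : H}
    (hk₁ : W 0 (0, h₁) = 0) (hk₂ : W 0 (0, h₂) = 0)
    (hsp : ∀ v, W 0 v = 0 → ∃ a b : 𝕜, v = a • ((0 : 𝕜), h₁) + b • ((0 : 𝕜), h₂))
    (hd : fderiv 𝕜 W 0 (1, 0) (0, h₁) (0, h₂) ≠ 0) :
    ∃ (A : H → H →L[𝕜] 𝕜) (S : H → H →L[𝕜] H →L[𝕜] 𝕜), SmoothNear 𝕜 r A 0 ∧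
      SmoothNear 𝕜 r S 0 ∧ (∀ y a b, S y a b = W (0, y) (0, a) (0, b)) ∧
      (∀ y a, A y a = W (0, y) (1, 0) (0, a)) ∧
      fderiv 𝕜 A 0 h₁ h₂ - fderiv 𝕜 A 0 h₂ h₁ ≠ 0 ∧
      (∀ᶠ y in 𝓝 0, IsClosedBilinAt S y) ∧
      GermEquivalent 𝕜 r (normalBilin A S) W := by
  have hn := ne_zero_of_infty_or_top hr
  set i := ContinuousLinearMap.inr 𝕜 𝕜 H with hi
  have hiy : ∀ y, i y = (0, y) := fun _ => rfl
  set S : H → H →L[𝕜] H →L[𝕜] 𝕜 := fun y => comapCLM i (W (i y)) with hS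
  set A : H → H →L[𝕜] 𝕜 := fun y => (W (i y) (1, 0)).comp i with hA
  have hit : Tendsto i (𝓝 0) (𝓝 0) := tendsto_inr_zero
  have hWi : ∀ᶠ y in 𝓝 (0 : H), ContDiffAt 𝕜 r (fun y => W (i y)) y := by
    filter_upwards [hit.eventually hW] with y hy
    exact hy.comp y i.contDiff.contDiffAt
  have hSs : SmoothNear 𝕜 r S 0 := by
    filter_upwards [hWi] with y hy
    exact (comapCLM i).contDiff.contDiffAt.comp y hy
  have hAs : SmoothNear 𝕜 r A 0 := by
    filter_upwards [hWi] with y hy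
    exact (hy.clm_apply contDiffAt_const).clm_comp contDiffAt_const
  have hSskew : ∀ y a b, S y a b = -S y b a := fun y a b => hskew _ _ _
  have hSc : ∀ᶠ y in 𝓝 0, IsClosedBilinAt S y := by
    filter_upwards [hit.eventually hc, hit.eventually hW] with y h1 h2
    exact IsClosedBilinAt.comap i h1 (h2.differentiableAt hn)
  have hdA : ∀ h h', fderiv 𝕜 A 0 h h' = fderiv 𝕜 W 0 (0, h) (1, 0) (0, h') := by
    intro h h'
    have h0 : HasFDerivAt W (fderiv 𝕜 W 0) (i 0) := by
      rw [map_zero]; exact (hW.self.differentiableAt hn).hasFDerivAt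
    have h1 : HasFDerivAt (fun y => W (i y)) _ 0 := h0.comp 0 i.hasFDerivAt
    have h2 : HasFDerivAt A _ 0 := (h1.clm_apply (hasFDerivAt_const _ 0)).clm_comp
      (hasFDerivAt_const i 0)
    rw [h2.fderiv]
    simp [hi]
  -- Closedness of `W` on `(∂_p, h₁, h₂)` turns the transversal derivative of `W` into `dA`.
  have hdA' : fderiv 𝕜 A 0 h₁ h₂ - fderiv 𝕜 A 0 h₂ h₁ =
      fderiv 𝕜 W 0 (1, 0) (0, h₁) (0, h₂) := by
    rw [hdA, hdA]
    have := hc.self_of_nhds (1, 0) (0, h₁) (0, h₂)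
    linear_combination -this
  have hN := SmoothNear.normalBilin hr hAs hSs
  have heq : ∀ᶠ z in 𝓝 (0 : 𝕜 × H), z.1 = 0 → normalBilin A S z = W z := by
    filter_upwards [tendsto_snd_zero.eventually hAs] with z hz h0
    refine ContinuousLinearMap.ext fun a => ContinuousLinearMap.ext fun b => ?_
    rw [normalBilin_apply S (hz.differentiableAt hn), h0]
    have hz : z = (0, z.2) := Prod.ext h0 rfl
    have ea : ∀ a : 𝕜 × H, a = a.1 • ((1 : 𝕜), (0 : H)) + i a.2 := fun a => by
      ext <;> simp [hi]
    have e0 : W z (1, 0) (1, 0) = 0 := self_eq_neg.1 (hskew _ _ _)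
    have e1 : W z a b = W z (a.1 • ((1 : 𝕜), (0 : H)) + i a.2)
        (b.1 • ((1 : 𝕜), (0 : H)) + i b.2) := by rw [← ea, ← ea]
    rw [e1]
    simp only [map_add, map_smul, add_apply, smul_apply, smul_eq_mul, e0]
    have e2 : A z.2 b.2 = W z (1, 0) (i b.2) := by
      simp only [hA, ContinuousLinearMap.comp_apply, hiy z.2, ← hz]
    have e3 : A z.2 a.2 = -W z (i a.2) (1, 0) := by
      rw [← hskew]
      simp only [hA, ContinuousLinearMap.comp_apply, hiy z.2, ← hz]
    have e4 : S z.2 a.2 b.2 = W z (i a.2) (i b.2) := by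
      simp only [hS, comapCLM_apply, hiy z.2, ← hz]
    rw [e2, e3, e4]
    ring
  have hN0 : normalBilin A S 0 = W 0 := heq.self_of_nhds rfl
  refine ⟨A, S, hAs, hSs, fun _ _ _ => rfl, fun _ _ => rfl, hdA' ▸ hd, hSc, ?_⟩
  have hηc : ∀ᶠ z in 𝓝 0, IsClosedBilinAt (fun z => W z - normalBilin A S z) z := by
    filter_upwards [hc, isClosedBilinAt_normalBilin hr hAs hSs hSc, hW, hN] with z h1 h2 h3 h4
    exact h1.sub h2 (h3.differentiableAt hn) (h4.differentiableAt hn)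
  have hηs : SmoothNear 𝕜 r (fun z => W z - normalBilin A S z) 0 := by
    filter_upwards [hW, hN] with z h1 h2
    exact h1.sub h2
  obtain ⟨β, hβ, hβ0, hβd⟩ := exists_relative_primitive hr hηs (fun z a b => by
      simp only [sub_apply]
      rw [hskew, normalBilin_skew A hSskew]; ring) hηc
    (ℓ := ContinuousLinearMap.fst 𝕜 𝕜 H) (e := ((1 : 𝕜), (0 : H))) rfl (by
      filter_upwards [heq] with z hz h0
      rw [hz h0, sub_self])
  refine germEquivalent_of_path hr hN hW (normalBilin_skew A hSskew) hskew
    (isClosedBilinAt_normalBilin hr hAs hSs hSc) hc (ℓ := ContinuousLinearMap.fst 𝕜 𝕜 H)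
    (e := ((1 : 𝕜), (0 : H))) rfl hβ hβd ?_
    (T := (fun s : ℝ => (s : 𝕜)) '' Set.Icc 0 1) ?_ ⟨0, by simp, by simp⟩ ⟨1, by simp, by simp⟩
    ?_ ?_
  · filter_upwards [hdeg, heq] with z h1 h2 h0 t
    rw [h2 h0, sub_self, smul_zero, add_zero]
    exact h1 h0
  · exact isPreconnected_Icc.image _ RCLike.continuous_ofReal.continuousOn
  · intro t _
    rw [hN0, sub_self, smul_zero, add_zero]
    refine ⟨(0, h₁), (0, h₂), hk₁, hk₂, hsp, ?_⟩
    rw [fderiv_normalBilin hr hAs hSs, hdA', sub_self, mul_zero, add_zero]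
    exact hd
  -- Here `β` vanishes on the whole hyperplane, in particular at the origin.
  · intro t v _
    rw [hβ0.self_of_nhds rfl]
    rfl

end NormalForm

/-! ### Dictionary between alternating maps and bilinear forms. -/

section FormConversion

variable {𝕜 : Type*} [RCLike 𝕜] {r : WithTop ℕ∞}
variable {E : Type*} [NormedAddCommGroup E] [NormedSpace 𝕜 E]
variable {F : Type*} [NormedAddCommGroup F] [NormedSpace 𝕜 F]

variable (𝕜 E) in
/-- Continuous 1-forms as continuous linear forms. -/
def clin : (E [⋀^Fin 1]→L[𝕜] 𝕜) ≃L[𝕜] (E →L[𝕜] 𝕜) :=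
  (ContinuousAlternatingMap.ofSubsingletonLIE (𝕜 := 𝕜) (E := E) (F := 𝕜) (0 : Fin 1)).symm.toContinuousLinearEquiv

theorem clin_apply (a : E [⋀^Fin 1]→L[𝕜] 𝕜) (x : E) : clin 𝕜 E a x = a ![x] := by
  change a (fun _ => x) = a ![x]
  congr 1; ext i; fin_cases i; rfl

theorem clin_symm_apply (A : E →L[𝕜] 𝕜) (x : E) : (clin 𝕜 E).symm A ![x] = A x := by
  rw [← clin_apply, ContinuousLinearEquiv.apply_symm_apply]

variable (𝕜 E) in
/-- Continuous 2-forms as continuous bilinear forms. -/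
def cbil : (E [⋀^Fin 2]→L[𝕜] 𝕜) →L[𝕜] (E →L[𝕜] E →L[𝕜] 𝕜) :=
  ((ContinuousLinearMap.compL 𝕜 E (E [⋀^Fin 1]→L[𝕜] 𝕜) (E →L[𝕜] 𝕜))
    (clin 𝕜 E : (E [⋀^Fin 1]→L[𝕜] 𝕜) →L[𝕜] (E →L[𝕜] 𝕜))).comp
      (ContinuousAlternatingMap.curryLeftLI (𝕜 := 𝕜) (E := E) (F := 𝕜)
        (n := 1)).toContinuousLinearMap

theorem cbil_apply (w : E [⋀^Fin 2]→L[𝕜] 𝕜) (a b : E) : cbil 𝕜 E w a b = w ![a, b] := by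
  change clin 𝕜 E (w.curryLeft a) b = _
  rw [clin_apply]
  rfl

theorem cbil_skew (w : E [⋀^Fin 2]→L[𝕜] 𝕜) (a b : E) : cbil 𝕜 E w a b = -cbil 𝕜 E w b a := by
  rw [cbil_apply, cbil_apply]
  exact form_two_swap w.toAlternatingMap a b

theorem cbil_injective : Function.Injective (cbil 𝕜 E) := by
  intro w w' h
  ext v
  have h1 : ∀ w : E [⋀^Fin 2]→L[𝕜] 𝕜, w v = cbil 𝕜 E w (v 0) (v 1) := fun w => by
    rw [cbil_apply]; exact form_two_apply w.toAlternatingMap v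
  rw [h1, h1, h]

/-- The injection `cbil` has a linear left inverse, continuous in finite dimension, so regularity
passes back from bilinear forms to alternating ones. -/
theorem smoothNear_cbil_iff [FiniteDimensional 𝕜 E] {w : F → E [⋀^Fin 2]→L[𝕜] 𝕜} {x : F} :
    SmoothNear 𝕜 r (fun y => cbil 𝕜 E (w y)) x ↔ SmoothNear 𝕜 r w x := by
  constructor
  · intro h
    obtain ⟨g, hg⟩ := LinearMap.exists_leftInverse_of_injective
      (cbil 𝕜 E : (E [⋀^Fin 2]→L[𝕜] 𝕜) →ₗ[𝕜] (E →L[𝕜] E →L[𝕜] 𝕜))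
      (LinearMap.ker_eq_bot.2 cbil_injective)
    have hw : w = fun y => LinearMap.toContinuousLinearMap g (cbil 𝕜 E (w y)) := by
      funext y
      exact (congrArg (fun L => L (w y)) hg).symm
    rw [hw]
    exact h.mono fun y hy => (LinearMap.toContinuousLinearMap g).contDiff.contDiffAt.comp y hy
  · exact fun h => h.mono fun y hy => (cbil 𝕜 E).contDiff.contDiffAt.comp y hy

theorem extDeriv_one_apply {α : E → E [⋀^Fin 1]→L[𝕜] 𝕜} {x : E} (h : DifferentiableAt 𝕜 α x)
    (a b : E) : extDeriv α x ![a, b] = bilinDeriv (fun y => clin 𝕜 E (α y)) x a b := by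
  have h1 : HasFDerivAt (fun y => clin 𝕜 E (α y))
      ((clin 𝕜 E : (E [⋀^Fin 1]→L[𝕜] 𝕜) →L[𝕜] (E →L[𝕜] 𝕜)).comp (fderiv 𝕜 α x)) x :=
    (clin 𝕜 E : (E [⋀^Fin 1]→L[𝕜] 𝕜) →L[𝕜] (E →L[𝕜] 𝕜)).hasFDerivAt.comp x h.hasFDerivAt
  have h2 : ∀ a b, fderiv 𝕜 (fun y => clin 𝕜 E (α y)) x a b = fderiv 𝕜 α x a ![b] := fun a b => by
    rw [h1.fderiv]
    exact clin_apply _ _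
  rw [bilinDeriv_apply, h2, h2, extDeriv_apply h, Fin.sum_univ_two]
  have e0 : Fin.removeNth (0 : Fin 2) ![a, b] = ![b] := by ext i; fin_cases i; rfl
  have e1 : Fin.removeNth (1 : Fin 2) ![a, b] = ![a] := by ext i; fin_cases i; rfl
  rw [e0, e1]
  simp [sub_eq_add_neg, fderiv_continuousAlternatingMap_apply_const_apply h]

theorem extDeriv_two_apply {w : E → E [⋀^Fin 2]→L[𝕜] 𝕜} {x : E} (h : DifferentiableAt 𝕜 w x)
    (a b c : E) : extDeriv w x ![a, b, c] = fderiv 𝕜 (fun y => cbil 𝕜 E (w y)) x a b c -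
      fderiv 𝕜 (fun y => cbil 𝕜 E (w y)) x b a c + fderiv 𝕜 (fun y => cbil 𝕜 E (w y)) x c a b := by
  have h1 : HasFDerivAt (fun y => cbil 𝕜 E (w y)) ((cbil 𝕜 E).comp (fderiv 𝕜 w x)) x :=
    (cbil 𝕜 E).hasFDerivAt.comp x h.hasFDerivAt
  have h2 : ∀ a b c, fderiv 𝕜 (fun y => cbil 𝕜 E (w y)) x a b c = fderiv 𝕜 w x a ![b, c] :=
    fun a b c => by
      rw [h1.fderiv]
      exact cbil_apply _ _ _
  rw [h2, h2, h2, extDeriv_apply h, Fin.sum_univ_three]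
  have e0 : Fin.removeNth (0 : Fin 3) ![a, b, c] = ![b, c] := by ext i; fin_cases i <;> rfl
  have e1 : Fin.removeNth (1 : Fin 3) ![a, b, c] = ![a, c] := by ext i; fin_cases i <;> rfl
  have e2 : Fin.removeNth (2 : Fin 3) ![a, b, c] = ![a, b] := by ext i; fin_cases i <;> rfl
  rw [e0, e1, e2]
  simp [sub_eq_add_neg, fderiv_continuousAlternatingMap_apply_const_apply h]

theorem isClosedBilinAt_cbil_iff {w : E → E [⋀^Fin 2]→L[𝕜] 𝕜} {x : E}
    (h : DifferentiableAt 𝕜 w x) :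
    IsClosedBilinAt (fun y => cbil 𝕜 E (w y)) x ↔ extDeriv w x = 0 := by
  constructor
  · intro hc
    ext v
    have hv : v = ![v 0, v 1, v 2] := by ext i; fin_cases i <;> rfl
    rw [hv, extDeriv_two_apply h]
    exact hc _ _ _
  · intro hw a b c
    rw [← extDeriv_two_apply h, hw]
    rfl

theorem IsClosedBilinAt.congr {A B : E → E →L[𝕜] E →L[𝕜] 𝕜} {x : E} (hA : IsClosedBilinAt A x)
    (h : B =ᶠ[𝓝 x] A) : IsClosedBilinAt B x := by
  intro a b c
  rw [h.fderiv_eq]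
  exact hA a b c

theorem cbil_pullback (Φ : E → F) (w : F → F [⋀^Fin 2]→L[𝕜] 𝕜) (x : E) :
    cbil 𝕜 E (pullback Φ w x) = comapCLM (fderiv 𝕜 Φ x) (cbil 𝕜 F (w (Φ x))) := by
  refine ContinuousLinearMap.ext fun a => ContinuousLinearMap.ext fun b => ?_
  rw [comapCLM_apply, cbil_apply, cbil_apply]
  exact form_two_apply ((w (Φ x)).toAlternatingMap.compLinearMap
    (fderiv 𝕜 Φ x : E →ₗ[𝕜] F)) ![a, b] |>.trans (by
      rw [AlternatingMap.compLinearMap_apply, form_two_apply]; rfl)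

theorem contDiffAt_comapCLM {Z : Type*} [NormedAddCommGroup Z] [NormedSpace 𝕜 Z]
    {L : Z → E →L[𝕜] F} {B : Z → F →L[𝕜] F →L[𝕜] 𝕜} {z : Z} (hL : ContDiffAt 𝕜 r L z)
    (hB : ContDiffAt 𝕜 r B z) : ContDiffAt 𝕜 r (fun z => comapCLM (L z) (B z)) z := by
  have h1 : ContDiffAt 𝕜 r (fun z => (ContinuousLinearMap.compL 𝕜 E F 𝕜).flip (L z)) z :=
    (ContinuousLinearMap.compL 𝕜 E F 𝕜).flip.contDiff.contDiffAt.comp z hL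
  exact h1.clm_comp (hB.clm_comp hL)

theorem SmoothNear.pullback [FiniteDimensional 𝕜 E]
    (hr : r = ((⊤ : ℕ∞) : WithTop ℕ∞) ∨ r = ⊤) {Φ : E → F} {w : F → F [⋀^Fin 2]→L[𝕜] 𝕜} {x : E}
    (hΦ : SmoothNear 𝕜 r Φ x) (hw : SmoothNear 𝕜 r w (Φ x)) :
    SmoothNear 𝕜 r (pullback Φ w) x := by
  refine smoothNear_cbil_iff.1 ?_
  simp only [cbil_pullback]
  filter_upwards [hΦ, hΦ.fderiv hr, hΦ.continuousAt.eventually hw] with y h1 h2 h3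
  exact contDiffAt_comapCLM h2 ((cbil 𝕜 F).contDiff.contDiffAt.comp y (h3.comp y h1))

theorem extDeriv_pullback_eq_zero (hr : r = ((⊤ : ℕ∞) : WithTop ℕ∞) ∨ r = ⊤) {k : ℕ} {Φ : E → F}
    {w : F → F [⋀^Fin k]→L[𝕜] 𝕜} {x : E} (hΦ : ContDiffAt 𝕜 r Φ x) (hw : ContDiffAt 𝕜 r w (Φ x))
    (h0 : extDeriv w (Φ x) = 0) : extDeriv (SingularSymplectic.pullback Φ w) x = 0 := by
  have hmin : minSmoothness 𝕜 2 ≤ r := by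
    rcases hr with rfl | rfl
    · rw [minSmoothness_of_isRCLikeNormedField]; exact WithTop.coe_le_coe.2 le_top
    · exact le_top
  have h := extDeriv_pullback (ω := w) (f := Φ) (x := x)
    (hw.differentiableAt (ne_zero_of_infty_or_top hr)) hΦ hmin
  refine Eq.trans h ?_
  rw [h0]
  ext; rfl

theorem cbil_normalForm {n : ℕ} {α : Hyp 𝕜 n → Hyp 𝕜 n [⋀^Fin 1]→L[𝕜] 𝕜}
    (σ : Hyp 𝕜 n → Hyp 𝕜 n [⋀^Fin 2]→L[𝕜] 𝕜) {z : Amb 𝕜 n} (hα : DifferentiableAt 𝕜 α z.2) :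
    cbil 𝕜 _ (normalForm α σ z) =
      normalBilin (fun y => clin 𝕜 _ (α y)) (fun y => cbil 𝕜 _ (σ y)) z := by
  have hproj : ∀ z, fderiv 𝕜 (proj : Amb 𝕜 n → Hyp 𝕜 n) z = ContinuousLinearMap.snd 𝕜 𝕜 _ :=
    fun z => (ContinuousLinearMap.snd 𝕜 𝕜 (Hyp 𝕜 n)).fderiv
  have h1 : (fun z : Amb 𝕜 n => clin 𝕜 _ (z.1 • pullback (proj : Amb 𝕜 n → Hyp 𝕜 n) α z)) =
      fun z => ContinuousLinearMap.fst 𝕜 𝕜 _ z • liftForm (fun y => clin 𝕜 _ (α y)) z := by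
    funext z
    refine ContinuousLinearMap.ext fun a => ?_
    rw [map_smul, smul_apply, smul_apply, liftForm_apply, clin_apply, clin_apply]
    congr 1
    have h5 : pullback (proj : Amb 𝕜 n → Hyp 𝕜 n) α z ![a] =
        α z.2 (fun i => fderiv 𝕜 (proj : Amb 𝕜 n → Hyp 𝕜 n) z (![a] i)) := rfl
    rw [h5, hproj]
    exact form_one_apply (α z.2).toAlternatingMap _
  have hd : DifferentiableAt 𝕜 (fun z : Amb 𝕜 n => z.1 • pullback (proj : Amb 𝕜 n → Hyp 𝕜 n) α z)
      z := by
    have h2 : DifferentiableAt 𝕜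
        (fun z : Amb 𝕜 n => clin 𝕜 _ (z.1 • pullback (proj : Amb 𝕜 n → Hyp 𝕜 n) α z)) z := by
      rw [h1]
      have h3 : DifferentiableAt 𝕜 (fun z : Amb 𝕜 n => clin 𝕜 _ (α z.2)) z :=
        ((clin 𝕜 (Hyp 𝕜 n)).differentiableAt).comp z (hα.comp z differentiableAt_snd)
      exact (ContinuousLinearMap.fst 𝕜 𝕜 (Hyp 𝕜 n)).differentiableAt.smul
        (h3.clm_comp (differentiableAt_const _))
    exact (clin 𝕜 (Amb 𝕜 n)).comp_differentiableAt_iff.1 h2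
  rw [normalForm, map_add, normalBilin, cbil_pullback, hproj]
  congr 1
  refine ContinuousLinearMap.ext fun a => ContinuousLinearMap.ext fun b => ?_
  rw [cbil_apply, extDeriv_one_apply hd, h1]

end FormConversion

/-! ### Radicals of 2-forms on 𝕜 × H. -/

section BorderedForms

variable {𝕜 : Type*} [RCLike 𝕜]

theorem linearIndependent_append_swap {V : Type*} [AddCommGroup V] [Module 𝕜 V] {k l : ℕ}
    {h : Fin k → V} {u : Fin l → V} (hu : LinearIndependent 𝕜 (Fin.append h u)) :
    LinearIndependent 𝕜 (Fin.append u h) := by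
  have e : Fin.append u h = Fin.append h u ∘ finAddFlip := by
    funext i
    refine Fin.addCases (fun i => ?_) (fun i => ?_) i <;> simp
  rw [e]
  exact hu.comp _ finAddFlip.injective

/-- The first-order nondegeneracy of a family of 2-forms at a degenerate form. -/
theorem exists_radical_basis_of_wedge_ne_zero {V : Type*} [AddCommGroup V] [Module 𝕜 V]
    [FiniteDimensional 𝕜 V] {m : ℕ} (hV : Module.finrank 𝕜 V = 2 * m + 2)
    {b c : V [⋀^Fin 2]→ₗ[𝕜] 𝕜} (hb : ∃ x, x ≠ 0 ∧ ∀ y, b ![x, y] = 0)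
    (hc : wedge (wedgePow b m) c ≠ 0) :
    ∃ k₁ k₂, (∀ y, b ![k₁, y] = 0) ∧ (∀ y, b ![k₂, y] = 0) ∧
      (∀ x, (∀ y, b ![x, y] = 0) → ∃ s t : 𝕜, x = s • k₁ + t • k₂) ∧ c ![k₁, k₂] ≠ 0 := by
  obtain ⟨u, hu⟩ : ∃ u, wedgePow b m u ≠ 0 := by
    by_contra! hcon
    refine hc ?_
    have : wedgePow b m = 0 := by ext v; exact hcon v
    rw [this, zero_wedge]
  obtain ⟨k₁, k₂, hli, h₁, h₂, hsp⟩ := exists_radical_basis hV hu hb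
  refine ⟨k₁, k₂, h₁, h₂, hsp, fun h0 => ?_⟩
  have hk : ∀ i y, b ![(![k₁, k₂] : Fin 2 → V) i, y] = 0 := by
    intro i; fin_cases i
    · exact h₁
    · exact h₂
  have hlin := linearIndependent_append_swap (linearIndependent_append hu hli
    (fun i => by ext j; exact hk i _))
  refine apply_ne_zero_of_linearIndependent hV hc hlin ?_
  rw [wedge_apply_of_left_killed]
  · simp only [Fin.append_left, Fin.append_right]
    rw [h0, mul_zero]
  · intro j v hv
    rw [Fin.append_right] at hv
    exact wedgePow_apply_of_mem_radical (hk j) v hv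

variable {H : Type*} [AddCommGroup H] [Module 𝕜 H]

/-- A radical vector transversal to the hyperplane would, together with it, span everything; the
kernel of the restricted form would then lie in the radical of `b`. The rank bound makes that kernel
at least 3-dimensional, while the radical is spanned by two vectors. -/
theorem fst_eq_zero_of_mem_radical [FiniteDimensional 𝕜 H] {m : ℕ}
    (hH : Module.finrank 𝕜 H = 2 * m + 3) {b : (𝕜 × H) [⋀^Fin 2]→ₗ[𝕜] 𝕜}
    (hr : formRank (b.compLinearMap (LinearMap.inr 𝕜 𝕜 H)) ≤ 2 * m) {k₁ k₂ : 𝕜 × H}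
    (hsp : ∀ x, (∀ y, b ![x, y] = 0) → ∃ s t : 𝕜, x = s • k₁ + t • k₂) {k : 𝕜 × H}
    (hk : ∀ y, b ![k, y] = 0) : k.1 = 0 := by
  by_contra hne
  set N := LinearMap.ker (bilOf (b.compLinearMap (LinearMap.inr 𝕜 𝕜 H))) with hN
  have hN3 : 3 ≤ Module.finrank 𝕜 N := by
    have h := formRank_add_finrank_ker (b.compLinearMap (LinearMap.inr 𝕜 𝕜 H))
    rw [← hN] at h
    omega
  have hmap : N.map (LinearMap.inr 𝕜 𝕜 H) ≤ Submodule.span 𝕜 (Set.range ![k₁, k₂]) := by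
    rintro _ ⟨y, hy, rfl⟩
    obtain ⟨s, t, hst⟩ := hsp (LinearMap.inr 𝕜 𝕜 H y) fun z => by
      have e : z = (z.1 * k.1⁻¹) • k + LinearMap.inr 𝕜 𝕜 H (z.2 - (z.1 * k.1⁻¹) • k.2) := by
        ext
        · simp [mul_assoc, inv_mul_cancel₀ hne]
        · simp
      have e1 : bilOf b (LinearMap.inr 𝕜 𝕜 H y) k = 0 := by
        rw [bilOf_swap, bilOf_apply, hk, neg_zero]
      have e2 : bilOf b (LinearMap.inr 𝕜 𝕜 H y)
          (LinearMap.inr 𝕜 𝕜 H (z.2 - (z.1 * k.1⁻¹) • k.2)) = 0 := by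
        have h3 := mem_ker_bilOf.1 hy (z.2 - (z.1 * k.1⁻¹) • k.2)
        rw [AlternatingMap.compLinearMap_apply, form_two_apply] at h3
        exact h3
      rw [← bilOf_apply, e, map_add, map_smul, e1, e2, smul_zero, add_zero]
    rw [hst]
    exact add_mem (Submodule.smul_mem _ _ (Submodule.subset_span ⟨0, rfl⟩))
      (Submodule.smul_mem _ _ (Submodule.subset_span ⟨1, rfl⟩))
  have h2 := (Submodule.finrank_mono hmap).trans (finrank_range_le_card ![k₁, k₂])
  rw [(Submodule.equivMapOfInjective _ LinearMap.inr_injective N).finrank_eq.symm,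
    Fintype.card_fin] at h2
  omega

/-- A bordered 2-form is degenerate if and only if its border and its core have a common kernel. -/
theorem bordered_degenerate_iff [FiniteDimensional 𝕜 H] {m : ℕ}
    (hH : Module.finrank 𝕜 H = 1 + 2 * m) {a : H [⋀^Fin 1]→ₗ[𝕜] 𝕜} {b : H [⋀^Fin 2]→ₗ[𝕜] 𝕜}
    {B : 𝕜 × H → 𝕜 × H → 𝕜}
    (hB : ∀ x y, B x y = x.1 * a ![y.2] - y.1 * a ![x.2] + b ![x.2, y.2]) :
    (∃ v, v ≠ 0 ∧ ∀ y, B v y = 0) ↔ ∃ x, x ≠ 0 ∧ a ![x] = 0 ∧ ∀ y, b ![x, y] = 0 := by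
  have ha0 : a ![0] = 0 := map_zero (linOf a)
  have hb0 : ∀ x, b ![x, 0] = 0 := fun x => map_zero (bilOf b x)
  have hb0' : ∀ x, b ![0, x] = 0 := fun x => by
    rw [← bilOf_apply, map_zero]; rfl
  constructor
  · rintro ⟨v, hv, hvB⟩
    have h1 : a ![v.2] = 0 := by
      have := hvB (1, 0)
      rw [hB] at this
      simpa [ha0, hb0] using this
    have h2 : ∀ y, v.1 * a ![y] + b ![v.2, y] = 0 := fun y => by
      have := hvB (0, y)
      rw [hB] at this
      simpa using this
    by_cases hv1 : v.1 = 0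
    · refine ⟨v.2, fun h => hv (Prod.ext hv1 h), h1, fun y => ?_⟩
      have := h2 y
      rwa [hv1, zero_mul, zero_add] at this
    · obtain ⟨z, hz, hzb⟩ := exists_radical_of_odd (m := m) (by omega) b
      refine ⟨z, hz, ?_, hzb⟩
      have h3 := h2 z
      rw [form_two_swap, hzb, neg_zero, add_zero] at h3
      exact (mul_eq_zero.1 h3).resolve_left hv1
  · rintro ⟨x, hx, hax, hbx⟩
    refine ⟨(0, x), fun h => hx (congrArg Prod.snd h), fun y => ?_⟩
    rw [hB]
    simp [hax, hbx]

end BorderedForms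

/-! ### First-order information from a structurally smooth Martinet hypersurface. -/

section Martinet

variable {𝕜 : Type*} [RCLike 𝕜]

theorem hasDerivAt_mul_of_continuousAt {g : 𝕜 → 𝕜} (hg : ContinuousAt g 0) :
    HasDerivAt (fun s => s * g s) (g 0) 0 := by
  rw [hasDerivAt_iff_tendsto_slope_zero]
  refine (hg.tendsto.mono_left nhdsWithin_le_nhds).congr' ?_
  filter_upwards [self_mem_nhdsWithin] with t ht
  have ht' : t ≠ 0 := ht
  simp [ht']

/-- Differentiating `w^{k+1} = ℓ Ω` at 0 along `e` gives `(k+1) w^k ∧ w' = Ω(0) ≠ 0`; the rest is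
linear algebra. Along the line the right side is `s` times a continuous function, so continuity of
`Ω` is all that the differentiation requires. -/
theorem exists_radical_basis_of_martinet {E : Type*} [NormedAddCommGroup E] [NormedSpace 𝕜 E]
    [FiniteDimensional 𝕜 E] {k : ℕ} (hE : Module.finrank 𝕜 E = 2 * k + 2)
    {w : E → E [⋀^Fin 2]→L[𝕜] 𝕜} (hw : DifferentiableAt 𝕜 w 0) {ℓ : E →L[𝕜] 𝕜} {e : E}
    (he : ℓ e = 1) {Ω : E → E [⋀^Fin (2 * (k + 1))]→ₗ[𝕜] 𝕜}
    (hΩ : ∀ v, ContinuousAt (fun x => Ω x v) 0) (hΩ0 : Ω 0 ≠ 0)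
    (hpow : ∀ᶠ x in 𝓝 0, powAt w (k + 1) x = ℓ x • Ω x) :
    ∃ k₁ k₂, (∀ y, w 0 ![k₁, y] = 0) ∧ (∀ y, w 0 ![k₂, y] = 0) ∧
      (∀ x, (∀ y, w 0 ![x, y] = 0) → ∃ s t : 𝕜, x = s • k₁ + t • k₂) ∧
      fderiv 𝕜 w 0 e ![k₁, k₂] ≠ 0 := by
  have h0 : wedgePow (w 0).toAlternatingMap (k + 1) = 0 := by
    have := hpow.self_of_nhds
    rwa [map_zero, zero_smul] at this
  refine exists_radical_basis_of_wedge_ne_zero (m := k) hE (b := (w 0).toAlternatingMap)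
    (c := (fderiv 𝕜 w 0 e).toAlternatingMap)
    (exists_degenerate_of_wedgePow_eq_zero (m := k + 1) (by omega) h0) fun hzero => hΩ0 ?_
  have hline : HasDerivAt (fun s : 𝕜 => s • e) e 0 := by
    simpa using (hasDerivAt_id (0 : 𝕜)).smul_const e
  have hcont : ContinuousAt (fun s : 𝕜 => s • e) 0 := hline.continuousAt
  have hw0 : HasFDerivAt w (fderiv 𝕜 w 0) ((0 : 𝕜) • e) := by
    rw [zero_smul]; exact hw.hasFDerivAt
  have hder : ∀ v, HasDerivAt (fun s : 𝕜 => (w (s • e)).toAlternatingMap v)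
      ((fderiv 𝕜 w 0 e).toAlternatingMap v) 0 := fun v => by
    have h1 := hw0.comp_hasDerivAt (0 : 𝕜) hline
    exact ((ContinuousAlternatingMap.apply 𝕜 E 𝕜 v).hasFDerivAt.comp_hasDerivAt (0 : 𝕜) h1)
  ext v
  have h1 := hasDerivAt_wedgePow_succ hder k v
  have e0 : w ((0 : 𝕜) • e) = w 0 := by rw [zero_smul]
  rw [e0, hzero, AlternatingMap.zero_apply, mul_zero] at h1
  have h2 : HasDerivAt (fun s : 𝕜 => s * Ω (s • e) v) (Ω ((0 : 𝕜) • e) v) 0 := by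
    refine hasDerivAt_mul_of_continuousAt (ContinuousAt.comp (f := fun s : 𝕜 => s • e)
      (g := fun x => Ω x v) ?_ hcont)
    rw [zero_smul]
    exact hΩ v
  have hcont' : Tendsto (fun s : 𝕜 => s • e) (𝓝 0) (𝓝 0) := by
    have := hcont.tendsto; rwa [zero_smul] at this
  have h3 := h1.unique (h2.congr_of_eventuallyEq (by
    filter_upwards [hcont'.eventually hpow] with s hs
    have h4 := congrArg (fun a => a v) hs
    simp only [AlternatingMap.smul_apply, map_smul, he, smul_eq_mul, mul_one] at h4
    exact h4))
  rw [zero_smul] at h3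
  exact h3.symm

end Martinet

/-! ### Straightening a smooth hypersurface-germ. -/

section Straightening

variable {𝕜 : Type u} [RCLike 𝕜] {r : WithTop ℕ∞}
variable {H : Type u} [NormedAddCommGroup H] [NormedSpace 𝕜 H] [FiniteDimensional 𝕜 H]

theorem exists_equiv_fst_eq {D : 𝕜 × H →L[𝕜] 𝕜} (hD : D ≠ 0) :
    ∃ L : (𝕜 × H) ≃L[𝕜] (𝕜 × H), ∀ x, (L x).1 = D x := by
  obtain ⟨e, he⟩ : ∃ e, D e = 1 := by
    obtain ⟨x, hx⟩ : ∃ x, D x ≠ 0 := by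
      by_contra! h
      exact hD (ContinuousLinearMap.ext h)
    exact ⟨(D x)⁻¹ • x, by rw [map_smul, smul_eq_mul, inv_mul_cancel₀ hx]⟩
  set K := LinearMap.ker (D : 𝕜 × H →ₗ[𝕜] 𝕜) with hK
  have hKr : Module.finrank 𝕜 K = Module.finrank 𝕜 H := by
    have h1 := LinearMap.finrank_range_add_finrank_ker (D : 𝕜 × H →ₗ[𝕜] 𝕜)
    have h2 : LinearMap.range (D : 𝕜 × H →ₗ[𝕜] 𝕜) = ⊤ := by
      rw [LinearMap.range_eq_top]
      exact fun t => ⟨t • e, by simp [he]⟩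
    rw [h2, finrank_top, Module.finrank_self, Module.finrank_prod, Module.finrank_self, ← hK] at h1
    omega
  let g : K ≃ₗ[𝕜] H := LinearEquiv.ofFinrankEq _ _ hKr
  let P : 𝕜 × H →ₗ[𝕜] K :=
    (LinearMap.id - (D : 𝕜 × H →ₗ[𝕜] 𝕜).smulRight e).codRestrict K fun x => by
      rw [hK, LinearMap.mem_ker]; simp [he]
  let L₀ : 𝕜 × H →ₗ[𝕜] 𝕜 × H := (D : 𝕜 × H →ₗ[𝕜] 𝕜).prod (g.toLinearMap.comp P)
  have hinj : Function.Injective L₀ := by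
    rw [← LinearMap.ker_eq_bot, LinearMap.ker_eq_bot']
    intro x hx
    have h1 : D x = 0 := congrArg Prod.fst hx
    have h2 : g (P x) = 0 := congrArg Prod.snd hx
    have h3 : P x = 0 := g.map_eq_zero_iff.1 h2
    have h4 : x - D x • e = 0 := congrArg Subtype.val h3
    rwa [h1, zero_smul, sub_zero] at h4
  exact ⟨(LinearEquiv.ofInjectiveEndo L₀ hinj).toContinuousLinearEquiv, fun x => rfl⟩

theorem exists_straightening (hr : r = ((⊤ : ℕ∞) : WithTop ℕ∞) ∨ r = ⊤) {f : 𝕜 × H → 𝕜}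
    (hf : SmoothNear 𝕜 r f 0) (hf0 : f 0 = 0) (hdf : fderiv 𝕜 f 0 ≠ 0) :
    ∃ Φ : 𝕜 × H → 𝕜 × H, IsDiffeoGerm 𝕜 r Φ ∧ ∀ᶠ x in 𝓝 0, f (Φ x) = x.1 := by
  have _ : CompleteSpace H := FiniteDimensional.complete 𝕜 H
  have hn := ne_zero_of_infty_or_top hr
  obtain ⟨L, hL⟩ := exists_equiv_fst_eq hdf
  set F : 𝕜 × H → 𝕜 × H := fun x => (f x, (L x).2) with hF
  have hFs : SmoothNear 𝕜 r F 0 := by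
    filter_upwards [hf] with x hx
    exact hx.prodMk (L.contDiff.contDiffAt.snd)
  have hF' : HasFDerivAt F (L : 𝕜 × H →L[𝕜] 𝕜 × H) 0 := by
    have h1 : HasFDerivAt F ((fderiv 𝕜 f 0).prod ((ContinuousLinearMap.snd 𝕜 𝕜 H).comp
        (L : 𝕜 × H →L[𝕜] 𝕜 × H))) 0 :=
      (hf.self.differentiableAt hn).hasFDerivAt.prodMk
        ((ContinuousLinearMap.snd 𝕜 𝕜 H).comp (L : 𝕜 × H →L[𝕜] 𝕜 × H)).hasFDerivAt
    convert h1 using 1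
    refine ContinuousLinearMap.ext fun x => Prod.ext (hL x) rfl
  obtain ⟨h1, h2, Φ, h3, h4, h5, h6⟩ :=
    isDiffeoGerm_of_fderiv hr hFs (by simp [hF, hf0]) L hF'
  exact ⟨Φ, ⟨h3, h4, F, h1, h2, h6, h5⟩, h6.mono fun x hx => congrArg Prod.fst hx⟩

end Straightening

/-! ### Reduction when the Martinet hypersurface is {p₁ = 0}. -/

section Reduction

variable {𝕜 : Type u} [RCLike 𝕜] {r : WithTop ℕ∞} {n : ℕ}

theorem finrank_hyp : Module.finrank 𝕜 (Hyp 𝕜 n) = 2 * n - 1 := by simp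

theorem finrank_amb (hn : 2 ≤ n) : Module.finrank 𝕜 (Amb 𝕜 n) = 2 * n := by
  simp only [Module.finrank_prod, Module.finrank_self, Module.finrank_fin_fun]
  omega

set_option maxHeartbeats 2000000 in
/-- The normal form of a closed 2-form-germ whose Martinet hypersurface is `{p₁ = 0}`. -/
theorem exists_normalForm (hr : r = ((⊤ : ℕ∞) : WithTop ℕ∞) ∨ r = ⊤) (hn : 2 ≤ n)
    {w : Amb 𝕜 n → Amb 𝕜 n [⋀^Fin 2]→L[𝕜] 𝕜} (hw : IsClosedTwoFormGerm r w)
    {Ω : Amb 𝕜 n → Amb 𝕜 n [⋀^Fin (2 * n)]→ₗ[𝕜] 𝕜} (hΩ : ∀ v, ContinuousAt (fun x => Ω x v) 0)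
    (hΩ0 : Ω 0 ≠ 0) (hpow : ∀ᶠ x in 𝓝 0, powAt w n x = x.1 • Ω x)
    (hrank : formRank ((w 0).toAlternatingMap.compLinearMap (LinearMap.inr 𝕜 𝕜 (Hyp 𝕜 n))) ≤
      2 * n - 4) :
    ∃ (Φ : Amb 𝕜 n → Amb 𝕜 n) (α : Hyp 𝕜 n → Hyp 𝕜 n [⋀^Fin 1]→L[𝕜] 𝕜), IsDiffeoGerm 𝕜 r Φ ∧
      ∀ w', w' =ᶠ[𝓝 0] pullback Φ w → IsAdmissible r α (pullback incl w') ∧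
        w' =ᶠ[𝓝 0] normalForm α (pullback incl w') := by
  have hr0 := ne_zero_of_infty_or_top hr
  have hws : SmoothNear 𝕜 r w 0 := hw.1
  set W : Amb 𝕜 n → Amb 𝕜 n →L[𝕜] Amb 𝕜 n →L[𝕜] 𝕜 := fun x => cbil 𝕜 _ (w x) with hW
  have hWs : SmoothNear 𝕜 r W 0 := smoothNear_cbil_iff.2 hws
  have hWa : ∀ x a b, W x a b = w x ![a, b] := fun x a b => cbil_apply _ _ _
  have hWskew : ∀ x a b, W x a b = -W x b a := fun x a b => cbil_skew _ _ _
  have hWc : ∀ᶠ x in 𝓝 0, IsClosedBilinAt W x := by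
    filter_upwards [hws, hw.2] with x h1 h2
    exact (isClosedBilinAt_cbil_iff (h1.differentiableAt hr0)).2 h2
  have hdeg : ∀ᶠ x in 𝓝 0, x.1 = 0 → ∃ v, v ≠ 0 ∧ W x v = 0 := by
    filter_upwards [hpow] with x hx h0
    rw [h0, zero_smul] at hx
    obtain ⟨v, hv, hvx⟩ := exists_degenerate_of_wedgePow_eq_zero (finrank_amb hn) hx
    exact ⟨v, hv, ContinuousLinearMap.ext fun y => (hWa _ _ _).trans (hvx y)⟩
  obtain ⟨k₁, k₂, hk₁, hk₂, hsp, hd⟩ : ∃ k₁ k₂, (∀ y, w 0 ![k₁, y] = 0) ∧ (∀ y, w 0 ![k₂, y] = 0) ∧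
      (∀ x, (∀ y, w 0 ![x, y] = 0) → ∃ s t : 𝕜, x = s • k₁ + t • k₂) ∧
      fderiv 𝕜 w 0 (1, 0) ![k₁, k₂] ≠ 0 := by
    -- With `n = m + 2` the degree `2 * n` has the shape `2 * (k + 1)`, `k = m + 1`, expected by the
    -- Martinet lemma.
    obtain ⟨m, rfl⟩ : ∃ m, n = m + 2 := ⟨n - 2, by omega⟩
    exact exists_radical_basis_of_martinet (k := m + 1) (by rw [finrank_amb hn]; omega)
      (hws.self.differentiableAt hr0) (ℓ := ContinuousLinearMap.fst 𝕜 𝕜 (Hyp 𝕜 (m + 2)))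
      (e := ((1 : 𝕜), (0 : Hyp 𝕜 (m + 2)))) rfl hΩ hΩ0 hpow
  have hH : Module.finrank 𝕜 (Hyp 𝕜 n) = 2 * n - 1 := finrank_hyp
  have hfst : ∀ k, (∀ y, w 0 ![k, y] = 0) → k.1 = 0 := fun k hk =>
    fst_eq_zero_of_mem_radical (m := n - 2) (by rw [hH]; omega) (hrank.trans (by omega)) hsp hk
  have ek : ∀ k, (∀ y, w 0 ![k, y] = 0) → ((0 : 𝕜), k.2) = k := fun k hk =>
    Prod.ext (hfst k hk).symm rfl
  have hWk : ∀ k, (∀ y, w 0 ![k, y] = 0) → W 0 ((0 : 𝕜), k.2) = 0 := fun k hk => by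
    rw [ek k hk]
    exact ContinuousLinearMap.ext fun y => (hWa _ _ _).trans (hk y)
  have hWsp : ∀ v, W 0 v = 0 → ∃ a b : 𝕜, v = a • ((0 : 𝕜), k₁.2) + b • ((0 : 𝕜), k₂.2) := by
    intro v hv
    rw [ek k₁ hk₁, ek k₂ hk₂]
    exact hsp v fun y => by rw [← hWa, hv]; rfl
  have hWd : fderiv 𝕜 W 0 (1, 0) (0, k₁.2) (0, k₂.2) ≠ 0 := by
    have h1 : HasFDerivAt W ((cbil 𝕜 _).comp (fderiv 𝕜 w 0)) 0 :=
      (cbil 𝕜 _).hasFDerivAt.comp 0 (hws.self.differentiableAt hr0).hasFDerivAt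
    rw [h1.fderiv, ek k₁ hk₁, ek k₂ hk₂]
    exact fun h => hd ((cbil_apply _ _ _).symm.trans h)
  obtain ⟨A, S, hAs, hSs, hS, hA, hdA, hSc, Φ, hΦ, hΦW⟩ :=
    germEquivalent_normalBilin hr hWs hWskew hWc hdeg (hWk k₁ hk₁) (hWk k₂ hk₂) hWsp hWd
  set α : Hyp 𝕜 n → Hyp 𝕜 n [⋀^Fin 1]→L[𝕜] 𝕜 := fun y => (clin 𝕜 _).symm (A y) with hα
  have hαs : SmoothNear 𝕜 r α 0 := hAs.mono fun y hy =>
    (clin 𝕜 (Hyp 𝕜 n)).symm.contDiff.contDiffAt.comp y hy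
  have hαA : (fun y => clin 𝕜 _ (α y)) = A := by
    funext y; exact ContinuousLinearEquiv.apply_symm_apply _ _
  have hαa : ∀ y a, α y ![a] = A y a := fun y a => clin_symm_apply _ _
  -- Any representative `w'` of the germ is allowed, since a further pull-back is only eventually
  -- equal to the pull-back along a composition.
  refine ⟨Φ, α, hΦ, fun w' hw' => ?_⟩
  set σ : Hyp 𝕜 n → Hyp 𝕜 n [⋀^Fin 2]→L[𝕜] 𝕜 := pullback incl w' with hσ
  have hw'N : ∀ᶠ x in 𝓝 0, cbil 𝕜 _ (w' x) = normalBilin A S x := by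
    filter_upwards [hw', hΦW] with x h1 h2
    rw [h1, cbil_pullback]
    exact ContinuousLinearMap.ext fun a => ContinuousLinearMap.ext fun b => h2 a b
  have hincl : ∀ y, fderiv 𝕜 (incl : Hyp 𝕜 n → Amb 𝕜 n) y = ContinuousLinearMap.inr 𝕜 𝕜 _ :=
    fun y => (ContinuousLinearMap.inr 𝕜 𝕜 (Hyp 𝕜 n)).fderiv
  have hσS : ∀ᶠ y in 𝓝 0, cbil 𝕜 _ (σ y) = S y := by
    filter_upwards [tendsto_inr_zero.eventually hw'N, hAs] with y h1 h2
    rw [hσ, cbil_pullback, hincl]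
    refine ContinuousLinearMap.ext fun a => ContinuousLinearMap.ext fun b => ?_
    rw [comapCLM_apply]
    change cbil 𝕜 _ (w' ((0 : 𝕜), y)) _ _ = _
    rw [h1, normalBilin_apply S (h2.differentiableAt hr0)]
    simp
  have hσa : ∀ᶠ y in 𝓝 0, ∀ a b, σ y ![a, b] = w (0, y) ![(0, a), (0, b)] := by
    filter_upwards [hσS] with y hy a b
    rw [← cbil_apply, hy, hS, hWa]
  have hσ0 : (σ 0).toAlternatingMap =
      (w 0).toAlternatingMap.compLinearMap (LinearMap.inr 𝕜 𝕜 (Hyp 𝕜 n)) := by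
    ext v
    have e1 : w 0 (fun i => LinearMap.inr 𝕜 𝕜 (Hyp 𝕜 n) (v i)) = w 0 ![(0, v 0), (0, v 1)] :=
      form_two_apply (w 0).toAlternatingMap _
    exact (form_two_apply _ v).trans ((hσa.self_of_nhds _ _).trans e1.symm)
  have hσs : SmoothNear 𝕜 r σ 0 := smoothNear_cbil_iff.1 (hSs.congr hσS)
  have hw'nf : w' =ᶠ[𝓝 0] normalForm α σ := by
    filter_upwards [hw'N, tendsto_snd_zero.eventually hαs,
      tendsto_snd_zero.eventually hσS] with x h1 h2 h3
    refine cbil_injective ?_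
    rw [h1, cbil_normalForm σ (h2.differentiableAt hr0), hαA]
    simp only [normalBilin, ContinuousLinearMap.coe_snd', h3]
  have hexp : ∀ y (a b : Amb 𝕜 n), W (0, y) a b =
      a.1 * A y b.2 - b.1 * A y a.2 + W (0, y) (0, a.2) (0, b.2) := by
    intro y a b
    have ea : ∀ a : Amb 𝕜 n, a = a.1 • ((1 : 𝕜), (0 : Hyp 𝕜 n)) + (0, a.2) := fun a => by
      ext <;> simp
    have e0 : W (0, y) (1, 0) (1, 0) = 0 := self_eq_neg.1 (hWskew _ _ _)
    have e1 : W (0, y) a b = W (0, y) (a.1 • ((1 : 𝕜), (0 : Hyp 𝕜 n)) + (0, a.2))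
        (b.1 • ((1 : 𝕜), (0 : Hyp 𝕜 n)) + (0, b.2)) := by rw [← ea, ← ea]
    rw [e1]
    simp only [map_add, map_smul, add_apply, smul_apply, smul_eq_mul, e0]
    rw [hA, hA, hWskew _ (0, a.2) (1, 0)]
    ring
  refine ⟨⟨⟨hσs, ?_⟩, ?_, hαs, ?_, ?_⟩, hw'nf⟩
  · filter_upwards [hSc, hσs, eventually_eventually_nhds.2 hσS] with y h1 h2 h3
    exact (isClosedBilinAt_cbil_iff (h2.differentiableAt hr0)).1 (h1.congr h3)
  · rw [hσ0]
    exact hrank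
  · filter_upwards [tendsto_inr_zero.eventually hdeg, hσa] with y h1 h2
    refine (wedge_wedgePow_eq_zero_iff (m := n - 1) (by rw [hH]; omega)).2 ?_
    -- At a point of `{p₁ = 0}` the form `w` is `σ` bordered by `α`, so its degeneracy gives a
    -- common kernel vector of `α` and `σ`.
    refine (bordered_degenerate_iff (m := n - 1) (by rw [hH]; omega)
      (B := fun a b => W (0, y) a b) fun a b => ?_).1 ?_
    · change W (0, y) a b = a.1 * α y ![b.2] - b.1 * α y ![a.2] + σ y ![a.2, b.2]
      rw [hαa, hαa, h2, ← hWa]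
      exact hexp y a b
    · obtain ⟨v, hv, hv0⟩ := h1 rfl
      exact ⟨v, hv, fun b => by rw [hv0]; rfl⟩
  · have h0 := hσa.self_of_nhds
    have hrad : ∀ k, (∀ y, w 0 ![k, y] = 0) → ∀ y, σ 0 ![k.2, y] = 0 := fun k hk y => by
      rw [h0, ek k hk]
      exact hk _
    have hAk : ∀ k, (∀ y, w 0 ![k, y] = 0) → α 0 ![k.2] = 0 := fun k hk => by
      rw [hαa, hA, hWskew, ek k hk, hWa]
      exact neg_eq_zero.2 (hk _)
    refine contact_ne_zero_of_radical (m := n - 2) (by rw [hH]; omega)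
      (b := (σ 0).toAlternatingMap) ?_ (hrad k₁ hk₁) (hrad k₂ hk₂) (hAk k₁ hk₁) (hAk k₂ hk₂) ?_ ?_
    · rw [hσ0]
      omega
    · intro x hx hax
      have hx' : ∀ y, σ 0 ![x, y] = 0 := hx
      have hax' : A 0 x = 0 := (hαa _ _).symm.trans hax
      -- A vector in the radical of `σ|₀` killed by `α|₀` is a radical vector of `w|₀`, hence a
      -- combination of `k₁` and `k₂`.
      obtain ⟨s, t, hst⟩ := hsp (0, x) fun y => by
        have h1 := hexp 0 (0, x) y
        have h2 := h0 x y.2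
        rw [hx'] at h2
        rw [← hWa]
        refine h1.trans ?_
        rw [hWa, ← h2, hax']
        ring
      exact ⟨s, t, congrArg Prod.snd hst⟩
    · change extDeriv α 0 ![k₁.2, k₂.2] ≠ 0
      rw [extDeriv_one_apply (hαs.self.differentiableAt hr0), hαA, bilinDeriv_apply]
      exact hdA

end Reduction

/-! ### Part (a). -/

section Existence

variable {𝕜 : Type u} [RCLike 𝕜] {r : WithTop ℕ∞} {n : ℕ}

theorem IsDiffeoGerm.exists_right_inverse_fderiv {E : Type u} [NormedAddCommGroup E]
    [NormedSpace 𝕜 E] (hr : r = ((⊤ : ℕ∞) : WithTop ℕ∞) ∨ r = ⊤) {Φ : E → E}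
    (hΦ : IsDiffeoGerm 𝕜 r Φ) : ∃ M : E →L[𝕜] E, ∀ a, fderiv 𝕜 Φ 0 (M a) = a := by
  have hn := ne_zero_of_infty_or_top hr
  obtain ⟨h1, h2, Ψ, h3, h4, h5, h6⟩ := hΦ
  have hΨ : HasFDerivAt Ψ (fderiv 𝕜 Ψ 0) 0 :=
    ((SmoothNear.self h3).differentiableAt hn).hasFDerivAt
  have hΦ : HasFDerivAt Φ (fderiv 𝕜 Φ 0) (Ψ 0) := by
    rw [h4]; exact ((SmoothNear.self h1).differentiableAt hn).hasFDerivAt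
  have h7 : HasFDerivAt (fun y => Φ (Ψ y)) ((fderiv 𝕜 Φ 0).comp (fderiv 𝕜 Ψ 0)) 0 :=
    hΦ.comp 0 hΨ
  have h8 := h7.unique ((hasFDerivAt_id (0 : E)).congr_of_eventuallyEq h6)
  exact ⟨fderiv 𝕜 Ψ 0, fun a => congrArg (fun L => L a) h8⟩

theorem pullback_comp_eventuallyEq {E : Type u} [NormedAddCommGroup E] [NormedSpace 𝕜 E]
    (hr : r = ((⊤ : ℕ∞) : WithTop ℕ∞) ∨ r = ⊤) {Φ Ψ : E → E} (hΦ : IsDiffeoGerm 𝕜 r Φ)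
    (hΨ : IsDiffeoGerm 𝕜 r Ψ) (w : E → E [⋀^Fin 2]→L[𝕜] 𝕜) :
    pullback (fun x => Φ (Ψ x)) w =ᶠ[𝓝 0] pullback Ψ (pullback Φ w) := by
  filter_upwards [hΨ.differentiableAt hr, hΨ.tendsto.eventually (hΦ.differentiableAt hr)]
    with x h1 h2
  have h3 : fderiv 𝕜 (fun x => Φ (Ψ x)) x = (fderiv 𝕜 Φ (Ψ x)).comp (fderiv 𝕜 Ψ x) :=
    (h2.hasFDerivAt.comp x h1.hasFDerivAt).fderiv
  simp only [pullback, h3]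
  rfl

/-- Reduction of a singular symplectic form-germ with structurally smooth Martinet hypersurface
to the normal form. -/
theorem exists_reduction (hr : r = ((⊤ : ℕ∞) : WithTop ℕ∞) ∨ r = ⊤) (hn : 2 ≤ n)
    {w : Amb 𝕜 n → Amb 𝕜 n [⋀^Fin 2]→L[𝕜] 𝕜} {f : Amb 𝕜 n → 𝕜} (hw : IsClosedTwoFormGerm r w)
    (hf : IsStructurallySmooth r w f) (hrank : restrictedRank w f ≤ 2 * n - 4) :
    ∃ (Φ : Amb 𝕜 n → Amb 𝕜 n) (α : Hyp 𝕜 n → Hyp 𝕜 n [⋀^Fin 1]→L[𝕜] 𝕜)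
      (σ : Hyp 𝕜 n → Hyp 𝕜 n [⋀^Fin 2]→L[𝕜] 𝕜), IsDiffeoGerm 𝕜 r Φ ∧
      σ = pullback incl (pullback Φ w) ∧ IsAdmissible r α σ ∧
      pullback Φ w =ᶠ[𝓝 0] normalForm α σ := by
  have hr0 := ne_zero_of_infty_or_top hr
  obtain ⟨⟨hfs, Ω, hΩ, hΩ0, hpow⟩, hf0, hdf⟩ := hf
  obtain ⟨Φ, hΦ, hfΦ⟩ := exists_straightening hr hfs hf0 hdf
  have hws : SmoothNear 𝕜 r w 0 := hw.1
  have hΦ0 : Φ 0 = 0 := hΦ.2.1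
  have hΦs : SmoothNear 𝕜 r Φ 0 := hΦ.1
  have hcl : IsClosedTwoFormGerm r (pullback Φ w) := by
    refine ⟨SmoothNear.pullback hr hΦs (by rwa [hΦ0]), ?_⟩
    filter_upwards [hΦs, hΦ.tendsto.eventually hws, hΦ.tendsto.eventually hw.2] with x h1 h2 h3
    exact extDeriv_pullback_eq_zero hr h1 h2 h3
  set Ω' : Amb 𝕜 n → Amb 𝕜 n [⋀^Fin (2 * n)]→ₗ[𝕜] 𝕜 := fun x =>
    (Ω (Φ x)).toAlternatingMap.compLinearMap (fderiv 𝕜 Φ x : Amb 𝕜 n →ₗ[𝕜] Amb 𝕜 n) with hΩ'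
  have hΩ'c : ∀ v, ContinuousAt (fun x => Ω' x v) 0 := by
    intro v
    have h1 : ContinuousAt (fun x => Ω (Φ x)) 0 :=
      ContinuousAt.comp (by rw [hΦ0]; exact SmoothNear.continuousAt hΩ) hΦs.continuousAt
    have h2 : ContinuousAt (fun x => fun i => fderiv 𝕜 Φ x (v i)) 0 :=
      continuousAt_pi.2 fun i => (hΦs.fderiv hr).continuousAt.clm_apply continuousAt_const
    exact h1.eval h2
  have hΩ'0 : Ω' 0 ≠ 0 := by
    obtain ⟨M, hM⟩ := hΦ.exists_right_inverse_fderiv hr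
    intro h0
    refine hΩ0 ?_
    ext v
    have h1 := congrArg (fun a => a (fun i => M (v i))) h0
    have h2 : Ω (Φ 0) (fun i => fderiv 𝕜 Φ 0 (M (v i))) = 0 := h1
    simp only [hM, hΦ0] at h2
    exact h2
  have hpow' : ∀ᶠ x in 𝓝 0, powAt (pullback Φ w) n x = x.1 • Ω' x := by
    filter_upwards [hΦ.tendsto.eventually hpow, hfΦ] with x h1 h2
    have h3 : powAt (pullback Φ w) n x = (powAt w n (Φ x)).compLinearMap
      (fderiv 𝕜 Φ x : Amb 𝕜 n →ₗ[𝕜] Amb 𝕜 n) :=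
        wedgePow_comp (w (Φ x)).toAlternatingMap (fderiv 𝕜 Φ x : Amb 𝕜 n →ₗ[𝕜] Amb 𝕜 n) n
    rw [h3, h1, h2]
    rfl
  have hker : ∀ y : Hyp 𝕜 n, fderiv 𝕜 f 0 (fderiv 𝕜 Φ 0 (0, y)) = 0 := by
    intro y
    have h1 : HasFDerivAt f (fderiv 𝕜 f 0) (Φ 0) := by
      rw [hΦ0]; exact ((SmoothNear.self hfs).differentiableAt hr0).hasFDerivAt
    have h2 : HasFDerivAt (fun x => f (Φ x)) ((fderiv 𝕜 f 0).comp (fderiv 𝕜 Φ 0)) 0 :=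
      h1.comp 0 (hΦs.self.differentiableAt hr0).hasFDerivAt
    have h3 := h2.unique (hasFDerivAt_fst.congr_of_eventuallyEq hfΦ)
    exact congrArg (fun L => L ((0 : 𝕜), y)) h3
  have hrank' : formRank ((pullback Φ w 0).toAlternatingMap.compLinearMap
      (LinearMap.inr 𝕜 𝕜 (Hyp 𝕜 n))) ≤ 2 * n - 4 := by
    -- Since `f ∘ Φ = p₁`, the derivative of `Φ` carries `{p₁ = 0}` into the kernel of `df`; rank
    -- does not grow under pull-back.
    let L : Hyp 𝕜 n →ₗ[𝕜] LinearMap.ker (fderiv 𝕜 f 0 : Amb 𝕜 n →ₗ[𝕜] 𝕜) :=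
      ((fderiv 𝕜 Φ 0 : Amb 𝕜 n →ₗ[𝕜] Amb 𝕜 n).comp (LinearMap.inr 𝕜 𝕜 (Hyp 𝕜 n))).codRestrict _ hker
    have e : (pullback Φ w 0).toAlternatingMap.compLinearMap (LinearMap.inr 𝕜 𝕜 (Hyp 𝕜 n)) =
        ((w 0).toAlternatingMap.compLinearMap
          (LinearMap.ker (fderiv 𝕜 f 0 : Amb 𝕜 n →ₗ[𝕜] 𝕜)).subtype).compLinearMap L := by
      ext v
      change w (Φ 0) _ = w 0 _
      rw [hΦ0]
      rfl
    rw [e]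
    exact (formRank_compLinearMap_le _ _).trans hrank
  obtain ⟨Ψ, α, hΨ, h⟩ := exists_normalForm hr hn hcl hΩ'c hΩ'0 hpow' hrank'
  have h1 := h _ (pullback_comp_eventuallyEq hr hΦ hΨ w)
  exact ⟨_, α, _, hΦ.comp hΨ, rfl, h1.1, h1.2⟩

end Existence

/-! ### Rescaling p₁ and deforming α with σ fixed. -/

section Scaling

variable {𝕜 : Type u} [RCLike 𝕜] {r : WithTop ℕ∞}
variable {H : Type u} [NormedAddCommGroup H] [NormedSpace 𝕜 H]

/-- Rescaling of the transversal coordinate. -/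
theorem germEquivalent_normalBilin_smul [FiniteDimensional 𝕜 H]
    (hr : r = ((⊤ : ℕ∞) : WithTop ℕ∞) ∨ r = ⊤) {A : H → H →L[𝕜] 𝕜}
    (S : H → H →L[𝕜] H →L[𝕜] 𝕜) (hA : SmoothNear 𝕜 r A 0) {c : 𝕜} (hc : c ≠ 0) :
    GermEquivalent 𝕜 r (normalBilin (fun y => c • A y) S) (normalBilin A S) := by
  have hn := ne_zero_of_infty_or_top hr
  have _ : CompleteSpace H := FiniteDimensional.complete 𝕜 H
  let L : (𝕜 × H) ≃L[𝕜] (𝕜 × H) :=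
    (ContinuousLinearEquiv.unitsEquivAut 𝕜 (Units.mk0 c hc)).prodCongr
      (ContinuousLinearEquiv.refl 𝕜 H)
  have hL : ∀ x, L x = (x.1 * c, x.2) := fun x => rfl
  have hL' : ∀ x, HasFDerivAt L (L : 𝕜 × H →L[𝕜] 𝕜 × H) x :=
    fun x => (L : 𝕜 × H →L[𝕜] 𝕜 × H).hasFDerivAt
  refine ⟨L, isDiffeoGerm_of_fderiv hr (ContDiff.smoothNear L.contDiff 0) (map_zero L) L (hL' 0), ?_⟩
  filter_upwards [tendsto_snd_zero.eventually hA] with x hx a b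
  have h1 : DifferentiableAt 𝕜 A x.2 := hx.differentiableAt hn
  have h1c : DifferentiableAt 𝕜 (fun y => c • A y) x.2 := h1.const_smul c
  rw [(hL' x).fderiv, normalBilin_apply S (z := L x) h1, normalBilin_apply S (z := x) h1c]
  have h2 : fderiv 𝕜 (fun y => c • A y) x.2 = c • fderiv 𝕜 A x.2 := fderiv_fun_const_smul h1 c
  rw [h2]
  simp only [ContinuousLinearEquiv.coe_coe, hL, smul_apply, smul_eq_mul]
  ring

/-- Moser's argument for normal forms with the same core. -/
theorem germEquivalent_normalBilin_of_path [FiniteDimensional 𝕜 H]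
    (hr : r = ((⊤ : ℕ∞) : WithTop ℕ∞) ∨ r = ⊤) {A₀ A₁ : H → H →L[𝕜] 𝕜}
    {S : H → H →L[𝕜] H →L[𝕜] 𝕜} (hA₀ : SmoothNear 𝕜 r A₀ 0) (hA₁ : SmoothNear 𝕜 r A₁ 0)
    (hS : SmoothNear 𝕜 r S 0) (hskew : ∀ y a b, S y a b = -S y b a)
    (hc : ∀ᶠ y in 𝓝 0, IsClosedBilinAt S y)
    (hdeg : ∀ᶠ y in 𝓝 0, ∀ t : 𝕜, ∃ x, x ≠ 0 ∧ A₀ y x + t * (A₁ y x - A₀ y x) = 0 ∧ S y x = 0)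
    {h₁ h₂ h₃ : H} (hS₁ : S 0 h₁ = 0) (hS₂ : S 0 h₂ = 0) (hS₃ : S 0 h₃ = 0)
    (h01 : A₀ 0 h₁ = 0) (h02 : A₀ 0 h₂ = 0) (h03 : A₀ 0 h₃ = 1)
    (h11 : A₁ 0 h₁ = 0) (h12 : A₁ 0 h₂ = 0) (h13 : A₁ 0 h₃ = 1)
    (hsp : ∀ x, S 0 x = 0 → ∃ a b c : 𝕜, x = a • h₃ + b • h₁ + c • h₂)
    {T : Set 𝕜} (hT : IsPreconnected T) (hT0 : (0 : 𝕜) ∈ T) (hT1 : (1 : 𝕜) ∈ T)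
    (hne : ∀ t ∈ T, bilinDeriv A₀ 0 h₁ h₂ + t * (bilinDeriv A₁ 0 h₁ h₂ - bilinDeriv A₀ 0 h₁ h₂) ≠ 0) :
    GermEquivalent 𝕜 r (normalBilin A₀ S) (normalBilin A₁ S) := by
  have hn := ne_zero_of_infty_or_top hr
  have happly : ∀ {y : H}, ContDiffAt 𝕜 r A₀ y → ContDiffAt 𝕜 r A₁ y → ∀ (t : 𝕜) (a b : 𝕜 × H),
      (normalBilin A₀ S (0, y) + t • (normalBilin A₁ S (0, y) - normalBilin A₀ S (0, y))) a b =
        a.1 * (A₀ y b.2 + t * (A₁ y b.2 - A₀ y b.2)) -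
          b.1 * (A₀ y a.2 + t * (A₁ y a.2 - A₀ y a.2)) + S y a.2 b.2 := by
    intro y h0 h1 t a b
    simp only [add_apply, smul_apply, sub_apply, smul_eq_mul]
    rw [normalBilin_apply S (z := (0, y)) (h0.differentiableAt hn),
      normalBilin_apply S (z := (0, y)) (h1.differentiableAt hn)]
    ring
  have hrad : ∀ (t : 𝕜) v,
      (normalBilin A₀ S 0 + t • (normalBilin A₁ S 0 - normalBilin A₀ S 0)) v = 0 →
        ∃ a b : 𝕜, v = a • ((0 : 𝕜), h₁) + b • ((0 : 𝕜), h₂) := by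
    intro t v hv
    have h : ∀ b : 𝕜 × H, v.1 * (A₀ 0 b.2 + t * (A₁ 0 b.2 - A₀ 0 b.2)) -
        b.1 * (A₀ 0 v.2 + t * (A₁ 0 v.2 - A₀ 0 v.2)) + S 0 v.2 b.2 = 0 := fun b => by
      rw [← happly hA₀.self hA₁.self t v b]
      change (normalBilin A₀ S 0 + t • (normalBilin A₁ S 0 - normalBilin A₀ S 0)) v b = 0
      rw [hv]; rfl
    -- Pairing with `h₃`, on which every interpolated `A` equals 1, isolates the `p₁`-component.
    -- This is why both forms are normalized on `h₃`.
    have hv1 : v.1 = 0 := by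
      have := h (0, h₃)
      rw [hskew, hS₃] at this
      simpa [h03, h13] using this
    have hSv : S 0 v.2 = 0 := ContinuousLinearMap.ext fun y => by
      simpa [hv1] using h (0, y)
    obtain ⟨a, b, c, habc⟩ := hsp _ hSv
    have ha : a = 0 := by
      have := h (1, 0)
      rw [habc] at this
      simpa [hv1, h01, h02, h03, h11, h12, h13, hS₁, hS₂, hS₃] using this
    rw [ha, zero_smul, zero_add] at habc
    exact ⟨b, c, by ext1 <;> simp [hv1, habc]⟩
  refine germEquivalent_of_path hr (SmoothNear.normalBilin hr hA₀ hS) (SmoothNear.normalBilin hr hA₁ hS)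
    (normalBilin_skew A₀ hskew) (normalBilin_skew A₁ hskew)
    (isClosedBilinAt_normalBilin hr hA₀ hS hc) (isClosedBilinAt_normalBilin hr hA₁ hS hc)
    (ℓ := ContinuousLinearMap.fst 𝕜 𝕜 H) (e := ((1 : 𝕜), (0 : H))) rfl
    -- The primitive is explicit, so no Poincaré lemma is needed.
    (β := liftForm fun y => A₁ y - A₀ y) ?_ ?_ ?_ hT hT0 hT1 ?_ ?_
  · refine SmoothNear.liftForm ?_
    filter_upwards [hA₀, hA₁] with y h0 h1
    exact h1.sub h0
  · filter_upwards [tendsto_snd_zero.eventually hA₀, tendsto_snd_zero.eventually hA₁]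
      with z h0 h1 a b
    have h0' := h0.differentiableAt hn
    have h1' := h1.differentiableAt hn
    have hsub : fderiv 𝕜 (fun y => A₁ y - A₀ y) z.2 = fderiv 𝕜 A₁ z.2 - fderiv 𝕜 A₀ z.2 :=
      fderiv_fun_sub h1' h0'
    have hsub' : DifferentiableAt 𝕜 (fun y => A₁ y - A₀ y) z.2 := h1'.sub h0'
    rw [fderiv_fst_smul_liftForm hsub', fderiv_fst_smul_liftForm hsub',
      normalBilin_apply S h0', normalBilin_apply S h1', hsub]
    simp only [sub_apply]
    ring
  · filter_upwards [tendsto_snd_zero.eventually hA₀, tendsto_snd_zero.eventually hA₁,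
      tendsto_snd_zero.eventually hdeg] with z h0 h1 h2 hz t
    have hz' : z = (0, z.2) := Prod.ext hz rfl
    rw [hz']
    obtain ⟨x, hx, hx1, hx2⟩ := h2 t
    refine ⟨(0, x), fun h => hx (congrArg Prod.snd h), ContinuousLinearMap.ext fun b => ?_⟩
    rw [happly h0 h1]
    simp [hx1, hx2]
  · intro t ht
    have hk : ∀ h : H, S 0 h = 0 → A₀ 0 h = 0 → A₁ 0 h = 0 →
        (normalBilin A₀ S 0 + t • (normalBilin A₁ S 0 - normalBilin A₀ S 0)) (0, h) = 0 :=
      fun h e1 e2 e3 => ContinuousLinearMap.ext fun b => by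
        refine (happly hA₀.self hA₁.self t (0, h) b).trans ?_
        simp [e1, e2, e3]
    refine ⟨(0, h₁), (0, h₂), hk h₁ hS₁ h01 h11, hk h₂ hS₂ h02 h12, hrad t, ?_⟩
    rw [fderiv_normalBilin hr hA₀ hS, fderiv_normalBilin hr hA₁ hS]
    exact hne t ht
  · intro t v hv
    obtain ⟨a, b, rfl⟩ := hrad t v hv
    simp [liftForm_apply, h01, h02, h11, h12]

/-- Over ℝ the segment works, because a convex combination of 1 and `c > 0` is positive. Over ℂ the
affine function has at most one zero, and the complement of a countable set in the plane is
connected. -/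
theorem exists_preconnected_ne_zero {𝕜 : Type*} [RCLike 𝕜] {a b : 𝕜} (ha : a ≠ 0) (hb : b ≠ 0)
    (h : (RCLike.I : 𝕜) = 0 → ∃ c : ℝ, 0 < c ∧ b = c * a) :
    ∃ T : Set 𝕜, IsPreconnected T ∧ 0 ∈ T ∧ 1 ∈ T ∧ ∀ t ∈ T, a + t * (b - a) ≠ 0 := by
  by_cases hI : (RCLike.I : 𝕜) = 0
  · obtain ⟨c, hc, rfl⟩ := h hI
    refine ⟨(fun s : ℝ => (s : 𝕜)) '' Set.Icc 0 1,
      isPreconnected_Icc.image _ RCLike.continuous_ofReal.continuousOn, ⟨0, by simp, by simp⟩,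
      ⟨1, by simp, by simp⟩, ?_⟩
    rintro _ ⟨s, hs, rfl⟩
    have e : a + (s : 𝕜) * (c * a - a) = ((1 - s + s * c : ℝ) : 𝕜) * a := by
      push_cast; ring
    simp only [e]
    refine mul_ne_zero (RCLike.ofReal_ne_zero.2 (ne_of_gt ?_)) ha
    rcases hs.1.eq_or_lt with h0 | h0
    · rw [← h0]; simp
    · have := mul_pos h0 hc
      linarith [hs.2]
  · have him : RCLike.im (RCLike.I : 𝕜) = 1 := RCLike.I_eq_zero_or_im_I_eq_one.resolve_left hI
    have hrk : 1 < Module.rank ℝ 𝕜 := by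
      have h2 : Module.finrank ℝ 𝕜 = 2 := by
        rw [(RCLike.complexLinearIsometryEquiv him).toLinearEquiv.finrank_eq,
          Complex.finrank_real_complex]
      exact_mod_cast Module.lt_rank_of_lt_finrank (n := 1) (by rw [h2]; norm_num)
    have hcount : {t : 𝕜 | a + t * (b - a) = 0}.Countable := by
      refine Set.Subsingleton.countable fun s hs t ht => ?_
      have hs' : a + s * (b - a) = 0 := hs
      have ht' : a + t * (b - a) = 0 := ht
      have hba : b - a ≠ 0 := fun h0 => ha (by rwa [h0, mul_zero, add_zero] at hs')
      exact mul_right_cancel₀ hba (by linear_combination hs' - ht')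
    refine ⟨{t : 𝕜 | a + t * (b - a) = 0}ᶜ,
      (hcount.isPathConnected_compl_of_one_lt_rank hrk).isConnected.isPreconnected, ?_, ?_,
      fun t ht => ht⟩
    · simpa using ha
    · simpa using hb

end Scaling

/-! ### Part (b). -/

section Uniqueness

variable {𝕜 : Type u} [RCLike 𝕜] {r : WithTop ℕ∞} {n : ℕ}

/-- Normal forms with the same core are equivalent when their contact data are compatible. -/
theorem exists_equivalence (hr : r = ((⊤ : ℕ∞) : WithTop ℕ∞) ∨ r = ⊤) (hn : 2 ≤ n)
    {σ : Hyp 𝕜 n → Hyp 𝕜 n [⋀^Fin 2]→L[𝕜] 𝕜} {α₀ α₁ : Hyp 𝕜 n → Hyp 𝕜 n [⋀^Fin 1]→L[𝕜] 𝕜}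
    (h₀ : IsAdmissible r α₀ σ) (h₁ : IsAdmissible r α₁ σ)
    (hsign : (RCLike.I : 𝕜) = 0 → ∃ c : ℝ, 0 < c ∧
      contactAt α₁ σ (n - 2) 0 = (c : 𝕜) • contactAt α₀ σ (n - 2) 0)
    (hpar : wedge (wedge (α₁ 0).toAlternatingMap (α₀ 0).toAlternatingMap)
      (powAt σ (n - 2) 0) = 0) :
    ∃ Ψ : Amb 𝕜 n → Amb 𝕜 n, IsDiffeoGerm 𝕜 r Ψ ∧
      pullback Ψ (normalForm α₁ σ) =ᶠ[𝓝 0] normalForm α₀ σ := by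
  have hr0 := ne_zero_of_infty_or_top hr
  have hH : Module.finrank 𝕜 (Hyp 𝕜 n) = 2 * n - 1 := finrank_hyp
  have hα₀ : SmoothNear 𝕜 r α₀ 0 := h₀.germ
  have hα₁ : SmoothNear 𝕜 r α₁ 0 := h₁.germ
  have hσ : SmoothNear 𝕜 r σ 0 := h₀.closed.1
  obtain ⟨x₁, x₂, x₃, u, hF⟩ := exists_isContactFrame (m := n - 2) (by rw [hH]; omega)
    (a := (α₀ 0).toAlternatingMap) (θ := (extDeriv α₀ 0).toAlternatingMap)
    (b := (σ 0).toAlternatingMap) (h₀.rank_le.trans (by omega)) h₀.contact_ne_zero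
  have hx₁ : ∀ y, σ 0 ![x₁, y] = 0 := hF.radical 1
  have hx₂ : ∀ y, σ 0 ![x₂, y] = 0 := hF.radical 2
  have hx₃ : ∀ y, σ 0 ![x₃, y] = 0 := hF.radical 0
  -- Condition 2 is evaluated on `(x, x₃, u)`: since `α₀(x) = 0`, only `α₁(x) α₀(x₃) σ^{n-2}(u)`
  -- remains, whose last two factors are nonzero.
  have hone : ∀ x, (∀ y, σ 0 ![x, y] = 0) → α₀ 0 ![x] = 0 → α₁ 0 ![x] = 0 := by
    intro x hx hax
    have h1 := congrArg (fun c => c (Fin.append (Fin.append ![x] ![x₃]) u)) hpar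
    have h2 := (wedge_wedgePow_apply (m := n - 2) (b := (σ 0).toAlternatingMap)
      (wedge (α₁ 0).toAlternatingMap (α₀ 0).toAlternatingMap)
      (h := (Fin.append ![x] ![x₃] : Fin (1 + 1) → Hyp 𝕜 n))
      (fun i => by
        fin_cases i
        · exact hx
        · exact hx₃) u).symm.trans h1
    rw [wedge_one_one_apply (α₁ 0).toAlternatingMap (c := (α₀ 0).toAlternatingMap) x₃ hax,
      hF.apply_three, mul_one] at h2
    exact (mul_eq_zero.1 h2).resolve_right hF.pow_ne_zero
  have h11 : α₁ 0 ![x₁] = 0 := hone x₁ hx₁ hF.apply_one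
  have h12 : α₁ 0 ![x₂] = 0 := hone x₂ hx₂ hF.apply_two
  have hcontact : ∀ α : Hyp 𝕜 n → Hyp 𝕜 n [⋀^Fin 1]→L[𝕜] 𝕜, α 0 ![x₁] = 0 → α 0 ![x₂] = 0 →
      contactAt α σ (n - 2) 0 (Fin.append (Fin.append ![x₃] ![x₁, x₂]) u) =
        α 0 ![x₃] * extDeriv α 0 ![x₁, x₂] * wedgePow (σ 0).toAlternatingMap (n - 2) u := by
    intro α e1 e2
    refine (wedge_wedgePow_apply (b := (σ 0).toAlternatingMap) _ hF.radical u).trans ?_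
    rw [wedge_one_two_apply (a := (α 0).toAlternatingMap) (extDeriv α 0).toAlternatingMap x₃ e1 e2]
    rfl
  set c := α₁ 0 ![x₃] with hc
  set δ₀ := extDeriv α₀ 0 ![x₁, x₂] with hδ₀
  set δ₁ := extDeriv α₁ 0 ![x₁, x₂] with hδ₁
  have hcδ : c ≠ 0 ∧ δ₁ ≠ 0 := by
    have h1 := apply_ne_zero_of_linearIndependent (by rw [hH]; omega) h₁.contact_ne_zero
      hF.linearIndependent
    rw [hcontact α₁ h11 h12] at h1
    exact ⟨left_ne_zero_of_mul (left_ne_zero_of_mul h1),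
      right_ne_zero_of_mul (left_ne_zero_of_mul h1)⟩
  have hδ₀0 : δ₀ ≠ 0 := hF.two_ne_zero
  set S : Hyp 𝕜 n → Hyp 𝕜 n →L[𝕜] Hyp 𝕜 n →L[𝕜] 𝕜 := fun y => cbil 𝕜 _ (σ y) with hSdef
  set A₀ : Hyp 𝕜 n → Hyp 𝕜 n →L[𝕜] 𝕜 := fun y => clin 𝕜 _ (α₀ y) with hA₀def
  set A₁ : Hyp 𝕜 n → Hyp 𝕜 n →L[𝕜] 𝕜 := fun y => clin 𝕜 _ (α₁ y) with hA₁def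
  -- After division by `c` the two forms agree on `x₁`, `x₂`, `x₃`, hence on the radical of `σ|₀`.
  set A' : Hyp 𝕜 n → Hyp 𝕜 n →L[𝕜] 𝕜 := fun y => c⁻¹ • A₁ y with hA'def
  have hA₀ : SmoothNear 𝕜 r A₀ 0 := hα₀.mono fun y hy =>
    (clin 𝕜 (Hyp 𝕜 n)).contDiff.contDiffAt.comp y hy
  have hA₁ : SmoothNear 𝕜 r A₁ 0 := hα₁.mono fun y hy =>
    (clin 𝕜 (Hyp 𝕜 n)).contDiff.contDiffAt.comp y hy
  have hA' : SmoothNear 𝕜 r A' 0 := hA₁.mono fun y hy => hy.const_smul c⁻¹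
  have hS : SmoothNear 𝕜 r S 0 := smoothNear_cbil_iff.2 hσ
  have hA₁' : A₁ = fun y => c • A' y := by
    funext y
    rw [hA'def, smul_smul, mul_inv_cancel₀ hcδ.1, one_smul]
  have a₀ : ∀ y x, A₀ y x = α₀ y ![x] := fun y x => clin_apply _ _
  have a' : ∀ y x, A' y x = c⁻¹ * α₁ y ![x] := fun y x =>
    congrArg (c⁻¹ * ·) (clin_apply (α₁ y) x)
  have hSx : ∀ x, (∀ y, σ 0 ![x, y] = 0) → S 0 x = 0 := fun x hx =>
    ContinuousLinearMap.ext fun y => (cbil_apply _ _ _).trans (hx y)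
  have d₀ : bilinDeriv A₀ 0 x₁ x₂ = δ₀ :=
    (extDeriv_one_apply (hα₀.self.differentiableAt hr0) _ _).symm
  have d' : bilinDeriv A' 0 x₁ x₂ = c⁻¹ * δ₁ := by
    have h1 : bilinDeriv A₁ 0 x₁ x₂ = δ₁ :=
      (extDeriv_one_apply (hα₁.self.differentiableAt hr0) _ _).symm
    have h2 : fderiv 𝕜 A' 0 = c⁻¹ • fderiv 𝕜 A₁ 0 :=
      fderiv_fun_const_smul (hA₁.self.differentiableAt hr0) c⁻¹
    rw [← h1, bilinDeriv_apply, bilinDeriv_apply, h2]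
    simp only [smul_apply, smul_eq_mul]
    ring
  obtain ⟨T, hT, hT0, hT1, hTne⟩ := exists_preconnected_ne_zero hδ₀0
    (mul_ne_zero (inv_ne_zero hcδ.1) hcδ.2) (fun hI => by
      obtain ⟨s, hs, hsc⟩ := hsign hI
      have h1 := congrArg (fun g => g (Fin.append (Fin.append ![x₃] ![x₁, x₂]) u)) hsc
      simp only [AlternatingMap.smul_apply, smul_eq_mul] at h1
      have h3 : α₀ 0 ![x₃] = 1 := hF.apply_three
      rw [hcontact α₁ h11 h12, hcontact α₀ hF.apply_one hF.apply_two, h3, one_mul,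
        ← mul_assoc] at h1
      have h2 : c * δ₁ = s * δ₀ := mul_right_cancel₀ hF.pow_ne_zero h1
      have hre : ((RCLike.re c : ℝ) : 𝕜) = c := by
        have := RCLike.re_add_im c
        rwa [hI, mul_zero, add_zero] at this
      have hre0 : RCLike.re c ≠ 0 := fun h0 => hcδ.1 (by rw [← hre, h0, RCLike.ofReal_zero])
      -- The sign condition reads `c δ₁ = s δ₀`, so `c⁻¹ δ₁ = (s / c²) δ₀`. The square makes the
      -- sign of `c` harmless: rescaling `p₁` may reverse it.
      refine ⟨s / (RCLike.re c) ^ 2, div_pos hs (by positivity), ?_⟩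
      rw [RCLike.ofReal_div, RCLike.ofReal_pow, hre]
      have hc0 := hcδ.1
      field_simp
      linear_combination h2)
  have hequiv : GermEquivalent 𝕜 r (normalBilin A₀ S) (normalBilin A' S) := by
    refine germEquivalent_normalBilin_of_path hr hA₀ hA' hS (fun y a b => cbil_skew _ _ _) ?_ ?_
      (hSx x₁ hx₁) (hSx x₂ hx₂) (hSx x₃ hx₃) ((a₀ _ _).trans hF.apply_one)
      ((a₀ _ _).trans hF.apply_two) ((a₀ _ _).trans hF.apply_three) (by rw [a', h11, mul_zero])
      (by rw [a', h12, mul_zero]) (by rw [a', ← hc, inv_mul_cancel₀ hcδ.1])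
      (fun x hx => hF.span x fun y => by
        have h1 : S 0 x y = σ 0 ![x, y] := cbil_apply _ _ _
        rw [hx] at h1
        exact h1.symm) hT hT0 hT1 (by rwa [d₀, d'])
    · filter_upwards [hσ, h₀.closed.2] with y h1 h2
      exact (isClosedBilinAt_cbil_iff (h1.differentiableAt hr0)).2 h2
    -- The equation `α ∧ σ^{n-1} = 0` is linear in `α`, so it holds for every interpolated form and
    -- yields a common kernel vector with `σ`.
    · filter_upwards [h₀.wedge_eq_zero, h₁.wedge_eq_zero] with y e0 e1 t
      have h1 : wedge ((1 - t) • (α₀ y).toAlternatingMap + (t * c⁻¹) • (α₁ y).toAlternatingMap)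
          (wedgePow (σ y).toAlternatingMap (n - 1)) = 0 := by
        rw [add_wedge, smul_wedge, smul_wedge]
        have e0' : wedge (α₀ y).toAlternatingMap (wedgePow (σ y).toAlternatingMap (n - 1)) = 0 := e0
        have e1' : wedge (α₁ y).toAlternatingMap (wedgePow (σ y).toAlternatingMap (n - 1)) = 0 := e1
        rw [e0', e1', smul_zero, smul_zero, add_zero]
      obtain ⟨x, hx, hax, hbx⟩ := (wedge_wedgePow_eq_zero_iff (m := n - 1) (by rw [hH]; omega)).1 h1
      refine ⟨x, hx, ?_, ContinuousLinearMap.ext fun z => (cbil_apply _ _ _).trans (hbx z)⟩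
      have h2 : (1 - t) * α₀ y ![x] + (t * c⁻¹) * α₁ y ![x] = 0 := hax
      rw [a₀, a']
      linear_combination h2
  have hequiv' : GermEquivalent 𝕜 r (normalBilin A₀ S) (normalBilin A₁ S) := by
    rw [hA₁']
    exact hequiv.trans hr ((germEquivalent_normalBilin_smul hr S hA' hcδ.1).symm hr)
  obtain ⟨Ψ, hΨ, h⟩ := hequiv'
  refine ⟨Ψ, hΨ, ?_⟩
  filter_upwards [h, tendsto_snd_zero.eventually hα₀,
    hΨ.tendsto.eventually (tendsto_snd_zero.eventually hα₁)] with x h1 h2 h3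
  refine cbil_injective ?_
  rw [cbil_pullback, cbil_normalForm σ (h2.differentiableAt hr0),
    cbil_normalForm σ (h3.differentiableAt hr0)]
  exact ContinuousLinearMap.ext fun a => ContinuousLinearMap.ext fun b => h1 a b

end Uniqueness

end SingularSymplectic

end

theorem mainTheorem1 {𝕜 : Type*} [RCLike 𝕜] {r : WithTop ℕ∞}
    (hr : r = ((⊤ : ℕ∞) : WithTop ℕ∞) ∨ r = ⊤) {n : ℕ} (hn : 2 ≤ n) :
    (∀ (w : SingularSymplectic.Amb 𝕜 n → SingularSymplectic.Amb 𝕜 n [⋀^Fin 2]→L[𝕜] 𝕜)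
        (f : SingularSymplectic.Amb 𝕜 n → 𝕜),
      SingularSymplectic.IsSingularSymplecticGerm r w →
      SingularSymplectic.IsStructurallySmooth r w f →
      SingularSymplectic.restrictedRank w f ≤ 2 * n - 4 →
      ∃ (Φ : SingularSymplectic.Amb 𝕜 n → SingularSymplectic.Amb 𝕜 n)
        (α : SingularSymplectic.Hyp 𝕜 n → SingularSymplectic.Hyp 𝕜 n [⋀^Fin 1]→L[𝕜] 𝕜)
        (σ : SingularSymplectic.Hyp 𝕜 n → SingularSymplectic.Hyp 𝕜 n [⋀^Fin 2]→L[𝕜] 𝕜),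
        SingularSymplectic.IsDiffeoGerm 𝕜 r Φ ∧
        σ = SingularSymplectic.pullback SingularSymplectic.incl
          (SingularSymplectic.pullback Φ w) ∧
        SingularSymplectic.IsAdmissible r α σ ∧
        SingularSymplectic.pullback Φ w =ᶠ[𝓝 0] SingularSymplectic.normalForm α σ) ∧
    (∀ (σ : SingularSymplectic.Hyp 𝕜 n → SingularSymplectic.Hyp 𝕜 n [⋀^Fin 2]→L[𝕜] 𝕜)
        (α₀ α₁ : SingularSymplectic.Hyp 𝕜 n → SingularSymplectic.Hyp 𝕜 n [⋀^Fin 1]→L[𝕜] 𝕜),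
      SingularSymplectic.IsAdmissible r α₀ σ →
      SingularSymplectic.IsAdmissible r α₁ σ →
      -- the sign condition, only for `𝕂 = ℝ` (the case in which `I = 0`)
      ((RCLike.I : 𝕜) = 0 → ∃ c : ℝ, 0 < c ∧
        SingularSymplectic.contactAt α₁ σ (n - 2) 0 =
          (c : 𝕜) • SingularSymplectic.contactAt α₀ σ (n - 2) 0) →
      SingularSymplectic.wedge
        (SingularSymplectic.wedge (α₁ 0).toAlternatingMap (α₀ 0).toAlternatingMap)
        (SingularSymplectic.powAt σ (n - 2) 0) = 0 →
      ∃ Ψ : SingularSymplectic.Amb 𝕜 n → SingularSymplectic.Amb 𝕜 n,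
        SingularSymplectic.IsDiffeoGerm 𝕜 r Ψ ∧
        SingularSymplectic.pullback Ψ (SingularSymplectic.normalForm α₁ σ) =ᶠ[𝓝 0]
          SingularSymplectic.normalForm α₀ σ) := by
  exact ⟨fun w f hw hf hrank => SingularSymplectic.exists_reduction hr hn hw.1 hf hrank,
    fun σ α₀ α₁ h₀ h₁ hsign hpar =>
      SingularSymplectic.exists_equivalence hr hn h₀ h₁ hsign hpar⟩
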